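/- **Setting.** For each sample size $n\ge1$ let $p=p_n$, $s=s_n\ge 1$, and let $y_i=x_i^T\beta_0\mathbf 1[w_i\le\tau_0]+x_i^T\gamma_0\mathbf 1[w_i>\tau_0]+\varepsilon_i$, $i=1,\dots,n$, with $x_i\in\mathbb R^p$, $w_i,\varepsilon_i\in\mathbb R$, $\tau_0\in\mathbb R\cup\{-\infty\}$; all quantities may depend on $n$. Let $\Phi$ be the cdf of $w_i$ ($\Phi(-\infty)=0$), $\Phi_{\min}=\Phi\wedge(1-\Phi)$, $\xi_n=\|\beta_0-\gamma_0\|_2$, and $$Q(\tau,\beta,\gamma)=\frac1n\sum_{w_i\le\tau}(y_i-x_i^T\beta)^2+\frac1n\sum_{w_i>\tau}(y_i-x_i^T\gamma)^2 ,$$ $$S_n(\tau,\beta,\gamma)=Q(\tau,\beta,\gamma)-Q(\tau_0,\beta,\gamma)+\mu\big(\|\Phi(\tau)\|_0-\|\Phi(\tau_0)\|_0\big),\qquad \mu=\mu_n>0,$$ where $\|a\|_0=\mathbf 1[a\ne0]$ for $a\in\mathbb R$. Let $\mathcal H(u,v)=\{\tau\in\mathbb R: v\le|\Phi(\tau)-\Phi(\tau_0)|\le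 u\}$. For an initial value $\tau^{(0)}\in\mathbb R$ and $\lambda_1=\lambda_{1,n}$ let $(\hat\beta^{(0)},\hat\gamma^{(0)})$ be a minimizer of $Q(\tau^{(0)},\beta,\gamma)+\lambda_1(\|\beta\|_1+\|\gamma\|_1)$ over $\beta,\gamma\in\mathbb R^p$. **Assumptions.** The $x_i$ are i.i.d., mean zero and subgaussian with variance parameter at most $C$, and the eigenvalues of $Ex_ix_i^T$ lie in $[\kappa,\phi]$, $\kappa>0$; the $\varepsilon_i$ are i.i.d., mean zero and subgaussian with variance parameter at most $C$; the $w_i$ are i.i.d.; the $x_i,w_i,\varepsilon_i$ are independent of each other. At most $s$ coordinates are nonzero in $\beta_0$ or in $\gamma_0$. There is a sequence $0<l_n\le1/2$ with $s\log p/n\to0$, $s\log p/(nl_n^2)\to0$ and $\Phi_{\min}(\tau^{(0)})\ge c_I l_n$, $c_I>0$. If there is a change, i.e. $\Phi_{\min}(\tau_0)>0$, assume moreover that for some $k\in[1,\infty)$ and fixed constants $c_0,c_l,c_\xi>0$, with $u_n^{(0)}=1\wedge c_0\big(\frac{s\log p}{nl_n^2}\big)^{1/k}$: $|\Phi(\tau^{(0)})-\Phi(\tau_0)|\le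 u_n^{(0)}$, $\frac{s}{l_n^2}\big(\frac{s\log p}{nl_n^2}\big)^{1/k}\to0$, $\Phi_{\min}(\tau_0)\ge c_l l_n$ and $\xi_n>c_\xi$. In this case let $r_n=\max\{\sqrt{s\log p/n},\sqrt s\,\xi_nu_n^{(0)}\}/\Phi_{\min}(\tau_0)$. **Lemma.** (i) *No change.* There is $L_0>0$ such that for every $L_1\ge L_0$ there are $c,c_1,c_2>0$ for which the following holds. If $\Phi(\tau_0)=0$ and $L_0\sqrt{\log p/n}\le\lambda_1\le L_1\sqrt{\log p/n}$, then for any $v_n>0$ and all sufficiently large $n$, with probability at least $1-c_1\exp(-c_2\log p)$, $$\inf_{\tau\in\mathcal H(1,v_n)}S_n(\tau,\hat\beta^{(0)},\hat\gamma^{(0)})\ge\mu-c\,\frac{s\log p}{n\Phi_{\min}^2(\tau^{(0)})}.$$ Here $L_0,c,c_1,c_2$ depend only on $C,\kappa,\phi,c_I$ and, except for $L_0$, on $L_1$. (ii) *Finite change point.* Let $c_v>0$. There are $c_\mu>0$ and $L_0>0$ such that for every $L_1\ge L_0$ there are $c_3,\dots,c_6,c_1,c_2>0$ for which the following holds. If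 $\Phi_{\min}(\tau_0)>0$ and $L_0\rho_n\le\lambda_1\le L_1\rho_n$ with $\rho_n=\max\{\sqrt{\log p/n},\xi_nu_n^{(0)}\}$, then for any sequences $u_n\ge0$ and $v_n\ge c_v\log p/n$ and all sufficiently large $n$, with probability at least $1-c_1\exp(-c_2\log p)$, $$\inf_{\tau\in\mathcal H(u_n,v_n)}S_n(\tau,\hat\beta^{(0)},\hat\gamma^{(0)})\ge\xi_n^2\Big(c_3v_n-c_4\frac{s\log p}n-\frac{c_5}{1\vee\xi_n}\sqrt{\frac{s\log p}n}\max\Big\{\sqrt{\frac{\log p}n},\sqrt{u_n}\Big\}-c_6\frac{r_n^2}{1\vee\xi_n^2}\max\Big\{\frac{s\log p}n,u_n\Big\}-\frac{c_\mu\,\mu}{1\vee\xi_n^2}F(u_n)\Big),$$ where $F(u_n)=0$ if $u_n/\Phi_{\min}(\tau_0)\to0$ and $F(u_n)=1$ otherwise. Here $c_\mu$ depends only on $c_\xi$, and the other constants depend only on $C,\kappa,\phi,c_I,c_0,c_l,c_\xi,c_v$ and, except for $L_0$, on $L_1$. An infimum over the empty set is $+\infty$. How large $n$ must be may depend on all the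 sequences involved. -/

import Mathlib

open MeasureTheory ProbabilityTheory Filter Topology
open scoped NNReal ENNReal RealInnerProductSpace

namespace ChangePoint

/-- Vectors of `ℝᵖ` with the Euclidean norm. -/
abbrev Vec (p : ℕ) : Type := EuclideanSpace ℝ (Fin p)

/-- The `ℓ₁` norm. -/
def l1Norm {p : ℕ} (v : Vec p) : ℝ := ∑ j, |v j|

/-- The `ℓ₀` norm of a real number: the number (0 or 1) of its nonzero components. -/
noncomputable def l0Norm (a : ℝ) : ℝ := if a = 0 then 0 else 1

/-- The data of a change point regression with `n` observations and `p` predictors on a sample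
space `Ω`: the predictors `x i`, the change inducing variables `w i`, the errors `ε i`, the law of
the `w i`, the regression parameters before and after the change, and the change point.
The value `τ₀ = ⊥` stands for `-∞` (no change). -/
structure Model (n p : ℕ) (Ω : Type*) where
  x : Fin n → Ω → Vec p
  w : Fin n → Ω → ℝ
  ε : Fin n → Ω → ℝ
  wLaw : Measure ℝ
  β₀ : Vec p
  γ₀ : Vec p
  τ₀ : WithBot ℝ

namespace Model

variable {n p : ℕ} {Ω : Type*}

/-- The distribution function `Φ(τ)` of the `w i`, on `ℝ ∪ {-∞}`; `Φ(-∞) = 0`. -/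
noncomputable def Phi (M : Model n p Ω) (τ : WithBot ℝ) : ℝ :=
  M.wLaw.real {a : ℝ | (a : WithBot ℝ) ≤ τ}

/-- `Φ_min(τ) = Φ(τ) ∧ (1 - Φ(τ))`. -/
noncomputable def PhiMin (M : Model n p Ω) (τ : WithBot ℝ) : ℝ :=
  min (M.Phi τ) (1 - M.Phi τ)

/-- The jump size `ξ = ‖β₀ - γ₀‖₂`. -/
noncomputable def jump (M : Model n p Ω) : ℝ := ‖M.β₀ - M.γ₀‖

/-- The set of indices that are active in `β₀` or in `γ₀`. -/
def support (M : Model n p Ω) : Set (Fin p) := {j | M.β₀ j ≠ 0 ∨ M.γ₀ j ≠ 0}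

/-- The response: `x_iᵀ β₀ + ε_i` if `w_i ≤ τ₀` and `x_iᵀ γ₀ + ε_i` if `w_i > τ₀`. -/
noncomputable def y (M : Model n p Ω) (i : Fin n) (ω : Ω) : ℝ :=
  (if (M.w i ω : WithBot ℝ) ≤ M.τ₀ then ⟪M.x i ω, M.β₀⟫ else ⟪M.x i ω, M.γ₀⟫) + M.ε i ω

/-- The least squares loss `Q(τ, β, γ)`. -/
noncomputable def Q (M : Model n p Ω) (ω : Ω) (τ : WithBot ℝ) (β γ : Vec p) : ℝ :=
  (1 / (n : ℝ)) * ∑ i, (if (M.w i ω : WithBot ℝ) ≤ τ then (M.y i ω - ⟪M.x i ω, β⟫) ^ 2 else 0) +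
  (1 / (n : ℝ)) * ∑ i, (if τ < (M.w i ω : WithBot ℝ) then (M.y i ω - ⟪M.x i ω, γ⟫) ^ 2 else 0)

/-- `R_n(τ, β, γ) = Q(τ, β, γ) - Q(τ₀, β, γ)`. -/
noncomputable def R (M : Model n p Ω) (ω : Ω) (τ : WithBot ℝ) (β γ : Vec p) : ℝ :=
  M.Q ω τ β γ - M.Q ω M.τ₀ β γ

/-- `S_n(τ, β, γ) = R_n(τ, β, γ) + μ (‖Φ(τ)‖₀ - ‖Φ(τ₀)‖₀)`. -/
noncomputable def S (M : Model n p Ω) (μ : ℝ) (ω : Ω) (τ : WithBot ℝ) (β γ : Vec p) : ℝ :=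
  M.R ω τ β γ + μ * (l0Norm (M.Phi τ) - l0Norm (M.Phi M.τ₀))

/-- The collection `H(u, v) = {τ ∈ ℝ : v ≤ |Φ(τ) - Φ(τ₀)| ≤ u}`. -/
def H (M : Model n p Ω) (u v : ℝ) : Set ℝ :=
  {τ | v ≤ |M.Phi τ - M.Phi M.τ₀| ∧ |M.Phi τ - M.Phi M.τ₀| ≤ u}

/-- `(b, g)` minimizes `(β, γ) ↦ Q(τ, β, γ) + lam ‖(β, γ)‖₁`: the initial regression estimates
computed at `τ` with regularizer `lam`. -/
def IsInitialEstimate (M : Model n p Ω) (lam : ℝ) (τ : ℝ) (ω : Ω) (b g : Vec p) : Prop :=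
  ∀ β γ : Vec p,
    M.Q ω τ b g + lam * (l1Norm b + l1Norm g) ≤ M.Q ω τ β γ + lam * (l1Norm β + l1Norm γ)

/-- The second moment matrix `E x_i x_iᵀ` of the `i`-th predictor. -/
noncomputable def covMatrix [MeasurableSpace Ω] (M : Model n p Ω) (P : Measure Ω) (i : Fin n) :
    Matrix (Fin p) (Fin p) ℝ :=
  Matrix.of fun j k => ∫ ω, M.x i ω j * M.x i ω k ∂P

/-- The assumptions on the distributions. The eigenvalue bounds
`κ ≤ min eigen Σ ≤ max eigen Σ ≤ φ` are stated in the Loewner order, and a random variable is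
`α`-subgaussian when it satisfies `HasSubgaussianMGF` with parameter `α ^ 2`. -/
structure DistributionAssumptions [MeasurableSpace Ω] (M : Model n p Ω) (P : Measure Ω)
    (C : ℝ≥0) (κ φ : ℝ) : Prop where
  measurable_x : ∀ i, Measurable (M.x i)
  measurable_w : ∀ i, Measurable (M.w i)
  measurable_ε : ∀ i, Measurable (M.ε i)
  identDistrib_x : ∀ i j, IdentDistrib (M.x i) (M.x j) P P
  law_w : ∀ i, P.map (M.w i) = M.wLaw
  identDistrib_ε : ∀ i j, IdentDistrib (M.ε i) (M.ε j) P P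
  /-- The triples `(x_i, w_i, ε_i)` are independent across `i`. -/
  indep_obs : iIndepFun (fun i ω => (M.x i ω, M.w i ω, M.ε i ω)) P
  /-- For each `i`, the three variables `x_i`, `w_i`, `ε_i` are mutually independent. -/
  indep_x_w : ∀ i, IndepFun (M.x i) (M.w i) P
  indep_xw_ε : ∀ i, IndepFun (fun ω => (M.x i ω, M.w i ω)) (M.ε i) P
  mean_x : ∀ i j, ∫ ω, M.x i ω j ∂P = 0
  mean_ε : ∀ i, ∫ ω, M.ε i ω ∂P = 0
  subgaussian_x : ∃ σ2 : ℝ≥0, σ2 ≤ C ∧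
    ∀ i, ∀ v : Vec p, ‖v‖ = 1 → HasSubgaussianMGF (fun ω => ⟪M.x i ω, v⟫) σ2 P
  subgaussian_ε : ∃ σ2 : ℝ≥0, σ2 ≤ C ∧ ∀ i, HasSubgaussianMGF (M.ε i) σ2 P
  eigen_lower : ∀ i, (M.covMatrix P i - κ • (1 : Matrix (Fin p) (Fin p) ℝ)).PosSemidef
  eigen_upper : ∀ i, (φ • (1 : Matrix (Fin p) (Fin p) ℝ) - M.covMatrix P i).PosSemidef

end Model

/-- The radius `u⁽⁰⁾ = 1 ∧ cu (s log p / (n l²))^{1/k}` of the neighbourhood of the initializer. -/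
noncomputable def initRadius (cu k : ℝ) (n p s : ℕ) (l : ℝ) : ℝ :=
  min 1 (cu * ((s * Real.log p) / (n * l ^ 2)) ^ (1 / k))

/-- `F(u) = 0` if `u_n / Φ_min(τ₀) → 0`, and `F(u) = 1` otherwise. -/
noncomputable def F (u phiMin : ℕ → ℝ) : ℝ :=
  open Classical in if Tendsto (fun n => u n / phiMin n) atTop (𝓝 0) then 0 else 1

/-- The rate `r_n = max{√(s log p / n), √s ξ u⁽⁰⁾} / Φ_min(τ₀)`. -/
noncomputable def estRate {n p : ℕ} {Ω : Type*} (M : Model n p Ω) (s : ℕ) (u0 : ℝ) : ℝ :=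
  max (√(s * Real.log p / n)) (√s * M.jump * u0) / M.PhiMin M.τ₀

/-- The assumptions, on a sequence of models indexed by the sample size, that are made whether or
not there is a change: distributions, sparsity, dimensions, and an initializer `τi` that is
separated from the boundaries. -/
structure BasicAssumptions {Ω : ℕ → Type*} [∀ n, MeasurableSpace (Ω n)]
    (P : ∀ n, Measure (Ω n)) {p : ℕ → ℕ} (M : ∀ n, Model n (p n) (Ω n)) (s : ℕ → ℕ)
    (l τi : ℕ → ℝ) (C : ℝ≥0) (κ φ cI : ℝ) : Prop where
  distributions : ∀ n ≥ 1, (M n).DistributionAssumptions (P n) C κ φ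
  one_le_s : ∀ n ≥ 1, 1 ≤ s n
  sparsity : ∀ n ≥ 1, (M n).support.ncard ≤ s n
  dimensions : Tendsto (fun n : ℕ => (s n * Real.log (p n)) / (n : ℝ)) atTop (𝓝 0)
  l_pos : ∀ n ≥ 1, 0 < l n
  l_le : ∀ n ≥ 1, l n ≤ 1 / 2
  dimensions_l : Tendsto (fun n : ℕ => (s n * Real.log (p n)) / (n * l n ^ 2)) atTop (𝓝 0)
  init_boundary : ∀ n ≥ 1, cI * l n ≤ (M n).PhiMin (τi n)

/-- The further assumptions that are made when a finite change point exists. -/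
structure ChangeAssumptions {Ω : ℕ → Type*} {p : ℕ → ℕ} (M : ∀ n, Model n (p n) (Ω n))
    (s : ℕ → ℕ) (l τi : ℕ → ℝ) (k cu cl cξ : ℝ) : Prop where
  change : ∀ n ≥ 1, 0 < (M n).PhiMin (M n).τ₀
  one_le_k : 1 ≤ k
  dimensions_k : Tendsto
    (fun n : ℕ => s n / l n ^ 2 * ((s n * Real.log (p n)) / (n * l n ^ 2)) ^ (1 / k)) atTop (𝓝 0)
  boundary : ∀ n ≥ 1, cl * l n ≤ (M n).PhiMin (M n).τ₀
  jump_lower : ∀ n ≥ 1, cξ < (M n).jump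
  init_close : ∀ n ≥ 1,
    |(M n).Phi (τi n) - (M n).Phi (M n).τ₀| ≤ initRadius cu k n (p n) (s n) (l n)

end ChangePoint

/-! The difference `Q(τ) - Q(τ₀)` involves only the observations with `w i` between `τ₀` and `τ`. To
the right of `τ₀` each of them contributes `(ε - xᵀ(d + D₁))² - (ε - xᵀD₂)²`, where `d = β₀ - γ₀`
and `D₁`, `D₂` are the errors of the two initial estimates. On the left the estimates exchange roles
and `d` changes sign. Since `(a + b)² ≥ a²/2 - b²`, the segment yields a signal of half the sum of
`(xᵀd)²`, of order `n v ξ²`, minus quadratic forms in `D₁`, `D₂` and noise terms linear in `d`,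
`D₁`, `D₂` (`segment_loss_ge`). Without a change, take `d = 0`: only the losses remain, and the
penalty contributes `μ`.

All bounds must be uniform in `τ`. The vector of the `w i` is independent of the pairs `(x i, ε i)`.
Conditionally on it, the noise sums over `w i ≤ τ` are sums of independent subexponential variables
over a chain of index sets, and an exponential Doob inequality bounds all of them at the price of
one sum (`measure_exists_chain_sum_ge_le`, `measure_exists_prefix_sum_gt_le`). The segments of mass
between `v` and `u` on one side of `τ₀` are nested. Their intersection still has mass at least `v`
and bounds the signal from below; their union has mass at most `u` and bounds the losses
(`exists_envelopes`, `segmentBounds`).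

The quadratic forms are controlled in all directions at once. A net of the sparse vectors and a
union bound treat sparse directions, and cutting a vector into blocks of `s` coordinates of
decreasing size extends the bound to all vectors at the price of `‖v‖₁ / √s` (`exists_sparse_net`,
`le_of_sparse_le`, `gram`). In the Lasso cone this extra term is of the order of the Euclidean norm.

The initial estimates are two separate Lassos, on the two sides of the initial value
(`lasso_error_bound`). Observations between the initial value and `τ₀` follow the wrong regression;
their contribution `xᵀ(β₀ - γ₀)` is counted as noise, of order `ξ u⁽⁰⁾` per coordinate, which `lam`
is chosen to dominate (`contamination_le`, `change_error`). With a change the errors are thus at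
most a multiple of `r_n`. The signal must survive with probability tending to one at rate `exp(-c
log p)`, and `v ≥ c_v log p / n` provides exactly that. -/

namespace ChangePoint

/-! ### Exponential moments of products of subgaussian variables -/

section SubExponential

variable {Ω : Type*} [MeasurableSpace Ω] {P : Measure Ω}

lemma lintegral_exp_neg_mul_sq {b : ℝ} (hb : 0 < b) :
    ∫⁻ x : ℝ, ENNReal.ofReal (Real.exp (-b * x ^ 2)) = ENNReal.ofReal (√(Real.pi / b)) := by
  rw [← integral_gaussian b, ofReal_integral_eq_lintegral_ofReal (integrable_exp_neg_mul_sq hb)]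
  exact Eventually.of_forall fun x => (Real.exp_pos _).le

/-- The square of a subgaussian variable has an exponential moment. -/
lemma lintegral_exp_sq_le [SFinite P] {X : Ω → ℝ} (hXm : Measurable X) {c : ℝ≥0}
    (hX : HasSubgaussianMGF X c P) {D : ℝ} (hD : 0 < D) (hcD : (c : ℝ) ≤ D) :
    ∫⁻ ω, ENNReal.ofReal (Real.exp (X ω ^ 2 / (4 * D))) ∂P ≤ 2 := by
  set s : ℝ := 1 / √D with hs
  have hs2 : s ^ 2 = 1 / D := by rw [hs, div_pow, one_pow, Real.sq_sqrt hD.le]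
  -- Completing the square turns the exponential of a square into a Gaussian mixture of exponentials
  -- linear in `X`. After Tonelli only the moment generating function of `X` is needed.
  have key : ∀ ω, ENNReal.ofReal (√Real.pi) * ENNReal.ofReal (Real.exp (X ω ^ 2 / (4 * D))) =
      ∫⁻ x : ℝ, ENNReal.ofReal (Real.exp (-x ^ 2 + s * x * X ω)) := by
    intro ω
    have h1 : ∀ x : ℝ, ENNReal.ofReal (Real.exp (-x ^ 2 + s * x * X ω)) =
        ENNReal.ofReal (Real.exp (-1 * (x - s * X ω / 2) ^ 2)) *
          ENNReal.ofReal (Real.exp (X ω ^ 2 / (4 * D))) := by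
      intro x
      rw [← ENNReal.ofReal_mul (Real.exp_pos _).le, ← Real.exp_add]
      congr 2
      have : X ω ^ 2 / (4 * D) = s ^ 2 * X ω ^ 2 / 4 := by rw [hs2]; field_simp
      rw [this]; ring
    simp_rw [h1]
    rw [lintegral_mul_const _ (by fun_prop),
      lintegral_sub_right_eq_self (μ := (volume : Measure ℝ))
        (fun x => ENNReal.ofReal (Real.exp (-1 * x ^ 2))) (s * X ω / 2),
      lintegral_exp_neg_mul_sq one_pos, div_one]
  have hpi : ENNReal.ofReal (√Real.pi) ≠ 0 := by
    simpa using Real.pi_pos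
  have hswap : ENNReal.ofReal (√Real.pi) *
      ∫⁻ ω, ENNReal.ofReal (Real.exp (X ω ^ 2 / (4 * D))) ∂P ≤ ENNReal.ofReal (√Real.pi) * 2 := by
    rw [← lintegral_const_mul _ (by fun_prop)]
    simp_rw [key]
    rw [lintegral_lintegral_swap (by fun_prop)]
    calc ∫⁻ x : ℝ, ∫⁻ ω, ENNReal.ofReal (Real.exp (-x ^ 2 + s * x * X ω)) ∂P
        ≤ ∫⁻ x : ℝ, ENNReal.ofReal (Real.exp (-(1 / 2) * x ^ 2)) := by
          refine lintegral_mono fun x => ?_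
          have h2 : ∀ ω, ENNReal.ofReal (Real.exp (-x ^ 2 + s * x * X ω)) =
              ENNReal.ofReal (Real.exp (-x ^ 2)) * ENNReal.ofReal (Real.exp (s * x * X ω)) := by
            intro ω
            rw [← ENNReal.ofReal_mul (Real.exp_pos _).le, ← Real.exp_add]
          simp_rw [h2]
          rw [lintegral_const_mul _ (by fun_prop), ← ofReal_integral_eq_lintegral_ofReal
            (hX.integrable_exp_mul _) (Eventually.of_forall fun _ => (Real.exp_pos _).le),
            ← ENNReal.ofReal_mul (Real.exp_pos _).le]
          refine ENNReal.ofReal_le_ofReal ?_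
          have h3 := hX.mgf_le (s * x)
          rw [mgf] at h3
          refine (mul_le_mul_of_nonneg_left h3 (Real.exp_pos _).le).trans ?_
          rw [← Real.exp_add, Real.exp_le_exp, mul_pow, hs2]
          have : (c : ℝ) * (1 / D * x ^ 2) ≤ x ^ 2 := by
            have : (c : ℝ) / D ≤ 1 := (div_le_one hD).2 hcD
            calc (c : ℝ) * (1 / D * x ^ 2) = c / D * x ^ 2 := by ring
              _ ≤ 1 * x ^ 2 := by gcongr
              _ = x ^ 2 := one_mul _
          linarith
      _ = ENNReal.ofReal (√(Real.pi / (1 / 2))) := lintegral_exp_neg_mul_sq (by norm_num)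
      _ ≤ ENNReal.ofReal (√Real.pi) * 2 := by
          rw [show (2 : ℝ≥0∞) = ENNReal.ofReal 2 by simp, ← ENNReal.ofReal_mul (Real.sqrt_nonneg _)]
          refine ENNReal.ofReal_le_ofReal ?_
          rw [Real.sqrt_le_iff]
          refine ⟨by positivity, ?_⟩
          rw [mul_pow, Real.sq_sqrt Real.pi_pos.le]
          nlinarith [Real.pi_pos]
  exact (ENNReal.mul_le_mul_iff_right hpi ENNReal.ofReal_ne_top).1 hswap

/-- `Z` has an exponential moment of order `a`, bounded by `2`. -/
def HasExpMoment (Z : Ω → ℝ) (a : ℝ) (P : Measure Ω) : Prop :=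
  ∫⁻ ω, ENNReal.ofReal (Real.exp (a * |Z ω|)) ∂P ≤ 2

/-- By the inequality of arithmetic and geometric means, used once in the exponent and once for the
exponentials, the moment is at most the average of those of `X²` and `Y²`. No independence of `X`
and `Y` is needed, so this serves both for `xᵀu · xᵀv` and for `ε · xᵀu`. -/
lemma hasExpMoment_mul [SFinite P] {X Y : Ω → ℝ} (hXm : Measurable X) (hYm : Measurable Y)
    {c d : ℝ≥0} (hX : HasSubgaussianMGF X c P) (hY : HasSubgaussianMGF Y d P) {D : ℝ}
    (hD : 0 < D) (hcD : (c : ℝ) ≤ D) (hdD : (d : ℝ) ≤ D) :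
    HasExpMoment (fun ω => X ω * Y ω) (1 / (4 * D)) P := by
  have hpt : ∀ ω, ENNReal.ofReal (Real.exp (1 / (4 * D) * |X ω * Y ω|)) ≤
      ENNReal.ofReal (1 / 2) * ENNReal.ofReal (Real.exp (X ω ^ 2 / (4 * D))) +
        ENNReal.ofReal (1 / 2) * ENNReal.ofReal (Real.exp (Y ω ^ 2 / (4 * D))) := by
    intro ω
    rw [← ENNReal.ofReal_mul (by norm_num), ← ENNReal.ofReal_mul (by norm_num),
      ← ENNReal.ofReal_add (by positivity) (by positivity)]
    refine ENNReal.ofReal_le_ofReal ?_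
    have h1 : |X ω * Y ω| ≤ (X ω ^ 2 + Y ω ^ 2) / 2 := by
      rw [abs_mul]
      nlinarith [sq_nonneg (|X ω| - |Y ω|), sq_abs (X ω), sq_abs (Y ω)]
    have h2 : 1 / (4 * D) * |X ω * Y ω| ≤ X ω ^ 2 / (4 * D) / 2 + Y ω ^ 2 / (4 * D) / 2 := by
      calc 1 / (4 * D) * |X ω * Y ω| ≤ 1 / (4 * D) * ((X ω ^ 2 + Y ω ^ 2) / 2) := by gcongr
        _ = _ := by ring
    refine (Real.exp_le_exp.2 h2).trans ?_
    rw [Real.exp_add]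
    have e1 : Real.exp (X ω ^ 2 / (4 * D)) = Real.exp (X ω ^ 2 / (4 * D) / 2) ^ 2 := by
      rw [← Real.exp_nat_mul]; congr 1; push_cast; ring
    have e2 : Real.exp (Y ω ^ 2 / (4 * D)) = Real.exp (Y ω ^ 2 / (4 * D) / 2) ^ 2 := by
      rw [← Real.exp_nat_mul]; congr 1; push_cast; ring
    rw [e1, e2]
    nlinarith [sq_nonneg (Real.exp (X ω ^ 2 / (4 * D) / 2) - Real.exp (Y ω ^ 2 / (4 * D) / 2))]
  refine (lintegral_mono hpt).trans ?_
  rw [lintegral_add_left (by fun_prop), lintegral_const_mul _ (by fun_prop),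
    lintegral_const_mul _ (by fun_prop)]
  calc _ ≤ ENNReal.ofReal (1 / 2) * 2 + ENNReal.ofReal (1 / 2) * 2 := by
        gcongr <;> exact lintegral_exp_sq_le ‹_› ‹_› hD ‹_›
    _ = 2 := by
        rw [show (2 : ℝ≥0∞) = ENNReal.ofReal 2 by simp, ← ENNReal.ofReal_mul (by norm_num),
          ← ENNReal.ofReal_add (by norm_num) (by norm_num)]
        norm_num

namespace HasExpMoment

variable {Z : Ω → ℝ} {a : ℝ}

lemma integrable_exp (hZm : Measurable Z) (hZ : HasExpMoment Z a P) :
    Integrable (fun ω => Real.exp (a * |Z ω|)) P :=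
  ⟨by fun_prop, by
    rw [hasFiniteIntegral_iff_ofReal (Eventually.of_forall fun _ => (Real.exp_pos _).le)]
    exact hZ.trans_lt (by simp)⟩

lemma integral_exp_le (hZm : Measurable Z) (hZ : HasExpMoment Z a P) :
    ∫ ω, Real.exp (a * |Z ω|) ∂P ≤ 2 := by
  have h := hZ
  rw [HasExpMoment, ← ofReal_integral_eq_lintegral_ofReal (hZ.integrable_exp hZm)
    (Eventually.of_forall fun _ => (Real.exp_pos _).le),
    show (2 : ℝ≥0∞) = ENNReal.ofReal 2 by simp, ENNReal.ofReal_le_ofReal_iff (by norm_num)] at h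
  exact h

lemma integrable (ha : 0 < a) (hZm : Measurable Z) (hZ : HasExpMoment Z a P) :
    Integrable Z P := by
  refine ((hZ.integrable_exp hZm).const_mul a⁻¹).mono' (by fun_prop)
    (Eventually.of_forall fun ω => ?_)
  rw [Real.norm_eq_abs, inv_mul_eq_div, le_div_iff₀ ha]
  nlinarith [Real.add_one_le_exp (a * |Z ω|)]

lemma abs_integral_le (ha : 0 < a) (hZm : Measurable Z) (hZ : HasExpMoment Z a P) :
    |∫ ω, Z ω ∂P| ≤ 2 / a := by
  calc |∫ ω, Z ω ∂P| ≤ ∫ ω, |Z ω| ∂P := abs_integral_le_integral_abs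
    _ ≤ ∫ ω, a⁻¹ * Real.exp (a * |Z ω|) ∂P := by
        refine integral_mono (hZ.integrable ha hZm).abs ((hZ.integrable_exp hZm).const_mul _) ?_
        intro ω
        simp only
        rw [inv_mul_eq_div, le_div_iff₀ ha]
        nlinarith [Real.add_one_le_exp (a * |Z ω|)]
    _ ≤ 2 / a := by
        rw [integral_const_mul, inv_mul_eq_div]
        gcongr
        exact hZ.integral_exp_le hZm

lemma exp_le_one_add {x : ℝ} : Real.exp x ≤ 1 + x + x ^ 2 * Real.exp |x| := by
  have h := Complex.norm_exp_sub_sum_le_norm_mul_exp (x : ℂ) 2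
  have h2 : Complex.exp x - ∑ m ∈ Finset.range 2, (x : ℂ) ^ m / (m.factorial : ℂ) =
      ((Real.exp x - (1 + x) : ℝ) : ℂ) := by
    simp [Finset.sum_range_succ]
  rw [h2, Complex.norm_real, Complex.norm_real, Real.norm_eq_abs, Real.norm_eq_abs, sq_abs] at h
  linarith [le_abs_self (Real.exp x - (1 + x))]

/-- The weight `exp (a |z|)` is split in half: one half dominates `exp |lam z|`, the other dominates
`z²` through the quadratic term of the exponential series. Hence the constant `8 / a ^ 2`. -/
lemma exp_mul_le (ha : 0 < a) {lam z : ℝ} (hlam : |lam| ≤ a / 2) :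
    Real.exp (lam * z) ≤ 1 + lam * z + lam ^ 2 * (8 / a ^ 2) * Real.exp (a * |z|) := by
  have hz := abs_nonneg z
  refine exp_le_one_add.trans ?_
  have h1 : Real.exp |lam * z| ≤ Real.exp (a * |z| / 2) := by
    rw [Real.exp_le_exp, abs_mul]
    nlinarith
  have h2 : z ^ 2 ≤ 8 / a ^ 2 * Real.exp (a * |z| / 2) := by
    have h3 := Real.quadratic_le_exp_of_nonneg (x := a * |z| / 2) (by positivity)
    have h4 : 8 / a ^ 2 * ((a * |z| / 2) ^ 2 / 2) = z ^ 2 := by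
      rw [div_pow, mul_pow, sq_abs]; field_simp; ring
    rw [← h4]
    gcongr
    have : 0 ≤ a * |z| / 2 := by positivity
    linarith
  have h5 : Real.exp (a * |z|) = Real.exp (a * |z| / 2) * Real.exp (a * |z| / 2) := by
    rw [← Real.exp_add]; congr 1; ring
  rw [h5, mul_pow]
  have := mul_le_mul h2 h1 (Real.exp_pos _).le (by positivity)
  nlinarith [mul_le_mul_of_nonneg_left this (sq_nonneg lam)]

lemma integrable_exp_mul (ha : 0 < a) (hZm : Measurable Z) (hZ : HasExpMoment Z a P) {lam : ℝ}
    (hlam : |lam| ≤ a / 2) : Integrable (fun ω => Real.exp (lam * Z ω)) P := by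
  refine (hZ.integrable_exp hZm).mono' (by fun_prop) (Eventually.of_forall fun ω => ?_)
  rw [Real.norm_eq_abs, abs_of_pos (Real.exp_pos _), Real.exp_le_exp]
  have := abs_nonneg (Z ω)
  calc lam * Z ω ≤ |lam * Z ω| := le_abs_self _
    _ = |lam| * |Z ω| := abs_mul _ _
    _ ≤ a * |Z ω| := by nlinarith [abs_nonneg lam]

variable [IsProbabilityMeasure P]

lemma integral_exp_mul_le (ha : 0 < a) (hZm : Measurable Z) (hZ : HasExpMoment Z a P) {lam : ℝ}
    (hlam : |lam| ≤ a / 2) :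
    ∫ ω, Real.exp (lam * Z ω) ∂P ≤
      Real.exp (lam * (∫ ω, Z ω ∂P) + 16 / a ^ 2 * lam ^ 2) := by
  have hint := hZ.integrable ha hZm
  have hexp := hZ.integrable_exp hZm
  calc ∫ ω, Real.exp (lam * Z ω) ∂P
      ≤ ∫ ω, (1 + lam * Z ω + lam ^ 2 * (8 / a ^ 2) * Real.exp (a * |Z ω|)) ∂P :=
        integral_mono (hZ.integrable_exp_mul ha hZm hlam)
          (((integrable_const _).add (hint.const_mul _)).add (hexp.const_mul _))
          fun ω => exp_mul_le ha hlam
    _ = 1 + lam * (∫ ω, Z ω ∂P) +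
          lam ^ 2 * (8 / a ^ 2) * ∫ ω, Real.exp (a * |Z ω|) ∂P := by
        have h1 : Integrable (fun ω => 1 + lam * Z ω) P :=
          (integrable_const _).add (hint.const_mul _)
        rw [integral_add h1 (hexp.const_mul _),
          integral_add (integrable_const _) (hint.const_mul _), integral_const_mul,
          integral_const_mul]
        simp
    _ ≤ 1 + lam * (∫ ω, Z ω ∂P) + lam ^ 2 * (8 / a ^ 2) * 2 := by
        gcongr
        exact hZ.integral_exp_le hZm
    _ ≤ _ := by
        refine le_trans (le_of_eq ?_) (Real.add_one_le_exp _)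
        ring

lemma lintegral_exp_mul_centered_le (ha : 0 < a) (hZm : Measurable Z) (hZ : HasExpMoment Z a P)
    {lam : ℝ} (hlam : |lam| ≤ a / 2) :
    ∫⁻ ω, ENNReal.ofReal (Real.exp (lam * (Z ω - ∫ ω, Z ω ∂P))) ∂P ≤
      ENNReal.ofReal (Real.exp (16 / a ^ 2 * lam ^ 2)) := by
  set m := ∫ ω, Z ω ∂P
  have h1 : ∀ ω, Real.exp (lam * (Z ω - m)) = Real.exp (-lam * m) * Real.exp (lam * Z ω) := by
    intro ω; rw [← Real.exp_add]; congr 1; ring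
  simp_rw [h1]
  rw [← ofReal_integral_eq_lintegral_ofReal ((hZ.integrable_exp_mul ha hZm hlam).const_mul _)
    (Eventually.of_forall fun _ => by positivity), integral_const_mul]
  refine ENNReal.ofReal_le_ofReal ?_
  refine (mul_le_mul_of_nonneg_left (hZ.integral_exp_mul_le ha hZm hlam)
    (Real.exp_pos _).le).trans ?_
  rw [← Real.exp_add, Real.exp_le_exp]
  linarith

/-- Jensen's inequality for a centered variable. In the maximal inequality it allows the exponential
weights of later variables to be multiplied in without lowering the expectation. -/
lemma one_le_lintegral_exp_mul_centered (ha : 0 < a) (hZm : Measurable Z)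
    (hZ : HasExpMoment Z a P) {lam : ℝ} (hlam : |lam| ≤ a / 2) :
    1 ≤ ∫⁻ ω, ENNReal.ofReal (Real.exp (lam * (Z ω - ∫ ω, Z ω ∂P))) ∂P := by
  set m := ∫ ω, Z ω ∂P with hm
  have hint := hZ.integrable ha hZm
  have hcent : Integrable (fun ω => lam * (Z ω - m)) P := (hint.sub (integrable_const _)).const_mul _
  have h1 : ∀ ω, Real.exp (lam * (Z ω - m)) = Real.exp (-lam * m) * Real.exp (lam * Z ω) := by
    intro ω; rw [← Real.exp_add]; congr 1; ring
  have hexp : Integrable (fun ω => Real.exp (lam * (Z ω - m))) P := by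
    simp_rw [h1]
    exact (hZ.integrable_exp_mul ha hZm hlam).const_mul _
  rw [← ofReal_integral_eq_lintegral_ofReal hexp
    (Eventually.of_forall fun _ => (Real.exp_pos _).le), ENNReal.one_le_ofReal]
  calc (1 : ℝ) = ∫ ω, (lam * (Z ω - m) + 1) ∂P := by
        rw [integral_add hcent (integrable_const _), integral_const_mul,
          integral_sub hint (integrable_const _)]
        simp [hm]
    _ ≤ _ := integral_mono (hcent.add (integrable_const _)) hexp fun ω => Real.add_one_le_exp _

end HasExpMoment

end SubExponential

/-! ### Doob's exponential inequality along a chain -/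

section MaximalInequality

variable {Ω ι : Type*} [MeasurableSpace Ω] {P : Measure Ω} [DecidableEq ι]

/-- Doob's exponential inequality for the partial sums of independent variables along a chain of
index sets. -/
lemma measure_exists_chain_sum_ge_le {Y : ι → Ω → ℝ} (hY : ∀ i, Measurable (Y i))
    (hind : iIndepFun Y P) {lam κ t : ℝ} (hlam : 0 ≤ lam)
    (hle : ∀ i, ∫⁻ ω, ENNReal.ofReal (Real.exp (lam * Y i ω)) ∂P ≤ ENNReal.ofReal (Real.exp κ))
    (hone : ∀ i, 1 ≤ ∫⁻ ω, ENNReal.ofReal (Real.exp (lam * Y i ω)) ∂P)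
    (𝒞 : Finset (Finset ι)) (hchain : ∀ A ∈ 𝒞, ∀ B ∈ 𝒞, A ⊆ B ∨ B ⊆ A)
    (U : Finset ι) (hU : ∀ A ∈ 𝒞, A ⊆ U) :
    P {ω | ∃ J ∈ 𝒞, t ≤ ∑ i ∈ J, Y i ω} ≤
      ENNReal.ofReal (Real.exp (κ * U.card - lam * t)) := by
  classical
  set g : ι → Ω → ℝ≥0∞ := fun i ω => ENNReal.ofReal (Real.exp (lam * Y i ω)) with hg
  have hgm : ∀ i, Measurable (g i) := fun i => by fun_prop
  have hgind : iIndepFun g P :=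
    hind.comp (fun _ y => ENNReal.ofReal (Real.exp (lam * y))) (fun _ => by fun_prop)
  have hprod : ∀ (J : Finset ι) ω,
      ∏ i ∈ J, g i ω = ENNReal.ofReal (Real.exp (lam * ∑ i ∈ J, Y i ω)) := by
    intro J ω
    rw [hg, ← ENNReal.ofReal_prod_of_nonneg (fun _ _ => (Real.exp_pos _).le), ← Real.exp_sum,
      Finset.mul_sum]
  -- the event that `J` is the first index set at which the level `t` is reached
  set B : Finset ι → Set (ι → ℝ) := fun J =>
    {y | t ≤ ∑ i ∈ J, y i ∧ ∀ J' ∈ 𝒞, J' ⊂ J → ∑ i ∈ J', y i < t} with hB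
  have hBm : ∀ J, MeasurableSet (B J) := by
    intro J
    have : B J = {y | t ≤ ∑ i ∈ J, y i} ∩
        ⋂ J' ∈ 𝒞, {y | J' ⊂ J → ∑ i ∈ J', y i < t} := by
      ext y; simp [hB]
    rw [this]
    refine (measurableSet_le (by fun_prop) (by fun_prop)).inter ?_
    refine Finset.measurableSet_biInter _ fun J' _ => ?_
    by_cases h : J' ⊂ J
    · simp only [h, true_imp_iff]
      exact measurableSet_lt (by fun_prop) (by fun_prop)
    · simp [h]
  set E : Finset ι → Set Ω := fun J => (fun ω i => Y i ω) ⁻¹' B J with hE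
  have hEm : ∀ J, MeasurableSet (E J) := fun J => (measurable_pi_iff.2 hY) (hBm J)
  have hcover : {ω | ∃ J ∈ 𝒞, t ≤ ∑ i ∈ J, Y i ω} ⊆ ⋃ J ∈ 𝒞, E J := by
    rintro ω ⟨J, hJ, hJt⟩
    obtain ⟨J₀, hJ₀, hmin⟩ := Finset.exists_min_image
      (𝒞.filter fun J => t ≤ ∑ i ∈ J, Y i ω) Finset.card ⟨J, by simp [hJ, hJt]⟩
    rw [Finset.mem_filter] at hJ₀
    simp only [Set.mem_iUnion]
    refine ⟨J₀, hJ₀.1, hJ₀.2, fun J' hJ' hlt => ?_⟩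
    by_contra! hcon
    exact absurd (hmin J' (by simp [hJ', hcon])) (not_le.2 (Finset.card_lt_card hlt))
  -- Two members of a chain are comparable, so they cannot both be first.
  have hdisj : (𝒞 : Set (Finset ι)).PairwiseDisjoint E := by
    intro J hJ J' hJ' hne
    rw [Function.onFun, Set.disjoint_left]
    rintro ω ⟨h1, h2⟩ ⟨h3, h4⟩
    rcases hchain J hJ J' hJ' with h | h
    · exact absurd (h4 J hJ (h.ssubset_of_ne hne)) (not_lt.2 h1)
    · exact absurd (h2 J' hJ' (h.ssubset_of_ne hne.symm)) (not_lt.2 h3)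
  -- On `E J` the weights over `J` already exceed `exp (lam t)`. The weights over `U \ J` are
  -- independent of `E J` and of those over `J`, and have mean at least one.
  have hstep : ∀ J ∈ 𝒞, ENNReal.ofReal (Real.exp (lam * t)) * P (E J) ≤
      ∫⁻ ω in E J, ∏ i ∈ U, g i ω ∂P := by
    intro J hJ
    set F : (ι → ℝ) → ℝ≥0∞ := (B J).indicator
      (fun y => ∏ i ∈ J, ENNReal.ofReal (Real.exp (lam * y i))) with hF
    have hFm : Measurable F := Measurable.indicator (by fun_prop) (hBm J)
    -- The event `B J` and its weight look only at subsets of `J`. Extending by zero displays them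
    -- as functions of the coordinates in `J` alone, the form needed for independence.
    set ext : (J → ℝ) → ι → ℝ := fun y i => if h : i ∈ J then y ⟨i, h⟩ else 0 with hext
    have hextm : Measurable ext := by
      refine measurable_pi_iff.2 fun i => ?_
      by_cases h : i ∈ J
      · simp only [hext, h, dite_true]; fun_prop
      · simp [hext, h]
    have hFext : ∀ ω, F (ext fun i => Y i ω) = F (fun i => Y i ω) := by
      intro ω
      have hs : ∀ J' ⊆ J, ∑ i ∈ J', ext (fun i => Y i ω) i = ∑ i ∈ J', Y i ω := by
        intro J' hJ'
        exact Finset.sum_congr rfl fun i hi => by simp [hext, hJ' hi]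
      have hmem : ext (fun i => Y i ω) ∈ B J ↔ (fun i => Y i ω) ∈ B J := by
        simp only [hB, Set.mem_ofPred_eq, hs J subset_rfl]
        refine and_congr_right fun _ => forall₂_congr fun J' _ => ?_
        exact ⟨fun h hl => by rw [← hs J' hl.1]; exact h hl,
          fun h hl => by rw [hs J' hl.1]; exact h hl⟩
      simp only [hF, Set.indicator, hmem]
      split_ifs
      · exact Finset.prod_congr rfl fun i hi => by simp [hext, hi]
      · rfl
    set G : (↥(U \ J) → ℝ) → ℝ≥0∞ := fun y => ∏ i, ENNReal.ofReal (Real.exp (lam * y i)) with hG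
    have hGm : Measurable G := Finset.measurable_prod _ fun i _ => by fun_prop
    have hindep : IndepFun (fun ω => F (ext fun i => Y i ω)) (fun ω => G fun i => Y i ω) P :=
      (hind.indepFun_finset J (U \ J) Finset.disjoint_sdiff hY).comp (hFm.comp hextm) hGm
    have hmul := lintegral_mul_eq_lintegral_mul_lintegral_of_indepFun''
      (hFm.comp (hextm.comp (measurable_pi_iff.2 fun i : J => hY i))).aemeasurable
      (hGm.comp (measurable_pi_iff.2 fun i : ↥(U \ J) => hY i)).aemeasurable hindep
    simp only [Function.comp_apply, hFext] at hmul
    have h2 : ∀ ω, G (fun i => Y i ω) =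
        ∏ i ∈ U \ J, g i ω := fun ω => Finset.prod_coe_sort (U \ J) (fun i => g i ω)
    have hge : 1 ≤ ∫⁻ ω, ∏ i ∈ U \ J, g i ω ∂P := by
      rw [lintegral_prod_eq_prod_lintegral_of_indepFun _ _ hgind hgm]
      exact Finset.one_le_prod'' hone
    calc ENNReal.ofReal (Real.exp (lam * t)) * P (E J)
        ≤ ∫⁻ ω, F (fun i => Y i ω) ∂P := by
          rw [← lintegral_indicator_const (hEm J)]
          refine lintegral_mono fun ω => ?_
          by_cases h : ω ∈ E J
          · rw [Set.indicator_of_mem h, hF, Set.indicator_of_mem (show _ ∈ B J from h)]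
            rw [show (∏ i ∈ J, ENNReal.ofReal (Real.exp (lam * Y i ω))) = ∏ i ∈ J, g i ω from rfl,
              hprod]
            refine ENNReal.ofReal_le_ofReal (Real.exp_le_exp.2 ?_)
            exact mul_le_mul_of_nonneg_left h.1 hlam
          · rw [Set.indicator_of_notMem h]; exact zero_le
      _ ≤ (∫⁻ ω, F (fun i => Y i ω) ∂P) * ∫⁻ ω, ∏ i ∈ U \ J, g i ω ∂P :=
          le_mul_of_one_le_right zero_le hge
      _ = ∫⁻ ω, F (fun i => Y i ω) * ∏ i ∈ U \ J, g i ω ∂P := by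
          simp_rw [h2] at hmul
          exact hmul.symm
      _ ≤ ∫⁻ ω in E J, ∏ i ∈ U, g i ω ∂P := by
          rw [← lintegral_indicator (hEm J)]
          refine lintegral_mono fun ω => ?_
          by_cases h : ω ∈ E J
          · rw [Set.indicator_of_mem h, hF, Set.indicator_of_mem (show _ ∈ B J from h)]
            rw [← Finset.prod_sdiff (hU J hJ), mul_comm]
          · rw [hF, Set.indicator_of_notMem (show _ ∉ B J from h), zero_mul]; exact zero_le
  have hmain : ENNReal.ofReal (Real.exp (lam * t)) * P {ω | ∃ J ∈ 𝒞, t ≤ ∑ i ∈ J, Y i ω} ≤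
      ENNReal.ofReal (Real.exp (κ * U.card)) := by
    calc _ ≤ ENNReal.ofReal (Real.exp (lam * t)) * ∑ J ∈ 𝒞, P (E J) := by
          gcongr
          exact (measure_mono hcover).trans (measure_biUnion_finset_le _ _)
      _ ≤ ∑ J ∈ 𝒞, ∫⁻ ω in E J, ∏ i ∈ U, g i ω ∂P := by
          rw [Finset.mul_sum]
          exact Finset.sum_le_sum hstep
      _ = ∫⁻ ω in ⋃ J ∈ 𝒞, E J, ∏ i ∈ U, g i ω ∂P :=
          (lintegral_biUnion_finset hdisj (fun J _ => hEm J) _).symm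
      _ ≤ ∫⁻ ω, ∏ i ∈ U, g i ω ∂P := setLIntegral_le_lintegral _ _
      _ = ∏ i ∈ U, ∫⁻ ω, g i ω ∂P := lintegral_prod_eq_prod_lintegral_of_indepFun _ _ hgind hgm
      _ ≤ ∏ i ∈ U, ENNReal.ofReal (Real.exp κ) := Finset.prod_le_prod' fun i _ => hle i
      _ = ENNReal.ofReal (Real.exp (κ * U.card)) := by
          rw [Finset.prod_const, ← ENNReal.ofReal_pow (Real.exp_pos _).le, ← Real.exp_nat_mul,
            mul_comm]
  rw [Real.exp_sub, ENNReal.ofReal_div_of_pos (Real.exp_pos _),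
    ENNReal.le_div_iff_mul_le (by simp [Real.exp_pos]) (by simp), mul_comm]
  exact hmain

end MaximalInequality

/-! ### Deviation inequalities, conditionally on the change inducing variables -/

section Deviations

variable {Ω ι : Type*} [MeasurableSpace Ω] {P : Measure Ω}

lemma hasExpMoment_neg {Z : Ω → ℝ} {a : ℝ} (hZ : HasExpMoment Z a P) :
    HasExpMoment (fun ω => -Z ω) a P := by
  simpa only [HasExpMoment, abs_neg] using hZ

variable [IsProbabilityMeasure P]

/-- The Chernoff parameter is `(a / 2) √(L / B)` with `B = |U| + L`. Having `L` inside `B` keeps it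
below `a / 2`, so the Gaussian and the exponential regimes of Bernstein's inequality are covered
together. The variance term costs at most `4 L`, and the threshold gains `a A L / 2`. -/
lemma measure_exists_chain_sum_centered_gt_le [DecidableEq ι] {Z : ι → Ω → ℝ}
    (hZm : ∀ i, Measurable (Z i)) (hind : iIndepFun Z P) {a : ℝ} (ha : 0 < a)
    (hZ : ∀ i, HasExpMoment (Z i) a P) {A L : ℝ} (hL : 0 ≤ L)
    (𝒞 : Finset (Finset ι)) (hchain : ∀ A ∈ 𝒞, ∀ B ∈ 𝒞, A ⊆ B ∨ B ⊆ A)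
    (U : Finset ι) (hU : ∀ A ∈ 𝒞, A ⊆ U) :
    P {ω | ∃ J ∈ 𝒞, A * √((U.card + L) * L) < ∑ i ∈ J, (Z i ω - ∫ ω, Z i ω ∂P)} ≤
      ENNReal.ofReal (Real.exp ((4 - a * A / 2) * L)) := by
  rcases hL.eq_or_lt with rfl | hL
  · simpa using prob_le_one
  set B : ℝ := U.card + L with hB
  have hBpos : 0 < B := by positivity
  set lam : ℝ := a / 2 * √(L / B) with hlam
  have hlam0 : 0 ≤ lam := by positivity
  have hLB : L / B ≤ 1 := (div_le_one hBpos).2 (by simp [hB])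
  have hlam1 : |lam| ≤ a / 2 := by
    rw [abs_of_nonneg hlam0, hlam]
    exact mul_le_of_le_one_right (by positivity) (Real.sqrt_le_one.2 hLB)
  have hlam2 : lam ^ 2 = a ^ 2 / 4 * (L / B) := by
    rw [hlam, mul_pow, Real.sq_sqrt (by positivity)]; ring
  refine (measure_mono ?_).trans ((measure_exists_chain_sum_ge_le
    (Y := fun i ω => Z i ω - ∫ ω, Z i ω ∂P) (t := A * √(B * L)) (κ := 16 / a ^ 2 * lam ^ 2)
    (fun i => (hZm i).sub_const _)
    (hind.comp (fun i z => z - ∫ ω, Z i ω ∂P) fun i => by fun_prop) hlam0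
    (fun i => (hZ i).lintegral_exp_mul_centered_le ha (hZm i) hlam1)
    (fun i => (hZ i).one_le_lintegral_exp_mul_centered ha (hZm i) hlam1) 𝒞 hchain U hU).trans ?_)
  · rintro ω ⟨J, hJ, h⟩
    exact ⟨J, hJ, h.le⟩
  · refine ENNReal.ofReal_le_ofReal (Real.exp_le_exp.2 ?_)
    have h1 : 16 / a ^ 2 * lam ^ 2 * U.card ≤ 4 * L := by
      have h2 : 16 / a ^ 2 * lam ^ 2 * U.card = 4 * L * (U.card / B) := by
        rw [hlam2]; field_simp; ring
      have h3 : (U.card : ℝ) / B ≤ 1 := (div_le_one hBpos).2 (by simp [hB, hL.le])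
      rw [h2]
      exact mul_le_of_le_one_right (by positivity) h3
    have h4 : lam * (A * √(B * L)) = a * A / 2 * L := by
      have h5 : √(L / B) * √(B * L) = L := by
        rw [← Real.sqrt_mul (by positivity), show L / B * (B * L) = L ^ 2 by field_simp,
          Real.sqrt_sq hL.le]
      rw [hlam]
      linear_combination (a * A / 2) * h5
    rw [h4]
    linarith

lemma measure_exists_chain_abs_sum_gt_le [DecidableEq ι] {Z : ι → Ω → ℝ}
    (hZm : ∀ i, Measurable (Z i)) (hind : iIndepFun Z P) {a : ℝ} (ha : 0 < a)
    (hZ : ∀ i, HasExpMoment (Z i) a P) {A L : ℝ} (hL : 0 ≤ L)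
    (𝒞 : Finset (Finset ι)) (hchain : ∀ A ∈ 𝒞, ∀ B ∈ 𝒞, A ⊆ B ∨ B ⊆ A)
    (U : Finset ι) (hU : ∀ A ∈ 𝒞, A ⊆ U) :
    P {ω | ∃ J ∈ 𝒞, A * √((U.card + L) * L) < |∑ i ∈ J, (Z i ω - ∫ ω, Z i ω ∂P)|} ≤
      ENNReal.ofReal (2 * Real.exp ((4 - a * A / 2) * L)) := by
  have h1 := measure_exists_chain_sum_centered_gt_le hZm hind ha hZ (A := A) hL 𝒞 hchain U hU
  have h2 := measure_exists_chain_sum_centered_gt_le (Z := fun i ω => -Z i ω)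
    (fun i => (hZm i).neg) (hind.comp (fun _ z => -z) fun _ => measurable_neg) ha
    (fun i => hasExpMoment_neg (hZ i)) (A := A) hL 𝒞 hchain U hU
  rw [two_mul, ENNReal.ofReal_add (by positivity) (by positivity)]
  refine le_trans (measure_mono ?_) ((measure_union_le _ _).trans (add_le_add h1 h2))
  rintro ω ⟨J, hJ, h⟩
  rcases lt_abs.1 h with h | h
  · exact Or.inl ⟨J, hJ, h⟩
  · refine Or.inr ⟨J, hJ, ?_⟩
    rw [← Finset.sum_neg_distrib] at h
    refine h.trans_eq (Finset.sum_congr rfl fun i _ => ?_)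
    rw [integral_neg]; ring

omit [IsProbabilityMeasure P] in
/-- An event has small probability if it does so conditionally on an independent variable. -/
lemma measure_prodMk_mem_le_of_indepFun [IsProbabilityMeasure P] {α β : Type*} [MeasurableSpace α]
    [MeasurableSpace β] {W : Ω → α} {V : Ω → β} (hW : Measurable W) (hV : Measurable V)
    (hind : IndepFun W V P) {S : Set (α × β)} (hS : MeasurableSet S) {δ : ℝ≥0∞}
    (h : ∀ w, P {ω | (w, V ω) ∈ S} ≤ δ) : P {ω | (W ω, V ω) ∈ S} ≤ δ := by
  have : IsProbabilityMeasure (P.map W) := Measure.isProbabilityMeasure_map hW.aemeasurable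
  have h1 : P {ω | (W ω, V ω) ∈ S} = (P.map fun ω => (W ω, V ω)) S :=
    (Measure.map_apply (hW.prodMk hV) hS).symm
  rw [h1, (indepFun_iff_map_prod_eq_prod_map_map hW.aemeasurable hV.aemeasurable).1 hind,
    Measure.prod_apply hS]
  calc ∫⁻ w, (P.map V) (Prod.mk w ⁻¹' S) ∂(P.map W) ≤ ∫⁻ _, δ ∂(P.map W) := by
        refine lintegral_mono fun w => ?_
        rw [Measure.map_apply hV (measurable_prodMk_left hS)]
        exact h w
    _ = δ := by simp

open Classical in
/-- The indices of the observations that fall into `I`. -/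
noncomputable def idx [Fintype ι] (w : ι → ℝ) (I : Set ℝ) : Finset ι :=
  Finset.univ.filter fun i => w i ∈ I

@[simp] lemma mem_idx [Fintype ι] {w : ι → ℝ} {I : Set ℝ} {i : ι} : i ∈ idx w I ↔ w i ∈ I := by
  simp [idx]

lemma idx_mono [Fintype ι] {w : ι → ℝ} {I J : Set ℝ} (h : I ⊆ J) : idx w I ⊆ idx w J := by
  intro i; simpa using @h (w i)

lemma sum_idx_eq [Fintype ι] (w : ι → ℝ) (I : Set ℝ) (f : ι → ℝ) :
    ∑ i ∈ idx w I, f i = ∑ i, I.indicator (fun _ => f i) (w i) := by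
  classical
  rw [idx, Finset.sum_filter]
  simp [Set.indicator]

lemma card_idx_eq [Fintype ι] (w : ι → ℝ) (I : Set ℝ) :
    ((idx w I).card : ℝ) = ∑ i, I.indicator (fun _ => (1 : ℝ)) (w i) := by
  rw [← sum_idx_eq]; simp

lemma measurable_card_idx [Fintype ι] {I : Set ℝ} (hI : MeasurableSet I) :
    Measurable fun w : ι → ℝ => ((idx w I).card : ℝ) := by
  simp_rw [card_idx_eq]
  exact Finset.measurable_sum _ fun i _ =>
    (measurable_const.indicator hI).comp (measurable_pi_apply i)

/-- A uniform deviation inequality for the sums over the observations with `w i ≤ τ`. -/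
lemma measure_exists_prefix_sum_gt_le [Fintype ι] {W : Ω → ι → ℝ} (hW : Measurable W)
    {Z : ι → Ω → ℝ} (hZm : ∀ i, Measurable (Z i)) (hind : iIndepFun Z P)
    (hWZ : IndepFun W (fun ω i => Z i ω) P) {a : ℝ} (ha : 0 < a)
    (hZ : ∀ i, HasExpMoment (Z i) a P) {A L : ℝ} (hA : 0 ≤ A) (hL : 0 ≤ L) {I : Set ℝ}
    (hI : MeasurableSet I) :
    P {ω | ∃ τ : ℝ, A * √(((idx (W ω) I).card + L) * L) <
        |∑ i ∈ idx (W ω) (I ∩ Set.Iic τ), (Z i ω - ∫ ω, Z i ω ∂P)|} ≤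
      ENNReal.ofReal (2 * Real.exp ((4 - a * A / 2) * L)) := by
  classical
  -- Cutting only at observed values `w k` makes the bad event a finite union, hence measurable.
  set S : Set ((ι → ℝ) × (ι → ℝ)) := ⋃ k : ι, {q | A * √(((idx q.1 I).card + L) * L) <
        |∑ i, if q.1 i ∈ I ∧ q.1 i ≤ q.1 k then (q.2 i - ∫ ω, Z i ω ∂P) else 0|} with hS
  have hSm : MeasurableSet S := by
    refine MeasurableSet.iUnion fun k => measurableSet_lt ?_ ?_
    · have := (measurable_card_idx (ι := ι) hI).comp
        (measurable_fst : Measurable fun q : (ι → ℝ) × (ι → ℝ) => q.1)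
      simp only [Function.comp_def] at this
      fun_prop
    · refine Measurable.abs (Finset.measurable_sum _ fun i _ => Measurable.ite ?_ ?_ ?_)
      · have hmi : ∀ j, Measurable fun q : (ι → ℝ) × (ι → ℝ) => q.1 j := fun j => by fun_prop
        exact (hmi i hI).inter (measurableSet_le (hmi i) (hmi k))
      · fun_prop
      · fun_prop
  have hfilter : ∀ (w : ι → ℝ) (z : ι → ℝ) (τ : ℝ),
      (∑ i, if w i ∈ I ∧ w i ≤ τ then (z i - ∫ ω, Z i ω ∂P) else 0) =
        ∑ i ∈ idx w (I ∩ Set.Iic τ), (z i - ∫ ω, Z i ω ∂P) := by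
    intro w z τ
    rw [idx, Finset.sum_filter]
    simp
  refine (measure_mono ?_).trans (measure_prodMk_mem_le_of_indepFun hW
    (measurable_pi_iff.2 hZm) hWZ hSm fun w => ?_)
  · rintro ω ⟨τ, hτ⟩
    -- An empty sum cannot exceed the nonnegative threshold. So the prefix has a largest `w k`, and
    -- cutting there gives the same prefix.
    have hne : (idx (W ω) (I ∩ Set.Iic τ)).Nonempty := by
      by_contra hcon
      rw [Finset.not_nonempty_iff_eq_empty.1 hcon] at hτ
      simp only [Finset.sum_empty, abs_zero] at hτ
      exact absurd hτ (not_lt.2 (by positivity))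
    obtain ⟨k, hk, hmax⟩ := Finset.exists_max_image _ (W ω) hne
    refine Set.mem_iUnion.2 ⟨k, ?_⟩
    simp only [Set.mem_ofPred_eq]
    rw [hfilter]
    have : idx (W ω) (I ∩ Set.Iic (W ω k)) = idx (W ω) (I ∩ Set.Iic τ) := by
      ext i
      simp only [mem_idx, Set.mem_inter_iff, Set.mem_Iic] at hk hmax ⊢
      exact ⟨fun h => ⟨h.1, h.2.trans hk.2⟩, fun h => ⟨h.1, hmax i h⟩⟩
    rwa [this]
  · refine (measure_mono ?_).trans (measure_exists_chain_abs_sum_gt_le hZm hind ha hZ hL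
      (Finset.univ.image fun k => idx w (I ∩ Set.Iic (w k))) ?_ (idx w I) ?_)
    · intro ω hω
      obtain ⟨k, hk⟩ := Set.mem_iUnion.1 hω
      simp only [Set.mem_ofPred_eq] at hk
      rw [hfilter] at hk
      exact ⟨_, Finset.mem_image_of_mem _ (Finset.mem_univ k), hk⟩
    · simp only [Finset.mem_image, Finset.mem_univ, true_and]
      rintro _ ⟨k, rfl⟩ _ ⟨k', rfl⟩
      rcases le_total (w k) (w k') with h | h
      · exact Or.inl (idx_mono (Set.inter_subset_inter_right _ (Set.Iic_subset_Iic.2 h)))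
      · exact Or.inr (idx_mono (Set.inter_subset_inter_right _ (Set.Iic_subset_Iic.2 h)))
    · simp only [Finset.mem_image, Finset.mem_univ, true_and]
      rintro _ ⟨k, rfl⟩
      exact idx_mono Set.inter_subset_left

/-- A deviation inequality for the sum over the observations that fall into a fixed set. -/
lemma measure_sum_idx_gt_le [Fintype ι] {W : Ω → ι → ℝ} (hW : Measurable W)
    {Z : ι → Ω → ℝ} (hZm : ∀ i, Measurable (Z i)) (hind : iIndepFun Z P)
    (hWZ : IndepFun W (fun ω i => Z i ω) P) {a : ℝ} (ha : 0 < a)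
    (hZ : ∀ i, HasExpMoment (Z i) a P) {A L : ℝ} (hA : 0 ≤ A) (hL : 0 ≤ L) {I : Set ℝ}
    (hI : MeasurableSet I) :
    P {ω | A * √(((idx (W ω) I).card + L) * L) <
        |∑ i ∈ idx (W ω) I, (Z i ω - ∫ ω, Z i ω ∂P)|} ≤
      ENNReal.ofReal (2 * Real.exp ((4 - a * A / 2) * L)) := by
  refine (measure_mono ?_).trans
    (measure_exists_prefix_sum_gt_le hW hZm hind hWZ ha hZ hA hL hI)
  intro ω hω
  rcases isEmpty_or_nonempty ι with hι | hι
  · refine ⟨0, ?_⟩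
    simpa [Finset.eq_empty_of_isEmpty] using hω
  · obtain ⟨k, -, hk⟩ := Finset.exists_max_image Finset.univ (W ω) Finset.univ_nonempty
    refine ⟨W ω k, ?_⟩
    have : idx (W ω) (I ∩ Set.Iic (W ω k)) = idx (W ω) I := by
      ext i; simp [hk i]
    rw [this]
    exact hω

end Deviations

/-! ### Chernoff bounds for the number of observations in a set -/

section Counts

variable {Ω ι : Type*} [MeasurableSpace Ω] {P : Measure Ω} [IsProbabilityMeasure P] [Fintype ι]

lemma lintegral_exp_card_idx_le {W : Ω → ι → ℝ} (hW : ∀ i, Measurable fun ω => W ω i)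
    (hind : iIndepFun (fun i ω => W ω i) P) {ν : Measure ℝ} (hν : ∀ i, P.map (fun ω => W ω i) = ν)
    {I : Set ℝ} (hI : MeasurableSet I) (lam : ℝ) :
    ∫⁻ ω, ENNReal.ofReal (Real.exp (lam * (idx (W ω) I).card)) ∂P ≤
      ENNReal.ofReal (Real.exp (Fintype.card ι * (ν.real I * (Real.exp lam - 1)))) := by
  classical
  set g : ι → Ω → ℝ≥0∞ := fun i ω =>
    ENNReal.ofReal (Real.exp (lam * I.indicator (fun _ => (1 : ℝ)) (W ω i))) with hg
  have hm : Measurable fun x : ℝ =>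
      ENNReal.ofReal (Real.exp (lam * I.indicator (fun _ => (1 : ℝ)) x)) := by
    have : Measurable fun x : ℝ => I.indicator (fun _ => (1 : ℝ)) x :=
      measurable_const.indicator hI
    fun_prop
  have hgm : ∀ i, Measurable (g i) := fun i => hm.comp (hW i)
  have hgind : iIndepFun g P := hind.comp (fun _ x =>
    ENNReal.ofReal (Real.exp (lam * I.indicator (fun _ => (1 : ℝ)) x))) fun _ => hm
  have h1 : ∀ ω, ENNReal.ofReal (Real.exp (lam * (idx (W ω) I).card)) = ∏ i, g i ω := by
    intro ω
    rw [hg, ← ENNReal.ofReal_prod_of_nonneg (fun _ _ => (Real.exp_pos _).le), ← Real.exp_sum,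
      ← Finset.mul_sum, card_idx_eq]
  have h2 : ∀ i, ∫⁻ ω, g i ω ∂P ≤ ENNReal.ofReal (Real.exp (ν.real I * (Real.exp lam - 1))) := by
    intro i
    have hset : MeasurableSet {ω | W ω i ∈ I} := hW i hI
    have hP : P.real {ω | W ω i ∈ I} = ν.real I := by
      rw [← hν i, map_measureReal_apply (hW i) hI]; rfl
    have h3 : ∀ ω, g i ω = ENNReal.ofReal
        (1 + {ω | W ω i ∈ I}.indicator (fun _ => Real.exp lam - 1) ω) := by
      intro ω
      by_cases h : W ω i ∈ I <;> simp [hg, Set.indicator, h]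
    simp_rw [h3]
    have hint : Integrable (fun ω => 1 + {ω | W ω i ∈ I}.indicator (fun _ => Real.exp lam - 1) ω)
        P := (integrable_const _).add ((integrable_const _).indicator hset)
    rw [← ofReal_integral_eq_lintegral_ofReal hint, integral_add (integrable_const _)
      ((integrable_const _).indicator hset), integral_indicator_const _ hset, hP]
    · refine ENNReal.ofReal_le_ofReal ?_
      simp only [integral_const, probReal_univ, smul_eq_mul, mul_one]
      linarith [Real.add_one_le_exp (ν.real I * (Real.exp lam - 1))]
    · refine Eventually.of_forall fun ω => ?_
      by_cases h : W ω i ∈ I <;> simp [Set.indicator, h, (Real.exp_pos lam).le]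
  simp_rw [h1]
  rw [lintegral_prod_eq_prod_lintegral_of_indepFun _ _ hgind hgm]
  refine (Finset.prod_le_prod' fun i _ => h2 i).trans ?_
  rw [Finset.prod_const, ← ENNReal.ofReal_pow (Real.exp_pos _).le, ← Real.exp_nat_mul,
    Finset.card_univ]

lemma measure_exp_card_idx_ge_le {W : Ω → ι → ℝ} (hW : ∀ i, Measurable fun ω => W ω i)
    (hind : iIndepFun (fun i ω => W ω i) P) {ν : Measure ℝ} (hν : ∀ i, P.map (fun ω => W ω i) = ν)
    {I : Set ℝ} (hI : MeasurableSet I) (lam t : ℝ) :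
    P {ω | t ≤ lam * (idx (W ω) I).card} ≤
      ENNReal.ofReal (Real.exp (Fintype.card ι * (ν.real I * (Real.exp lam - 1)) - t)) := by
  have hm : Measurable fun ω => ENNReal.ofReal (Real.exp (lam * (idx (W ω) I).card)) := by
    have := (measurable_card_idx (ι := ι) hI).comp (measurable_pi_iff.2 hW)
    simp only [Function.comp_def] at this
    fun_prop
  have h := (mul_meas_ge_le_lintegral (μ := P) hm (ENNReal.ofReal (Real.exp t))).trans
    (lintegral_exp_card_idx_le hW hind hν hI lam)
  rw [Real.exp_sub, ENNReal.ofReal_div_of_pos (Real.exp_pos _),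
    ENNReal.le_div_iff_mul_le (by simp [Real.exp_pos]) (by simp), mul_comm]
  refine le_trans ?_ h
  gcongr with ω
  intro hω
  exact ENNReal.ofReal_le_ofReal (Real.exp_le_exp.2 hω)

/-- The exponential bound at parameter `1`, where `e - 1 < 2`. -/
lemma measure_card_idx_gt_le {W : Ω → ι → ℝ} (hW : ∀ i, Measurable fun ω => W ω i)
    (hind : iIndepFun (fun i ω => W ω i) P) {ν : Measure ℝ} (hν : ∀ i, P.map (fun ω => W ω i) = ν)
    {I : Set ℝ} (hI : MeasurableSet I) {q : ℝ} (hq : ν.real I ≤ q) (L : ℝ) :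
    P {ω | 2 * (Fintype.card ι * q) + L < (idx (W ω) I).card} ≤
      ENNReal.ofReal (Real.exp (-L)) := by
  refine (measure_mono fun ω hω => ?_).trans ((measure_exp_card_idx_ge_le hW hind hν hI 1
    (2 * (Fintype.card ι * q) + L)).trans (ENNReal.ofReal_le_ofReal (Real.exp_le_exp.2 ?_)))
  · simpa using le_of_lt hω
  · have h1 : ν.real I * (Real.exp 1 - 1) ≤ q * 2 := by
      have := Real.exp_one_lt_d9
      have h0 : 0 ≤ ν.real I := measureReal_nonneg
      nlinarith
    nlinarith [mul_le_mul_of_nonneg_left h1 (Nat.cast_nonneg (α := ℝ) (Fintype.card ι))]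

/-- The exponential bound at parameter `-1`: since `1 - 1/e > 6/10`, a margin of `1/10` remains
beyond the level `1/2`. -/
lemma measure_card_idx_lt_le {W : Ω → ι → ℝ} (hW : ∀ i, Measurable fun ω => W ω i)
    (hind : iIndepFun (fun i ω => W ω i) P) {ν : Measure ℝ} (hν : ∀ i, P.map (fun ω => W ω i) = ν)
    {I : Set ℝ} (hI : MeasurableSet I) {q : ℝ} (hq0 : 0 ≤ q) (hq : q ≤ ν.real I) :
    P {ω | (idx (W ω) I).card < Fintype.card ι * q / 2} ≤
      ENNReal.ofReal (Real.exp (-(Fintype.card ι * q / 10))) := by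
  refine (measure_mono fun ω hω => ?_).trans ((measure_exp_card_idx_ge_le hW hind hν hI (-1)
    (-(Fintype.card ι * q / 2))).trans (ENNReal.ofReal_le_ofReal (Real.exp_le_exp.2 ?_)))
  · have : ((idx (W ω) I).card : ℝ) < Fintype.card ι * q / 2 := hω
    simp only [Set.mem_ofPred_eq]
    linarith
  · have h1 : ν.real I * (Real.exp (-1) - 1) ≤ -(q * (6 / 10)) := by
      have := Real.exp_neg_one_lt_d9
      nlinarith
    nlinarith [mul_le_mul_of_nonneg_left h1 (Nat.cast_nonneg (α := ℝ) (Fintype.card ι))]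

end Counts

/-! ### Nets of sparse vectors -/

section Nets

/-- A maximal `1/2`-separated subset of the unit ball is a net. Doubling it gives a `1`-separated
set in the ball of radius two, where packing allows at most `5 ^ d` points; if no net of that size
existed, separated sets could be enlarged forever. -/
lemma exists_half_net (E : Type*) [NormedAddCommGroup E] [NormedSpace ℝ E]
    [FiniteDimensional ℝ E] :
    ∃ N : Finset E, N.card ≤ 5 ^ Module.finrank ℝ E ∧ (∀ c ∈ N, ‖c‖ ≤ 1) ∧
      ∀ x : E, ‖x‖ ≤ 1 → ∃ c ∈ N, ‖x - c‖ ≤ 1 / 2 := by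
  classical
  have hcard : ∀ N : Finset E, (∀ c ∈ N, ‖c‖ ≤ 1) →
      (∀ c ∈ N, ∀ d ∈ N, c ≠ d → 1 / 2 ≤ ‖c - d‖) → N.card ≤ 5 ^ Module.finrank ℝ E := by
    intro N h1 h2
    have hinj : Function.Injective fun c : E => (2 : ℝ) • c :=
      smul_right_injective E two_ne_zero
    rw [← Finset.card_image_of_injective N hinj]
    refine Besicovitch.card_le_of_separated _ ?_ ?_
    · intro c hc
      obtain ⟨c', hc', rfl⟩ := Finset.mem_image.1 hc
      simp only [norm_smul, Real.norm_ofNat]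
      linarith [h1 c' hc']
    · intro c hc d hd hne
      obtain ⟨c', hc', rfl⟩ := Finset.mem_image.1 hc
      obtain ⟨d', hd', rfl⟩ := Finset.mem_image.1 hd
      rw [← smul_sub, norm_smul, Real.norm_ofNat]
      linarith [h2 c' hc' d' hd' fun h => hne (by rw [h])]
  by_contra hcon
  push Not at hcon
  have hbig : ∀ k : ℕ, ∃ N : Finset E, (∀ c ∈ N, ‖c‖ ≤ 1) ∧
      (∀ c ∈ N, ∀ d ∈ N, c ≠ d → 1 / 2 ≤ ‖c - d‖) ∧ N.card = k := by
    intro k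
    induction k with
    | zero => exact ⟨∅, by simp⟩
    | succ k ih =>
      obtain ⟨N, h1, h2, h3⟩ := ih
      obtain ⟨x, hx, hfar⟩ := hcon N (hcard N h1 h2) h1
      have hxN : x ∉ N := fun h => by
        have := hfar x h
        rw [sub_self, norm_zero] at this
        linarith
      refine ⟨insert x N, ?_, ?_, by rw [Finset.card_insert_of_notMem hxN, h3]⟩
      · intro c hc
        rcases Finset.mem_insert.1 hc with rfl | hc
        · exact hx
        · exact h1 c hc
      · intro c hc d hd hne
        rcases Finset.mem_insert.1 hc with hcx | hcN
        · rcases Finset.mem_insert.1 hd with hdx | hdN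
          · exact absurd (hcx.trans hdx.symm) hne
          · rw [hcx]; exact (hfar d hdN).le
        · rcases Finset.mem_insert.1 hd with hdx | hdN
          · rw [hdx, norm_sub_rev]; exact (hfar c hcN).le
          · exact h2 c hcN d hdN hne
  obtain ⟨N, h1, h2, h3⟩ := hbig (5 ^ Module.finrank ℝ E + 1)
  have := hcard N h1 h2
  omega

/-- Approximating a unit vector by the net gives `‖f‖ ≤ δ + ‖f‖ / 2`, because the remainder has norm
at most one half. -/
lemma abs_le_of_half_net {E : Type*} [NormedAddCommGroup E] [NormedSpace ℝ E]
    [FiniteDimensional ℝ E] {N : Finset E} (hN : ∀ x : E, ‖x‖ ≤ 1 → ∃ c ∈ N, ‖x - c‖ ≤ 1 / 2)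
    (f : E →ₗ[ℝ] ℝ) {δ : ℝ} (hf : ∀ c ∈ N, |f c| ≤ δ) (x : E) : |f x| ≤ 2 * δ * ‖x‖ := by
  set g : E →L[ℝ] ℝ := f.toContinuousLinearMap with hg
  have hgf : ∀ x, g x = f x := fun x => rfl
  have hδ : 0 ≤ δ := by
    obtain ⟨c, hc, -⟩ := hN 0 (by simp)
    exact (abs_nonneg _).trans (hf c hc)
  have h1 : ‖g‖ ≤ δ + ‖g‖ / 2 := by
    refine ContinuousLinearMap.opNorm_le_of_unit_norm (by positivity) fun x hx => ?_
    obtain ⟨c, hc, hxc⟩ := hN x hx.le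
    calc ‖g x‖ = ‖g c + g (x - c)‖ := by rw [← map_add]; congr 2; abel
      _ ≤ ‖g c‖ + ‖g (x - c)‖ := norm_add_le _ _
      _ ≤ δ + ‖g‖ * (1 / 2) := by
          refine add_le_add ?_ ((g.le_opNorm _).trans (by gcongr))
          rw [hgf, Real.norm_eq_abs]; exact hf c hc
      _ = δ + ‖g‖ / 2 := by ring
  have h2 : ‖g‖ ≤ 2 * δ := by linarith
  calc |f x| = ‖g x‖ := by rw [hgf, Real.norm_eq_abs]
    _ ≤ ‖g‖ * ‖x‖ := g.le_opNorm x
    _ ≤ 2 * δ * ‖x‖ := by gcongr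

variable {p : ℕ}

/-- At most `s` coordinates of `v` are nonzero. -/
def IsSparse (s : ℕ) (v : Vec p) : Prop := ∃ T : Finset (Fin p), T.card ≤ s ∧ ∀ j ∉ T, v j = 0

/-- The inclusion of the vectors supported by `T`. -/
noncomputable def extendZero (T : Finset (Fin p)) : EuclideanSpace ℝ T →ₗ[ℝ] Vec p where
  toFun a := WithLp.toLp 2 fun j => if h : j ∈ T then a ⟨j, h⟩ else 0
  map_add' a b := by
    ext j; by_cases h : j ∈ T <;> simp [h]
  map_smul' c a := by
    ext j; by_cases h : j ∈ T <;> simp [h]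

lemma norm_extendZero (T : Finset (Fin p)) (a : EuclideanSpace ℝ T) : ‖extendZero T a‖ = ‖a‖ := by
  classical
  rw [EuclideanSpace.norm_eq, EuclideanSpace.norm_eq]
  congr 1
  have h1 : ∀ j : T, ‖a j‖ ^ 2 = ‖extendZero T a j‖ ^ 2 := by
    intro j; simp [extendZero]
  simp_rw [h1]
  rw [Finset.sum_coe_sort T fun j => ‖extendZero T a j‖ ^ 2]
  refine (Finset.sum_subset (Finset.subset_univ T) fun j _ hj => ?_).symm
  simp [extendZero, hj]

lemma exists_extendZero {T : Finset (Fin p)} {v : Vec p} (hv : ∀ j ∉ T, v j = 0) :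
    ∃ a : EuclideanSpace ℝ T, extendZero T a = v := by
  refine ⟨WithLp.toLp 2 fun j => v j, ?_⟩
  ext j
  by_cases h : j ∈ T
  · simp [extendZero, h]
  · simp [extendZero, h, hv j h]

/-- A finite set of vectors that controls every bilinear form on the `s`-sparse vectors. -/
lemma exists_sparse_net (p s : ℕ) (hp : 1 ≤ p) :
    ∃ N : Finset (Vec p), N.card ≤ (5 * p) ^ s ∧ (∀ c ∈ N, ‖c‖ ≤ 1) ∧
      ∀ (G : Vec p →ₗ[ℝ] Vec p →ₗ[ℝ] ℝ) (δ : ℝ), (∀ c ∈ N, ∀ d ∈ N, |G c d| ≤ δ) →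
        ∀ u v, IsSparse s u → IsSparse s v → |G u v| ≤ 4 * δ * ‖u‖ * ‖v‖ := by
  classical
  choose! net hcard hnorm hnet using fun T : Finset (Fin p) => exists_half_net (EuclideanSpace ℝ T)
  -- Supports are enumerated by maps `Fin s → Fin p`, with repetitions. There are `p ^ s` of them,
  -- each carrying a net of at most `5 ^ s` points.
  set N : Finset (Vec p) := Finset.univ.biUnion fun f : Fin s → Fin p =>
    (net (Finset.univ.image f)).image (extendZero (Finset.univ.image f)) with hN
  have hsub : ∀ v : Vec p, IsSparse s v → ∃ f : Fin s → Fin p,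
      ∀ j ∉ Finset.univ.image f, v j = 0 := by
    rintro v ⟨T, hT, hv⟩
    -- Surplus indices go to coordinate `0`, which can only enlarge the support.
    refine ⟨fun i => if h : (i : ℕ) < T.card then T.equivFin.symm ⟨i, h⟩ else ⟨0, hp⟩,
      fun j hj => hv j fun hjT => hj ?_⟩
    rw [Finset.mem_image]
    refine ⟨⟨T.equivFin ⟨j, hjT⟩, (T.equivFin ⟨j, hjT⟩).2.trans_le hT⟩, Finset.mem_univ _, ?_⟩
    simp
  refine ⟨N, ?_, ?_, ?_⟩
  · calc N.card ≤ ∑ f : Fin s → Fin p,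
          ((net (Finset.univ.image f)).image (extendZero (Finset.univ.image f))).card :=
        Finset.card_biUnion_le
      _ ≤ ∑ _f : Fin s → Fin p, 5 ^ s := by
        refine Finset.sum_le_sum fun f _ => Finset.card_image_le.trans ((hcard _).trans ?_)
        refine Nat.pow_le_pow_right (by norm_num) ?_
        rw [finrank_euclideanSpace, Fintype.card_coe]
        exact Finset.card_image_le.trans (by simp)
      _ = (5 * p) ^ s := by
        simp [mul_pow, mul_comm]
  · intro c hc
    obtain ⟨f, -, hc⟩ := Finset.mem_biUnion.1 hc
    obtain ⟨a, ha, rfl⟩ := Finset.mem_image.1 hc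
    rw [norm_extendZero]
    exact hnorm _ a ha
  · intro G δ hG u v hu hv
    obtain ⟨f, hf⟩ := hsub u hu
    obtain ⟨g, hg⟩ := hsub v hv
    obtain ⟨a, rfl⟩ := exists_extendZero hf
    obtain ⟨b, rfl⟩ := exists_extendZero hg
    rw [norm_extendZero, norm_extendZero]
    have hmem : ∀ (f : Fin s → Fin p), ∀ c ∈ net (Finset.univ.image f),
        extendZero (Finset.univ.image f) c ∈ N := fun f c hc =>
      Finset.mem_biUnion.2 ⟨f, Finset.mem_univ f, Finset.mem_image_of_mem _ hc⟩
    have h1 : ∀ c ∈ net (Finset.univ.image f),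
        |G (extendZero _ c) (extendZero (Finset.univ.image g) b)| ≤ 2 * δ * ‖b‖ := fun c hc =>
      abs_le_of_half_net (hnet (Finset.univ.image g))
        ((G (extendZero _ c)).comp (extendZero (Finset.univ.image g)))
        (fun d hd => hG _ (hmem f c hc) _ (hmem g d hd)) b
    have h2 := abs_le_of_half_net (hnet (Finset.univ.image f))
      ((G.flip (extendZero (Finset.univ.image g) b)).comp (extendZero (Finset.univ.image f)))
      h1 a
    simp only [LinearMap.comp_apply, LinearMap.flip_apply] at h2
    linarith

end Nets

/-! ### From sparse vectors to all vectors by blocks of decreasing size -/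

section Blocks

variable {p : ℕ}

lemma l1Norm_nonneg (v : Vec p) : 0 ≤ l1Norm v := Finset.sum_nonneg fun _ _ => abs_nonneg _

lemma exists_top_subset (v : Vec p) {k : ℕ} (hk : k ≤ p) :
    ∃ T : Finset (Fin p), T.card = k ∧ ∀ i ∈ T, ∀ j ∉ T, |v j| ≤ |v i| := by
  classical
  induction k with
  | zero => exact ⟨∅, by simp⟩
  | succ k ih =>
    obtain ⟨T, hT, htop⟩ := ih (by omega)
    have hne : (Finset.univ \ T).Nonempty := by
      rw [← Finset.card_pos, Finset.card_sdiff_of_subset (Finset.subset_univ T)]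
      simp; omega
    obtain ⟨i₀, hi₀, hmax⟩ := Finset.exists_max_image _ (fun j => |v j|) hne
    have hi₀T : i₀ ∉ T := by simpa using hi₀
    refine ⟨insert i₀ T, by rw [Finset.card_insert_of_notMem hi₀T, hT], fun i hi j hj => ?_⟩
    rw [Finset.mem_insert, not_or] at hj
    rcases Finset.mem_insert.1 hi with rfl | hi
    · exact hmax j (by simp [hj.2])
    · exact htop i hi j hj.2

/-- The restriction of a vector to the coordinates in `T`. -/
noncomputable def restrictVec (T : Finset (Fin p)) (v : Vec p) : Vec p :=
  WithLp.toLp 2 fun j => if j ∈ T then v j else 0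

lemma restrictVec_apply (T : Finset (Fin p)) (v : Vec p) (j : Fin p) :
    restrictVec T v j = if j ∈ T then v j else 0 := rfl

lemma norm_restrictVec_le (T : Finset (Fin p)) (v : Vec p) : ‖restrictVec T v‖ ≤ ‖v‖ := by
  rw [EuclideanSpace.norm_eq, EuclideanSpace.norm_eq]
  refine Real.sqrt_le_sqrt (Finset.sum_le_sum fun j _ => ?_)
  rw [restrictVec_apply]
  split_ifs
  · exact le_rfl
  · simpa using sq_nonneg (v j)

lemma norm_restrictVec_le_of_abs_le {T : Finset (Fin p)} {s : ℕ} (hT : T.card ≤ s) {v : Vec p}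
    {B : ℝ} (hB : ∀ j, |v j| ≤ B) (hB0 : 0 ≤ B) : ‖restrictVec T v‖ ≤ √s * B := by
  rw [EuclideanSpace.norm_eq, Real.sqrt_le_left (by positivity), mul_pow,
    Real.sq_sqrt (by positivity)]
  calc ∑ j, ‖restrictVec T v j‖ ^ 2 = ∑ j, if j ∈ T then |v j| ^ 2 else 0 := by
        refine Finset.sum_congr rfl fun j _ => ?_
        rw [restrictVec_apply]; split_ifs <;> simp
    _ = ∑ j ∈ T, |v j| ^ 2 := by simp
    _ ≤ ∑ j ∈ T, B ^ 2 := Finset.sum_le_sum fun j _ => by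
        have := hB j
        gcongr
    _ = T.card * B ^ 2 := by simp
    _ ≤ s * B ^ 2 := by gcongr

lemma l1Norm_restrictVec_add (T : Finset (Fin p)) (v : Vec p) :
    l1Norm (restrictVec T v) + l1Norm (v - restrictVec T v) = l1Norm v := by
  rw [l1Norm, l1Norm, l1Norm, ← Finset.sum_add_distrib]
  refine Finset.sum_congr rfl fun j _ => ?_
  rw [PiLp.sub_apply, restrictVec_apply]
  split_ifs <;> simp

lemma l1Norm_restrictVec (T : Finset (Fin p)) (v : Vec p) :
    l1Norm (restrictVec T v) = ∑ j ∈ T, |v j| := by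
  rw [l1Norm, ← Finset.sum_subset (Finset.subset_univ T)]
  · exact Finset.sum_congr rfl fun j hj => by simp [restrictVec_apply, hj]
  · intro j _ hj; simp [restrictVec_apply, hj]

lemma isSparse_restrictVec {T : Finset (Fin p)} {s : ℕ} (hT : T.card ≤ s) (v : Vec p) :
    IsSparse s (restrictVec T v) := ⟨T, hT, fun j hj => by simp [restrictVec_apply, hj]⟩

/-- Splitting off the `s` largest coordinates. -/
lemma exists_block {s : ℕ} (hs : 1 ≤ s) {v : Vec p} {T₀ : Finset (Fin p)}
    (hT₀ : ∀ j ∉ T₀, v j = 0) (hlt : s < T₀.card) (hne : ∀ j ∈ T₀, v j ≠ 0) :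
    ∃ T : Finset (Fin p), T.card = s ∧ T ⊆ T₀ ∧
      ∀ j, |(v - restrictVec T v) j| ≤ l1Norm (restrictVec T v) / s := by
  obtain ⟨T, hT, htop⟩ := exists_top_subset v (k := s)
    (hlt.le.trans ((Finset.card_le_univ T₀).trans (by simp)))
  have hs0 : (0 : ℝ) < s := by exact_mod_cast hs
  refine ⟨T, hT, fun i hi => ?_, fun j => ?_⟩
  · by_contra hi₀
    obtain ⟨j, hj, hjT⟩ := Finset.exists_mem_notMem_of_card_lt_card (hT ▸ hlt)
    have := htop i hi j hjT
    rw [hT₀ i hi₀, abs_zero] at this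
    exact hne j hj (abs_nonpos_iff.1 this)
  · rw [PiLp.sub_apply, restrictVec_apply]
    split_ifs with hj
    · rw [sub_self, abs_zero]
      exact div_nonneg (l1Norm_nonneg _) hs0.le
    · rw [sub_zero, le_div_iff₀ hs0, l1Norm_restrictVec, ← hT, mul_comm]
      simpa using Finset.card_nsmul_le_sum T (fun i => |v i|) (|v j|) fun i hi => htop i hi j hj

variable {f : Vec p → ℝ} {K : ℝ} {s : ℕ}

lemma restrictVec_eq_self {T : Finset (Fin p)} {v : Vec p} (h : ∀ j ∉ T, v j = 0) :
    restrictVec T v = v := by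
  ext j
  rw [restrictVec_apply]
  split_ifs with hj
  · rfl
  · exact (h j hj).symm

/-- The block of the `s` largest coordinates has norm at most `√s B`. Every remaining coordinate is
at most the average over that block, so the remainder satisfies the hypotheses with `B` replaced by
`‖block‖₁ / s`. The contributions `‖block‖₁ / √s` then add up to at most `‖v‖₁ / √s`. -/
lemma le_of_sparse_le_aux (hadd : ∀ a b, f (a + b) ≤ f a + f b) (hK : 0 ≤ K) (hs : 1 ≤ s)
    (hf : ∀ v, IsSparse s v → f v ≤ K * ‖v‖) (m : ℕ) :
    ∀ (v : Vec p) (B : ℝ), (Finset.univ.filter fun j => v j ≠ 0).card ≤ m → (∀ j, |v j| ≤ B) →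
      0 ≤ B → f v ≤ K * (√s * B + l1Norm v / √s) := by
  have hs0 : (0 : ℝ) < s := by exact_mod_cast hs
  induction m using Nat.strong_induction_on with
  | _ m ih =>
    intro v B hm hB hB0
    set T₀ := Finset.univ.filter fun j => v j ≠ 0 with hT₀
    have hv0 : ∀ j ∉ T₀, v j = 0 := fun j hj => by simpa [hT₀] using hj
    by_cases hcard : T₀.card ≤ s
    · refine (hf v ⟨T₀, hcard, hv0⟩).trans ?_
      have := norm_restrictVec_le_of_abs_le hcard hB hB0
      rw [restrictVec_eq_self hv0] at this
      have h2 : 0 ≤ l1Norm v / √s := div_nonneg (l1Norm_nonneg _) (Real.sqrt_nonneg _)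
      gcongr
      linarith
    · push Not at hcard
      obtain ⟨T, hT, hTT₀, hrest⟩ := exists_block hs hv0 hcard fun j hj => by
        simpa [hT₀] using hj
      set a := restrictVec T v with ha
      set b := v - a with hb
      have hbcard : (Finset.univ.filter fun j => b j ≠ 0).card < m := by
        refine lt_of_lt_of_le (Finset.card_lt_card ?_) hm
        have hTne : T.Nonempty := by rw [← Finset.card_pos]; omega
        obtain ⟨i, hi⟩ := hTne
        rw [Finset.ssubset_iff_of_subset]
        · refine ⟨i, hTT₀ hi, ?_⟩
          simp [hb, ha, restrictVec_apply, hi]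
        · intro j hj
          simp only [Finset.mem_filter, Finset.mem_univ, true_and] at hj
          by_contra hjT
          have hjT' : j ∉ T := fun h => hjT (hTT₀ h)
          exact hj (by simp [hb, ha, restrictVec_apply, hjT', hv0 j hjT])
      have h1 := ih _ hbcard b (l1Norm a / s) le_rfl hrest
        (div_nonneg (l1Norm_nonneg _) hs0.le)
      have h2 := (hf a (isSparse_restrictVec hT.le v)).trans (mul_le_mul_of_nonneg_left
        (norm_restrictVec_le_of_abs_le hT.le hB hB0) hK)
      have h3 : √s * (l1Norm a / s) = l1Norm a / √s := by
        field_simp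
        rw [Real.sq_sqrt hs0.le, mul_comm]
      have h4 : l1Norm a + l1Norm b = l1Norm v := l1Norm_restrictVec_add T v
      calc f v = f (a + b) := by rw [hb]; congr 1; abel
        _ ≤ f a + f b := hadd a b
        _ ≤ K * (√s * B) + K * (√s * (l1Norm a / s) + l1Norm b / √s) := add_le_add h2 h1
        _ = K * (√s * B + l1Norm v / √s) := by rw [h3, ← h4]; ring

/-- A subadditive functional that is bounded by `K ‖v‖` at the sparse vectors is bounded by
`K (‖v‖ + ‖v‖₁ / √s)` everywhere. -/
lemma le_of_sparse_le (hadd : ∀ a b, f (a + b) ≤ f a + f b) (hK : 0 ≤ K) (hs : 1 ≤ s)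
    (hf : ∀ v, IsSparse s v → f v ≤ K * ‖v‖) (v : Vec p) :
    f v ≤ K * (‖v‖ + l1Norm v / √s) := by
  have hs0 : (0 : ℝ) < s := by exact_mod_cast hs
  set T₀ := Finset.univ.filter fun j => v j ≠ 0 with hT₀
  have hv0 : ∀ j ∉ T₀, v j = 0 := fun j hj => by simpa [hT₀] using hj
  by_cases hcard : T₀.card ≤ s
  · refine (hf v ⟨T₀, hcard, hv0⟩).trans ?_
    have h2 : 0 ≤ l1Norm v / √s := div_nonneg (l1Norm_nonneg _) (Real.sqrt_nonneg _)
    gcongr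
    linarith
  · push Not at hcard
    obtain ⟨T, hT, hTT₀, hrest⟩ := exists_block hs hv0 hcard fun j hj => by
      simpa [hT₀] using hj
    set a := restrictVec T v with ha
    set b := v - a with hb
    have h1 := le_of_sparse_le_aux hadd hK hs hf _ b (l1Norm a / s) le_rfl hrest
      (div_nonneg (l1Norm_nonneg _) hs0.le)
    have h2 := (hf a (isSparse_restrictVec hT.le v)).trans (mul_le_mul_of_nonneg_left
      (norm_restrictVec_le T v) hK)
    have h3 : √s * (l1Norm a / s) = l1Norm a / √s := by
      field_simp
      rw [Real.sq_sqrt hs0.le, mul_comm]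
    have h4 : l1Norm a + l1Norm b = l1Norm v := l1Norm_restrictVec_add T v
    calc f v = f (a + b) := by rw [hb]; congr 1; abel
      _ ≤ f a + f b := hadd a b
      _ ≤ K * ‖v‖ + K * (√s * (l1Norm a / s) + l1Norm b / √s) := add_le_add h2 h1
      _ = K * (‖v‖ + l1Norm v / √s) := by rw [h3, ← h4]; ring

/-- The extension from sparse vectors is applied to one argument at a time: first with the other
argument sparse and fixed, then with the full vector in its place. -/
lemma abs_bilin_le_of_sparse (hs : 1 ≤ s) (G : Vec p →ₗ[ℝ] Vec p →ₗ[ℝ] ℝ) (hK : 0 ≤ K)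
    (hG : ∀ u v, IsSparse s u → IsSparse s v → |G u v| ≤ K * ‖u‖ * ‖v‖) (v : Vec p) :
    |G v v| ≤ K * (‖v‖ + l1Norm v / √s) ^ 2 := by
  have h1 : ∀ u, IsSparse s u → |G u v| ≤ K * (‖v‖ + l1Norm v / √s) * ‖u‖ := by
    intro u hu
    have := le_of_sparse_le (f := fun w => |G u w|) (K := K * ‖u‖)
      (fun a b => by simp only [map_add]; exact abs_add_le _ _) (by positivity) hs
      (fun w hw => hG u w hu hw) v
    linarith
  have h0 : 0 ≤ ‖v‖ + l1Norm v / √s :=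
    add_nonneg (norm_nonneg _) (div_nonneg (l1Norm_nonneg _) (Real.sqrt_nonneg _))
  have := le_of_sparse_le (f := fun u => |G u v|)
    (fun a b => by simp only [map_add, LinearMap.add_apply]; exact abs_add_le _ _)
    (by positivity) hs h1 v
  rw [sq, ← mul_assoc]
  exact this

end Blocks

/-! ### Bookkeeping of exceptional events -/

section Exceptional

variable {Ω : Type*} [MeasurableSpace Ω]

/-- The property `G` holds outside of an event of probability at most `δ`. -/
def HoldsExcept (P : Measure Ω) (G : Ω → Prop) (δ : ℝ) : Prop :=
  P {ω | ¬ G ω} ≤ ENNReal.ofReal δ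

namespace HoldsExcept

variable {P : Measure Ω} {G H : Ω → Prop} {δ η : ℝ}

lemma and (hG : HoldsExcept P G δ) (hH : HoldsExcept P H η) (hδ : 0 ≤ δ) (hη : 0 ≤ η) :
    HoldsExcept P (fun ω => G ω ∧ H ω) (δ + η) := by
  rw [HoldsExcept, ENNReal.ofReal_add hδ hη]
  refine (measure_mono fun ω hω => ?_).trans ((measure_union_le _ _).trans (add_le_add hG hH))
  exact not_and_or.1 hω

lemma mono (hG : HoldsExcept P G δ) (h : ∀ ω, G ω → H ω) (hδ : δ ≤ η) : HoldsExcept P H η :=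
  (measure_mono fun ω (hω : ¬ H ω) => show ¬ G ω from fun hGω => hω (h ω hGω)).trans
    (hG.trans (ENNReal.ofReal_le_ofReal hδ))

lemma finset_forall {ι : Type*} (S : Finset ι) {G : ι → Ω → Prop}
    (h : ∀ i ∈ S, HoldsExcept P (G i) δ) : HoldsExcept P (fun ω => ∀ i ∈ S, G i ω) (S.card * δ) := by
  have h1 : {ω | ¬ ∀ i ∈ S, G i ω} = ⋃ i ∈ S, {ω | ¬ G i ω} := by
    ext ω; simp
  rw [HoldsExcept, h1]
  refine (measure_biUnion_finset_le _ _).trans ((Finset.sum_le_sum h).trans ?_)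
  rw [Finset.sum_const, nsmul_eq_mul, ENNReal.ofReal_mul (by positivity), ENNReal.ofReal_natCast]

lemma of_forall (h : ∀ ω, G ω) : HoldsExcept P G δ := by
  simp [HoldsExcept, h]

end HoldsExcept

end Exceptional

/-! ### Independence of the change inducing variables from predictors and errors -/

section Independence

variable {Ω : Type*} [MeasurableSpace Ω] {P : Measure Ω} [IsProbabilityMeasure P]

/-- The two assumptions make the law of the triple a product of its three marginals, and the factors
of a product may be regrouped. -/
lemma indepFun_middle {α β γ : Type*} [MeasurableSpace α] [MeasurableSpace β] [MeasurableSpace γ]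
    {X : Ω → α} {W : Ω → β} {E : Ω → γ} (hX : Measurable X) (hW : Measurable W)
    (hE : Measurable E) (h1 : IndepFun X W P) (h2 : IndepFun (fun ω => (X ω, W ω)) E P) :
    IndepFun W (fun ω => (X ω, E ω)) P := by
  have := Measure.isProbabilityMeasure_map hX.aemeasurable (μ := P)
  have := Measure.isProbabilityMeasure_map hW.aemeasurable (μ := P)
  have := Measure.isProbabilityMeasure_map hE.aemeasurable (μ := P)
  have h3 : IndepFun X E P := h2.comp measurable_fst measurable_id
  rw [indepFun_iff_map_prod_eq_prod_map_map hW.aemeasurable (hX.prodMk hE).aemeasurable,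
    (indepFun_iff_map_prod_eq_prod_map_map hX.aemeasurable hE.aemeasurable).1 h3]
  have h4 : P.map (fun ω => ((X ω, W ω), E ω)) =
      ((P.map X).prod (P.map W)).prod (P.map E) := by
    rw [(indepFun_iff_map_prod_eq_prod_map_map (hX.prodMk hW).aemeasurable hE.aemeasurable).1 h2,
      (indepFun_iff_map_prod_eq_prod_map_map hX.aemeasurable hW.aemeasurable).1 h1]
  have h5 : MeasurePreserving (fun q : (α × β) × γ => (Prod.swap q.1, q.2))
      (((P.map X).prod (P.map W)).prod (P.map E)) (((P.map W).prod (P.map X)).prod (P.map E)) :=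
    Measure.measurePreserving_swap.prod (MeasurePreserving.id _)
  have h6 := (measurePreserving_prodAssoc (P.map W) (P.map X) (P.map E)).comp h5
  rw [← h6.map_eq, ← h4, Measure.map_map h6.measurable ((hX.prodMk hW).prodMk hE)]
  rfl

lemma iIndepFun_bool {α : Type*} [MeasurableSpace α] {X : Bool → Ω → α}
    (h : IndepFun (X true) (X false) P) : iIndepFun X P := by
  rw [iIndepFun_iff_measure_inter_preimage_eq_mul]
  intro S sets hsets
  have hpair := fun h1 h2 => h.measure_inter_preimage_eq_mul (sets true) (sets false) h1 h2
  have hS : S = ∅ ∨ S = {true} ∨ S = {false} ∨ S = {true, false} := by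
    clear hsets; revert S; decide
  rcases hS with rfl | rfl | rfl | rfl
  · simp
  · simp
  · simp
  · have h1 := hpair (hsets true (by simp)) (hsets false (by simp))
    rw [Finset.set_biInter_insert, Finset.set_biInter_singleton, h1]
    simp

end Independence

/-! ### Moments of the predictors and errors -/

namespace Model

variable {n p : ℕ} {Ω : Type*} [MeasurableSpace Ω] {P : Measure Ω}
  {M : Model n p Ω} {C : ℝ≥0} {κ φ : ℝ}

namespace DistributionAssumptions

lemma measurable_W (h : M.DistributionAssumptions P C κ φ) : Measurable fun ω i => M.w i ω :=
  measurable_pi_iff.2 h.measurable_w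

lemma iIndepFun_w (h : M.DistributionAssumptions P C κ φ) : iIndepFun M.w P :=
  h.indep_obs.comp (fun _ q => q.2.1) fun _ => by fun_prop

lemma iIndepFun_obs (h : M.DistributionAssumptions P C κ φ) :
    iIndepFun (fun i ω => (M.x i ω, M.ε i ω)) P :=
  h.indep_obs.comp (fun _ q => (q.1, q.2.2)) fun _ => by fun_prop

lemma measurable_inner (h : M.DistributionAssumptions P C κ φ) (i : Fin n) (u : Vec p) :
    Measurable fun ω => ⟪M.x i ω, u⟫ := (h.measurable_x i).inner_const

lemma integral_noise_mul (h : M.DistributionAssumptions P C κ φ) (i : Fin n) (u : Vec p) :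
    ∫ ω, M.ε i ω * ⟪M.x i ω, u⟫ ∂P = 0 := by
  have hind : IndepFun (M.ε i) (fun ω => ⟪M.x i ω, u⟫) P :=
    ((h.indep_xw_ε i).comp (φ := fun q : Vec p × ℝ => ⟪q.1, u⟫)
      (measurable_fst.inner_const) measurable_id).symm
  rw [hind.integral_fun_mul_eq_mul_integral (h.measurable_ε i).aestronglyMeasurable
    (h.measurable_inner i u).aestronglyMeasurable, h.mean_ε i, zero_mul]

variable [IsProbabilityMeasure P]

/-- The assumptions give independence across `i` and, for each `i`, independence of `w i` from `(x
i, ε i)`. Together these make the family indexed by `Fin n × Bool` independent, and it can be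
regrouped by the second index. -/
lemma indepFun_w_obs (h : M.DistributionAssumptions P C κ φ) :
    IndepFun (fun ω i => M.w i ω) (fun ω i => (M.x i ω, M.ε i ω)) P := by
  classical
  -- A dummy zero vector is attached to `w i`, so that both kinds of variables take values in one
  -- type.
  set X : Fin n → Bool → Ω → Vec p × ℝ := fun i b ω =>
    cond b (0, M.w i ω) (M.x i ω, M.ε i ω) with hX
  have hXm : ∀ i b, Measurable (X i b) := by
    intro i b
    have h1 := h.measurable_w i
    have h2 := h.measurable_x i
    have h3 := h.measurable_ε i
    cases b
    · exact h2.prodMk h3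
    · exact measurable_const.prodMk h1
  have h1 : iIndepFun (fun i ω b => X i b ω) P := by
    refine h.indep_obs.comp (fun _ q b => cond b ((0 : Vec p), q.2.1) (q.1, q.2.2)) fun i => ?_
    refine measurable_pi_iff.2 fun b => ?_
    cases b
    · exact measurable_fst.prodMk (measurable_snd.comp measurable_snd)
    · exact measurable_const.prodMk (measurable_fst.comp measurable_snd)
  have h2 : ∀ i, iIndepFun (X i) P := fun i => iIndepFun_bool
    ((indepFun_middle (h.measurable_x i) (h.measurable_w i) (h.measurable_ε i) (h.indep_x_w i)
      (h.indep_xw_ε i)).comp (φ := fun w => ((0 : Vec p), w)) (by fun_prop) measurable_id)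
  set S : Finset (Fin n × Bool) := Finset.univ.filter fun q => q.2 = true with hS
  set T : Finset (Fin n × Bool) := Finset.univ.filter fun q => q.2 = false with hT
  have hST : Disjoint S T := by
    rw [Finset.disjoint_filter]
    intro q _ hq hq'
    rw [hq] at hq'
    exact absurd hq' (by simp)
  have h3 := (iIndepFun_uncurry' hXm h1 h2).indepFun_finset S T hST fun q => hXm q.1 q.2
  have hφ : Measurable fun (y : S → Vec p × ℝ) (i : Fin n) => (y ⟨(i, true), by simp [hS]⟩).2 :=
    measurable_pi_iff.2 fun i => measurable_snd.comp (measurable_pi_apply _)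
  have hψ : Measurable fun (y : T → Vec p × ℝ) (i : Fin n) => y ⟨(i, false), by simp [hT]⟩ :=
    measurable_pi_iff.2 fun i => measurable_pi_apply _
  exact h3.comp hφ hψ

/-- Subgaussianity is assumed in unit directions and transferred to the unit ball by scaling. The
bound `C + 1` is positive even when `C = 0`, as later divisions require. -/
lemma exists_subgaussian_inner (h : M.DistributionAssumptions P C κ φ) (i : Fin n) {u : Vec p}
    (hu : ‖u‖ ≤ 1) :
    ∃ c : ℝ≥0, (c : ℝ) ≤ C + 1 ∧ HasSubgaussianMGF (fun ω => ⟪M.x i ω, u⟫) c P := by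
  obtain ⟨σ2, hσ, hx⟩ := h.subgaussian_x
  rcases eq_or_ne u 0 with rfl | hu0
  · refine ⟨0, by positivity, ?_⟩
    simp
  · have h1 := (hx i ((‖u‖⁻¹ : ℝ) • u) (by
      rw [norm_smul, norm_inv, norm_norm, inv_mul_cancel₀ (norm_ne_zero_iff.2 hu0)])).const_mul ‖u‖
    refine ⟨_, ?_, h1.congr (Eventually.of_forall fun ω => ?_)⟩
    · have h2 : (σ2 : ℝ) ≤ C := by exact_mod_cast hσ
      have h3 : ‖u‖ ^ 2 ≤ 1 := pow_le_one₀ (norm_nonneg _) hu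
      have h4 : (0 : ℝ) ≤ σ2 := σ2.2
      change ‖u‖ ^ 2 * (σ2 : ℝ) ≤ C + 1
      nlinarith
    · simp only [real_inner_smul_right]
      rw [← mul_assoc, mul_inv_cancel₀ (norm_ne_zero_iff.2 hu0), one_mul]

lemma hasExpMoment_inner_mul (h : M.DistributionAssumptions P C κ φ) (i : Fin n) {u v : Vec p}
    (hu : ‖u‖ ≤ 1) (hv : ‖v‖ ≤ 1) :
    HasExpMoment (fun ω => ⟪M.x i ω, u⟫ * ⟪M.x i ω, v⟫) (1 / (4 * (C + 1))) P := by
  obtain ⟨c, hc, hX⟩ := h.exists_subgaussian_inner i hu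
  obtain ⟨d, hd, hY⟩ := h.exists_subgaussian_inner i hv
  exact hasExpMoment_mul (h.measurable_inner i u) (h.measurable_inner i v) hX hY (by positivity)
    hc hd

lemma hasExpMoment_noise_mul (h : M.DistributionAssumptions P C κ φ) (i : Fin n) {u : Vec p}
    (hu : ‖u‖ ≤ 1) :
    HasExpMoment (fun ω => M.ε i ω * ⟪M.x i ω, u⟫) (1 / (4 * (C + 1))) P := by
  obtain ⟨c, hc, hX⟩ := h.exists_subgaussian_inner i hu
  obtain ⟨σ2, hσ, hε⟩ := h.subgaussian_ε
  have h2 : (σ2 : ℝ) ≤ C := by exact_mod_cast hσ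
  exact hasExpMoment_mul (h.measurable_ε i) (h.measurable_inner i u) (hε i) hX (by positivity)
    (by linarith) hc

lemma integrable_inner_mul (h : M.DistributionAssumptions P C κ φ) (i : Fin n) (u v : Vec p) :
    Integrable (fun ω => ⟪M.x i ω, u⟫ * ⟪M.x i ω, v⟫) P := by
  have key : ∀ u : Vec p, MemLp (fun ω => ⟪M.x i ω, u⟫) 2 P := by
    intro u
    set r : ℝ := ‖u‖ + 1 with hr
    have hr0 : 0 < r := by positivity
    have hu : ‖r⁻¹ • u‖ ≤ 1 := by
      rw [norm_smul, norm_inv, Real.norm_of_nonneg hr0.le, inv_mul_le_iff₀ hr0]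
      linarith
    obtain ⟨c, -, hX⟩ := h.exists_subgaussian_inner i hu
    have h1 := (hX.memLp 2).const_mul r
    refine h1.congr_norm (h.measurable_inner i u).aestronglyMeasurable
      (Eventually.of_forall fun ω => ?_)
    simp only [real_inner_smul_right]
    rw [← mul_assoc, mul_inv_cancel₀ hr0.ne', one_mul]
  exact (key u).integrable_mul (key v)

/-- The second moment `E (xᵀu)(xᵀv)`. -/
noncomputable def _root_.ChangePoint.Model.secondMoment (M : Model n p Ω) (P : Measure Ω)
    (i : Fin n) (u v : Vec p) : ℝ := ∫ ω, ⟪M.x i ω, u⟫ * ⟪M.x i ω, v⟫ ∂P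

lemma le_secondMoment (h : M.DistributionAssumptions P C κ φ) (i : Fin n) (v : Vec p) :
    κ * ‖v‖ ^ 2 ≤ M.secondMoment P i v v := by
  have h1 := (h.eigen_lower i).dotProduct_mulVec_nonneg (fun j => v j)
  have h2 : M.secondMoment P i v v = ∑ j, ∑ k, v j * (v k * ∫ ω, M.x i ω j * M.x i ω k ∂P) := by
    have hexp : ∀ ω, ⟪M.x i ω, v⟫ * ⟪M.x i ω, v⟫ =
        ∑ j, ∑ k, v j * (v k * (M.x i ω j * M.x i ω k)) := by
      intro ω
      simp only [PiLp.inner_apply, RCLike.inner_apply, conj_trivial]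
      rw [Finset.sum_mul_sum]
      exact Finset.sum_congr rfl fun j _ => Finset.sum_congr rfl fun k _ => by ring
    have hint : ∀ j k, Integrable (fun ω => M.x i ω j * M.x i ω k) P := by
      intro j k
      have := h.integrable_inner_mul i (EuclideanSpace.single j 1) (EuclideanSpace.single k 1)
      simpa [EuclideanSpace.inner_single_right] using this
    rw [secondMoment]
    simp_rw [hexp]
    rw [integral_finsetSum _ fun j _ => integrable_finsetSum _ fun k _ =>
      ((hint j k).const_mul _).const_mul _]
    refine Finset.sum_congr rfl fun j _ => ?_
    rw [integral_finsetSum _ fun k _ => ((hint j k).const_mul _).const_mul _]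
    refine Finset.sum_congr rfl fun k _ => ?_
    rw [integral_const_mul, integral_const_mul]
  rw [h2, EuclideanSpace.norm_sq_eq]
  simp only [star_trivial, Matrix.sub_mulVec, Matrix.smul_mulVec, Matrix.one_mulVec,
    dotProduct_sub, dotProduct_smul, smul_eq_mul] at h1
  have h3 : (fun j => v j) ⬝ᵥ (fun j => v j) = ∑ j, ‖v j‖ ^ 2 := by
    simp [dotProduct, sq]
  have h4 : (fun j => v j) ⬝ᵥ (M.covMatrix P i).mulVec (fun j => v j) =
      ∑ j, ∑ k, v j * (v k * ∫ ω, M.x i ω j * M.x i ω k ∂P) := by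
    simp only [dotProduct, Matrix.mulVec, covMatrix, Matrix.of_apply, Finset.mul_sum]
    exact Finset.sum_congr rfl fun j _ => Finset.sum_congr rfl fun k _ => by ring
  rw [h3, h4] at h1
  linarith

lemma abs_secondMoment_le (h : M.DistributionAssumptions P C κ φ) (i : Fin n) {u v : Vec p}
    (hu : ‖u‖ ≤ 1) (hv : ‖v‖ ≤ 1) : |M.secondMoment P i u v| ≤ 8 * (C + 1) := by
  have h0 : (0 : ℝ) < 1 / (4 * (C + 1)) := by positivity
  refine ((h.hasExpMoment_inner_mul i hu hv).abs_integral_le h0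
    ((h.measurable_inner i u).mul (h.measurable_inner i v))).trans (le_of_eq ?_)
  field_simp; norm_num

lemma secondMoment_self_le (h : M.DistributionAssumptions P C κ φ) (i : Fin n) (v : Vec p) :
    M.secondMoment P i v v ≤ 8 * (C + 1) * ‖v‖ ^ 2 := by
  rcases eq_or_ne v 0 with rfl | hv
  · simp [secondMoment]
  · have h0 := norm_pos_iff.2 hv
    have h1 := (le_abs_self _).trans (h.abs_secondMoment_le i (u := (‖v‖⁻¹ : ℝ) • v)
      (v := (‖v‖⁻¹ : ℝ) • v) (by rw [norm_smul, norm_inv, norm_norm, inv_mul_cancel₀ h0.ne'])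
      (by rw [norm_smul, norm_inv, norm_norm, inv_mul_cancel₀ h0.ne']))
    have h2 : M.secondMoment P i ((‖v‖⁻¹ : ℝ) • v) ((‖v‖⁻¹ : ℝ) • v) =
        (‖v‖ ^ 2)⁻¹ * M.secondMoment P i v v := by
      rw [secondMoment, secondMoment, ← integral_const_mul]
      refine integral_congr_ae (Eventually.of_forall fun ω => ?_)
      simp only [real_inner_smul_right]
      ring
    rw [h2, inv_mul_le_iff₀ (by positivity)] at h1
    linarith

end DistributionAssumptions

end Model

/-! ### Deviations of the noise and of the Gram form -/

namespace Model

variable {n p : ℕ} {Ω : Type*}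

/-- The indices of the observations for which `w_i` falls into `I`. -/
noncomputable def obs (M : Model n p Ω) (ω : Ω) (I : Set ℝ) : Finset (Fin n) :=
  idx (fun i => M.w i ω) I

lemma mem_obs {M : Model n p Ω} {ω : Ω} {I : Set ℝ} {i : Fin n} :
    i ∈ M.obs ω I ↔ M.w i ω ∈ I := mem_idx

lemma obs_mono (M : Model n p Ω) (ω : Ω) {I J : Set ℝ} (h : I ⊆ J) : M.obs ω I ⊆ M.obs ω J :=
  idx_mono h

variable [MeasurableSpace Ω] {P : Measure Ω} {M : Model n p Ω} {C : ℝ≥0} {κ φ : ℝ}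

/-- The constant in the deviation inequalities. -/
noncomputable def devConst (C : ℝ≥0) : ℝ := 104 * (C + 1)

lemma devConst_pos (C : ℝ≥0) : 0 < devConst C := by unfold devConst; positivity

/-- The factor `104` in `devConst` leaves a tail `exp (-9 L)`. For the Gram form, pairs of net
points cost `exp (8 s log p)`, so `exp (-s log p)` survives the union bound. -/
lemma devConst_exponent (C : ℝ≥0) : 4 - 1 / (4 * ((C : ℝ) + 1)) * devConst C / 2 = -9 := by
  unfold devConst
  field_simp
  norm_num

lemma exp_log_natCast {p : ℕ} (hp : 1 ≤ p) : Real.exp (Real.log p) = p :=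
  Real.exp_log (by exact_mod_cast hp)

lemma sqrt_add_mul_le {N L : ℝ} (hN : 0 ≤ N) (hL : 0 ≤ L) : √((N + L) * L) ≤ N + L := by
  rw [Real.sqrt_le_iff]
  exact ⟨by positivity, by nlinarith⟩

lemma exp_nine_mul_le {p : ℕ} (hp : 1 ≤ p) :
    p * (2 * Real.exp (-9 * Real.log p)) ≤ 2 * Real.exp (-Real.log p) := by
  nth_rewrite 1 [← exp_log_natCast hp]
  rw [mul_left_comm, ← Real.exp_add]
  have : 0 ≤ Real.log p := Real.log_natCast_nonneg p
  gcongr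
  linarith

namespace DistributionAssumptions

lemma count_le (h : M.DistributionAssumptions P C κ φ) [IsProbabilityMeasure P] {I : Set ℝ}
    (hI : MeasurableSet I) {q : ℝ} (hq : M.wLaw.real I ≤ q) (L : ℝ) :
    HoldsExcept P (fun ω => ((M.obs ω I).card : ℝ) ≤ 2 * (n * q) + L) (Real.exp (-L)) := by
  have := measure_card_idx_gt_le (W := fun ω i => M.w i ω) h.measurable_w h.iIndepFun_w h.law_w hI
    hq L
  simpa only [HoldsExcept, obs, not_le, Fintype.card_fin] using this

lemma le_count (h : M.DistributionAssumptions P C κ φ) [IsProbabilityMeasure P] {I : Set ℝ}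
    (hI : MeasurableSet I) {q : ℝ} (hq0 : 0 ≤ q) (hq : q ≤ M.wLaw.real I) :
    HoldsExcept P (fun ω => n * q / 2 ≤ ((M.obs ω I).card : ℝ)) (Real.exp (-(n * q / 10))) := by
  have := measure_card_idx_lt_le (W := fun ω i => M.w i ω) h.measurable_w h.iIndepFun_w h.law_w hI
    hq0 hq
  simpa only [HoldsExcept, obs, not_le, Fintype.card_fin] using this

variable [IsProbabilityMeasure P]

lemma indepFun_w_comp (h : M.DistributionAssumptions P C κ φ) {f : Vec p × ℝ → ℝ}
    (hf : Measurable f) :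
    IndepFun (fun ω i => M.w i ω) (fun ω i => f (M.x i ω, M.ε i ω)) P :=
  h.indepFun_w_obs.comp (ψ := fun (y : Fin n → Vec p × ℝ) i => f (y i)) measurable_id
    (measurable_pi_iff.2 fun i => hf.comp (measurable_pi_apply i))

lemma noise_prefix (h : M.DistributionAssumptions P C κ φ) {I : Set ℝ} (hI : MeasurableSet I)
    {u : Vec p} (hu : ‖u‖ ≤ 1) {L : ℝ} (hL : 0 ≤ L) :
    HoldsExcept P (fun ω => ∀ τ : ℝ, |∑ i ∈ M.obs ω (I ∩ Set.Iic τ), M.ε i ω * ⟪M.x i ω, u⟫| ≤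
      devConst C * √(((M.obs ω I).card + L) * L)) (2 * Real.exp (-9 * L)) := by
  have hf : Measurable fun q : Vec p × ℝ => q.2 * ⟪q.1, u⟫ :=
    measurable_snd.mul measurable_fst.inner_const
  have := measure_exists_prefix_sum_gt_le h.measurable_W
    (Z := fun i ω => M.ε i ω * ⟪M.x i ω, u⟫)
    (fun i => (h.measurable_ε i).mul (h.measurable_inner i u))
    (h.iIndepFun_obs.comp (fun _ q => q.2 * ⟪q.1, u⟫) fun _ => hf) (h.indepFun_w_comp hf)
    (by positivity) (fun i => h.hasExpMoment_noise_mul i hu) (devConst_pos C).le hL hI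
  rw [devConst_exponent] at this
  simp only [h.integral_noise_mul, sub_zero] at this
  simpa only [HoldsExcept, obs, not_forall, not_le] using this

lemma moment_sum (h : M.DistributionAssumptions P C κ φ) {I : Set ℝ} (hI : MeasurableSet I)
    {u v : Vec p} (hu : ‖u‖ ≤ 1) (hv : ‖v‖ ≤ 1) {L : ℝ} (hL : 0 ≤ L) :
    HoldsExcept P (fun ω =>
      |∑ i ∈ M.obs ω I, (⟪M.x i ω, u⟫ * ⟪M.x i ω, v⟫ - M.secondMoment P i u v)| ≤
      devConst C * √(((M.obs ω I).card + L) * L)) (2 * Real.exp (-9 * L)) := by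
  have hf : Measurable fun q : Vec p × ℝ => ⟪q.1, u⟫ * ⟪q.1, v⟫ :=
    measurable_fst.inner_const.mul measurable_fst.inner_const
  have := measure_sum_idx_gt_le h.measurable_W
    (Z := fun i ω => ⟪M.x i ω, u⟫ * ⟪M.x i ω, v⟫)
    (fun i => (h.measurable_inner i u).mul (h.measurable_inner i v))
    (h.iIndepFun_obs.comp (fun _ q => ⟪q.1, u⟫ * ⟪q.1, v⟫) fun _ => hf) (h.indepFun_w_comp hf)
    (by positivity) (fun i => h.hasExpMoment_inner_mul i hu hv) (devConst_pos C).le hL hI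
  rw [devConst_exponent] at this
  simpa only [HoldsExcept, obs, secondMoment, not_le] using this

lemma inner_single_one {p : ℕ} (v : Vec p) (j : Fin p) :
    ⟪v, EuclideanSpace.single j (1 : ℝ)⟫ = v j := by
  simp [EuclideanSpace.inner_single_right]

lemma noise_coord (h : M.DistributionAssumptions P C κ φ) (hp : 1 ≤ p) {I : Set ℝ}
    (hI : MeasurableSet I) :
    HoldsExcept P (fun ω => ∀ (j : Fin p) (τ : ℝ),
      |∑ i ∈ M.obs ω (I ∩ Set.Iic τ), M.ε i ω * M.x i ω j| ≤
      devConst C * √(((M.obs ω I).card + Real.log p) * Real.log p))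
      (2 * Real.exp (-Real.log p)) := by
  have h1 := HoldsExcept.finset_forall (Finset.univ : Finset (Fin p)) fun j _ =>
    h.noise_prefix hI (u := EuclideanSpace.single j (1 : ℝ)) (by simp)
      (Real.log_natCast_nonneg p)
  refine h1.mono (fun ω hω j τ => ?_) ?_
  · simpa only [inner_single_one] using hω j (Finset.mem_univ j) τ
  · simpa using exp_nine_mul_le hp

/-- Mean and deviation are merged, since only the order of magnitude matters: the sum is used for
observations assigned to the wrong regime by the initial value, where no cancellation is expected.
-/
lemma gram_coord_le (h : M.DistributionAssumptions P C κ φ) (hp : 1 ≤ p) {I : Set ℝ}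
    (hI : MeasurableSet I) {u : Vec p} (hu : ‖u‖ ≤ 1) :
    HoldsExcept P (fun ω => ∀ (j : Fin p),
      |∑ i ∈ M.obs ω I, ⟪M.x i ω, u⟫ * M.x i ω j| ≤
      2 * devConst C * ((M.obs ω I).card + Real.log p)) (2 * Real.exp (-Real.log p)) := by
  have h1 := HoldsExcept.finset_forall (Finset.univ : Finset (Fin p)) fun j _ =>
    h.moment_sum hI hu (v := EuclideanSpace.single j (1 : ℝ)) (by simp)
      (Real.log_natCast_nonneg p)
  refine h1.mono (fun ω hω j => ?_) (by simpa using exp_nine_mul_le hp)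
  have h2 := hω j (Finset.mem_univ j)
  simp only [inner_single_one] at h2
  rw [Finset.sum_sub_distrib] at h2
  have hL := Real.log_natCast_nonneg p
  have h3 : |∑ i ∈ M.obs ω I, M.secondMoment P i u (EuclideanSpace.single j (1 : ℝ))| ≤
      devConst C * (M.obs ω I).card := by
    refine (Finset.abs_sum_le_sum_abs _ _).trans ((Finset.sum_le_card_nsmul _ _ (devConst C)
      fun i _ => ?_).trans (by rw [nsmul_eq_mul, mul_comm]))
    refine (h.abs_secondMoment_le i hu (by simp)).trans ?_
    unfold devConst
    have : (0 : ℝ) ≤ C := C.2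
    linarith
  have h4 := mul_le_mul_of_nonneg_left
    (sqrt_add_mul_le (N := (M.obs ω I).card) (by positivity) hL) (devConst_pos C).le
  have h5 := abs_sub_abs_le_abs_sub (∑ i ∈ M.obs ω I, ⟪M.x i ω, u⟫ * M.x i ω j)
    (∑ i ∈ M.obs ω I, M.secondMoment P i u (EuclideanSpace.single j (1 : ℝ)))
  have h6 := mul_nonneg (devConst_pos C).le hL
  linarith

/-- The centered Gram form of the observations in `J`. -/
noncomputable def gramForm (h : M.DistributionAssumptions P C κ φ) (ω : Ω) (J : Finset (Fin n)) :
    Vec p →ₗ[ℝ] Vec p →ₗ[ℝ] ℝ :=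
  LinearMap.mk₂ ℝ
    (fun u v => ∑ i ∈ J, (⟪M.x i ω, u⟫ * ⟪M.x i ω, v⟫ - M.secondMoment P i u v))
    (fun u u' v => by
      rw [← Finset.sum_add_distrib]
      refine Finset.sum_congr rfl fun i _ => ?_
      have : M.secondMoment P i (u + u') v = M.secondMoment P i u v + M.secondMoment P i u' v := by
        simp only [secondMoment, inner_add_right, add_mul]
        exact integral_add (h.integrable_inner_mul i u v) (h.integrable_inner_mul i u' v)
      rw [this, inner_add_right]; ring)
    (fun c u v => by
      rw [smul_eq_mul, Finset.mul_sum]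
      refine Finset.sum_congr rfl fun i _ => ?_
      have : M.secondMoment P i (c • u) v = c * M.secondMoment P i u v := by
        simp only [secondMoment, real_inner_smul_right, mul_assoc]
        exact integral_const_mul _ _
      rw [this, real_inner_smul_right]; ring)
    (fun u v v' => by
      rw [← Finset.sum_add_distrib]
      refine Finset.sum_congr rfl fun i _ => ?_
      have : M.secondMoment P i u (v + v') = M.secondMoment P i u v + M.secondMoment P i u v' := by
        simp only [secondMoment, inner_add_right, mul_add]
        exact integral_add (h.integrable_inner_mul i u v) (h.integrable_inner_mul i u v')
      rw [this, inner_add_right]; ring)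
    (fun c u v => by
      rw [smul_eq_mul, Finset.mul_sum]
      refine Finset.sum_congr rfl fun i _ => ?_
      have : M.secondMoment P i u (c • v) = c * M.secondMoment P i u v := by
        simp only [secondMoment, real_inner_smul_right]
        rw [← integral_const_mul]
        refine integral_congr_ae (Eventually.of_forall fun ω => ?_)
        simp only; ring
      rw [this, real_inner_smul_right]; ring)

/-- Uniform deviations of the Gram form over all directions. -/
lemma gram (h : M.DistributionAssumptions P C κ φ) (hp : 2 ≤ p) {s : ℕ} (hs : 1 ≤ s) {I : Set ℝ}
    (hI : MeasurableSet I) :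
    HoldsExcept P (fun ω => ∀ v : Vec p,
      |∑ i ∈ M.obs ω I, (⟪M.x i ω, v⟫ * ⟪M.x i ω, v⟫ - M.secondMoment P i v v)| ≤
      4 * (devConst C * √(((M.obs ω I).card + s * Real.log p) * (s * Real.log p))) *
        (‖v‖ + l1Norm v / √s) ^ 2) (2 * Real.exp (-Real.log p)) := by
  obtain ⟨N, hNcard, hN1, hN⟩ := exists_sparse_net p s (by omega)
  have hL := Real.log_natCast_nonneg p
  have hs1 : (1 : ℝ) ≤ s := by exact_mod_cast hs
  have hsL : 0 ≤ s * Real.log p := by positivity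
  have h1 := HoldsExcept.finset_forall (N ×ˢ N) fun q hq =>
    h.moment_sum hI (hN1 q.1 (Finset.mem_product.1 hq).1) (hN1 q.2 (Finset.mem_product.1 hq).2) hsL
  refine h1.mono (fun ω hω v => ?_) ?_
  · have := abs_bilin_le_of_sparse hs (h.gramForm ω (M.obs ω I))
      (K := 4 * (devConst C * √(((M.obs ω I).card + s * Real.log p) * (s * Real.log p))))
      (by have := devConst_pos C; positivity)
      (hN (h.gramForm ω (M.obs ω I)) _ fun c hc d hd =>
        hω (c, d) (Finset.mem_product.2 ⟨hc, hd⟩)) v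
    exact this
  · have hp0 : (2 : ℝ) ≤ p := by exact_mod_cast hp
    -- The net has at most `(5 p) ^ s ≤ p ^ (4 s)` points, because `p ≥ 2` gives `5 ≤ p ^ 3`.
    have hcard : (((N ×ˢ N).card : ℕ) : ℝ) ≤ Real.exp (8 * (s * Real.log p)) := by
      have h5 : ((N.card : ℕ) : ℝ) ≤ Real.exp (4 * (s * Real.log p)) := by
        calc ((N.card : ℕ) : ℝ) ≤ ((5 * p : ℕ) : ℝ) ^ s := by exact_mod_cast hNcard
          _ ≤ ((p : ℝ) ^ 4) ^ s := by
              gcongr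
              push_cast
              nlinarith [pow_le_pow_left₀ (by norm_num) hp0 3]
          _ = Real.exp (4 * (s * Real.log p)) := by
              rw [← exp_log_natCast (show 1 ≤ p by omega), ← Real.exp_nat_mul, ← Real.exp_nat_mul,
                Real.log_exp]
              congr 1; push_cast; ring
      rw [Finset.card_product, Nat.cast_mul]
      calc (N.card : ℝ) * N.card ≤ Real.exp (4 * (s * Real.log p)) * Real.exp (4 * (s * Real.log p)) := by
            gcongr
        _ = _ := by rw [← Real.exp_add]; congr 1; ring
    calc (((N ×ˢ N).card : ℕ) : ℝ) * (2 * Real.exp (-9 * (s * Real.log p)))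
        ≤ Real.exp (8 * (s * Real.log p)) * (2 * Real.exp (-9 * (s * Real.log p))) := by gcongr
      _ = 2 * Real.exp (-(s * Real.log p)) := by
          rw [mul_left_comm, ← Real.exp_add]; congr 2; ring
      _ ≤ 2 * Real.exp (-Real.log p) := by
          gcongr
          nlinarith

lemma sum_sq_le_of_gram (h : M.DistributionAssumptions P C κ φ) {L : ℝ} (hL : 0 ≤ L) {s : ℕ}
    {ω : Ω} {I : Set ℝ} {v : Vec p}
    (hG : |∑ i ∈ M.obs ω I, (⟪M.x i ω, v⟫ * ⟪M.x i ω, v⟫ - M.secondMoment P i v v)| ≤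
      4 * (devConst C * √(((M.obs ω I).card + L) * L)) * (‖v‖ + l1Norm v / √s) ^ 2) :
    ∑ i ∈ M.obs ω I, ⟪M.x i ω, v⟫ ^ 2 ≤
      5 * devConst C * ((M.obs ω I).card + L) * (‖v‖ + l1Norm v / √s) ^ 2 := by
  have h0 : 0 ≤ l1Norm v / √s := div_nonneg (l1Norm_nonneg v) (Real.sqrt_nonneg _)
  have h1 : ∑ i ∈ M.obs ω I, M.secondMoment P i v v ≤
      devConst C * (M.obs ω I).card * (‖v‖ + l1Norm v / √s) ^ 2 := by
    refine (Finset.sum_le_card_nsmul _ _ (devConst C * (‖v‖ + l1Norm v / √s) ^ 2)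
      fun i _ => ?_).trans (by rw [nsmul_eq_mul]; apply le_of_eq; ring)
    refine (h.secondMoment_self_le i v).trans ?_
    have : (0 : ℝ) ≤ C := C.2
    have h8 : 8 * ((C : ℝ) + 1) ≤ devConst C := by unfold devConst; linarith
    have h9 := devConst_pos C
    gcongr
    linarith
  have h2 := (le_abs_self _).trans hG
  rw [Finset.sum_sub_distrib] at h2
  simp only [← sq] at h2
  have h3 := mul_le_mul_of_nonneg_right (mul_le_mul_of_nonneg_left
    (sqrt_add_mul_le (N := (M.obs ω I).card) (by positivity) hL) (devConst_pos C).le)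
    (sq_nonneg (‖v‖ + l1Norm v / √s))
  have h4 := mul_nonneg (mul_nonneg (devConst_pos C).le hL) (sq_nonneg (‖v‖ + l1Norm v / √s))
  nlinarith

lemma le_sum_sq_of_gram (h : M.DistributionAssumptions P C κ φ) {L B : ℝ} {s : ℕ}
    {ω : Ω} {I : Set ℝ} {v : Vec p}
    (hG : |∑ i ∈ M.obs ω I, (⟪M.x i ω, v⟫ * ⟪M.x i ω, v⟫ - M.secondMoment P i v v)| ≤
      4 * (devConst C * √(((M.obs ω I).card + L) * L)) * (‖v‖ + l1Norm v / √s) ^ 2)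
    (hv : ‖v‖ + l1Norm v / √s ≤ B) (hL : 0 ≤ L) :
    κ * (M.obs ω I).card * ‖v‖ ^ 2 - 4 * devConst C * √((n + L) * L) * B ^ 2 ≤
      ∑ i ∈ M.obs ω I, ⟪M.x i ω, v⟫ ^ 2 := by
  have h0 : 0 ≤ l1Norm v / √s := div_nonneg (l1Norm_nonneg v) (Real.sqrt_nonneg _)
  have h1 : κ * (M.obs ω I).card * ‖v‖ ^ 2 ≤ ∑ i ∈ M.obs ω I, M.secondMoment P i v v := by
    refine le_trans (by rw [nsmul_eq_mul]; apply le_of_eq; ring)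
      (Finset.card_nsmul_le_sum (M.obs ω I) _ (κ * ‖v‖ ^ 2) fun i _ => h.le_secondMoment i v)
  have h2 := (neg_le_abs _).trans hG
  rw [Finset.sum_sub_distrib] at h2
  simp only [← sq] at h2
  have hcard : ((M.obs ω I).card : ℝ) ≤ n := by
    exact_mod_cast (Finset.card_le_univ _).trans (by simp)
  have h3 : 4 * (devConst C * √(((M.obs ω I).card + L) * L)) * (‖v‖ + l1Norm v / √s) ^ 2 ≤
      4 * (devConst C * √((n + L) * L)) * B ^ 2 := by
    have := devConst_pos C
    gcongr
  linarith

end DistributionAssumptions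

end Model

/-! ### The Lasso error and the loss over a segment -/

section Lasso

variable {p : ℕ} {ι : Type*}

lemma inner_eq_sum (v w : Vec p) : ⟪v, w⟫ = ∑ j, v j * w j := by
  simp only [PiLp.inner_apply, RCLike.inner_apply, conj_trivial]
  exact Finset.sum_congr rfl fun j _ => mul_comm _ _

lemma abs_sum_mul_inner_le {J : Finset ι} {x : ι → Vec p} {e : ι → ℝ} {V : ℝ}
    (h : ∀ j, |∑ i ∈ J, e i * x i j| ≤ V) (v : Vec p) :
    |∑ i ∈ J, e i * ⟪x i, v⟫| ≤ V * l1Norm v := by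
  have h1 : ∑ i ∈ J, e i * ⟪x i, v⟫ = ∑ j, (∑ i ∈ J, e i * x i j) * v j := by
    simp_rw [inner_eq_sum, Finset.mul_sum, Finset.sum_mul]
    rw [Finset.sum_comm]
    exact Finset.sum_congr rfl fun j _ => Finset.sum_congr rfl fun i _ => by ring
  rw [h1, l1Norm, Finset.mul_sum]
  refine (Finset.abs_sum_le_sum_abs _ _).trans (Finset.sum_le_sum fun j _ => ?_)
  rw [abs_mul]
  exact mul_le_mul_of_nonneg_right (h j) (abs_nonneg _)

lemma sum_abs_le_sqrt_mul_norm {S : Finset (Fin p)} {s : ℕ} (hS : S.card ≤ s) (v : Vec p) :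
    ∑ j ∈ S, |v j| ≤ √s * ‖v‖ := by
  have h1 : (∑ j ∈ S, |v j|) ^ 2 ≤ (√s * ‖v‖) ^ 2 := by
    rw [mul_pow, Real.sq_sqrt (by positivity), EuclideanSpace.norm_sq_eq]
    calc (∑ j ∈ S, |v j|) ^ 2 ≤ S.card * ∑ j ∈ S, |v j| ^ 2 := sq_sum_le_card_mul_sum_sq
      _ ≤ s * ∑ j, ‖v j‖ ^ 2 := by
          gcongr
          refine (Finset.sum_le_sum_of_subset_of_nonneg (Finset.subset_univ S)
            fun j _ _ => by positivity).trans (le_of_eq ?_)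
          rfl
  exact le_of_sq_le_sq h1 (by positivity)

/-- The error bound for the Lasso under a restricted eigenvalue condition. -/
lemma lasso_error_bound {J : Finset ι} {x : ι → Vec p} {y e : ι → ℝ} {a b : Vec p} {c lam ρ : ℝ}
    {s : ℕ} {S : Finset (Fin p)} (hc : 0 ≤ c) (hlam : 0 < lam) (hρ : 0 < ρ)
    (hy : ∀ i ∈ J, y i = ⟪x i, a⟫ + e i)
    (hmin : c * ∑ i ∈ J, (y i - ⟪x i, b⟫) ^ 2 + lam * l1Norm b ≤
      c * ∑ i ∈ J, (y i - ⟪x i, a⟫) ^ 2 + lam * l1Norm a)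
    (hnoise : ∀ j, c * |∑ i ∈ J, e i * x i j| ≤ lam / 4)
    (hS : S.card ≤ s) (hsupp : ∀ j ∉ S, a j = 0)
    (hre : ∀ v : Vec p, l1Norm v ≤ 4 * √s * ‖v‖ → ρ * ‖v‖ ^ 2 ≤ c * ∑ i ∈ J, ⟪x i, v⟫ ^ 2) :
    l1Norm (b - a) ≤ 4 * √s * ‖b - a‖ ∧ ‖b - a‖ ≤ 3 / 2 * (lam * √s) / ρ := by
  set D := b - a with hD
  have hb : b = a + D := by rw [hD]; abel
  have h1 : ∑ i ∈ J, (y i - ⟪x i, b⟫) ^ 2 = ∑ i ∈ J, (y i - ⟪x i, a⟫) ^ 2 +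
      ∑ i ∈ J, ⟪x i, D⟫ ^ 2 - 2 * ∑ i ∈ J, e i * ⟪x i, D⟫ := by
    rw [Finset.mul_sum, ← Finset.sum_add_distrib, ← Finset.sum_sub_distrib]
    refine Finset.sum_congr rfl fun i hi => ?_
    rw [hy i hi, hb, inner_add_right]; ring
  have h2 : |c * ∑ i ∈ J, e i * ⟪x i, D⟫| ≤ lam / 4 * l1Norm D := by
    have := abs_sum_mul_inner_le (J := J) (x := x) (e := fun i => c * e i) (V := lam / 4)
      (fun j => by
        have := hnoise j
        rw [← abs_of_nonneg hc, ← abs_mul, Finset.mul_sum] at this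
        simpa only [mul_assoc, abs_of_nonneg hc] using this) D
    simpa only [mul_assoc, ← Finset.mul_sum] using this
  -- Off the support of `a` the vectors `b` and `D` agree, so all of the `ℓ₁` mass of `D` there
  -- counts against `b`.
  have h3 : l1Norm a - l1Norm b ≤ ∑ j ∈ S, |D j| - ∑ j ∈ Sᶜ, |D j| := by
    have e1 : l1Norm a = ∑ j ∈ S, |a j| := by
      rw [l1Norm, ← Finset.sum_add_sum_compl S, add_eq_left]
      exact Finset.sum_eq_zero fun j hj => by
        rw [hsupp j (by simpa using hj), abs_zero]
    have e2 : l1Norm b = ∑ j ∈ S, |b j| + ∑ j ∈ Sᶜ, |b j| := by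
      rw [l1Norm, Finset.sum_add_sum_compl S]
    have e3 : ∑ j ∈ Sᶜ, |b j| = ∑ j ∈ Sᶜ, |D j| := Finset.sum_congr rfl fun j hj => by
      rw [hD, PiLp.sub_apply, hsupp j (by simpa using hj), sub_zero]
    have e4 : ∑ j ∈ S, |a j| ≤ ∑ j ∈ S, |b j| + ∑ j ∈ S, |D j| := by
      rw [← Finset.sum_add_distrib]
      refine Finset.sum_le_sum fun j _ => ?_
      have := abs_sub_abs_le_abs_sub (a j) (b j)
      rw [abs_sub_comm] at this
      rw [hD, PiLp.sub_apply]
      linarith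
    rw [e1, e2, e3]
    linarith
  have h4 : l1Norm D = ∑ j ∈ S, |D j| + ∑ j ∈ Sᶜ, |D j| := by
    rw [l1Norm, Finset.sum_add_sum_compl S]
  have h5 : c * ∑ i ∈ J, ⟪x i, D⟫ ^ 2 ≤
      lam * (3 / 2 * ∑ j ∈ S, |D j| - 1 / 2 * ∑ j ∈ Sᶜ, |D j|) := by
    rw [h1] at hmin
    have h6 := (le_abs_self _).trans h2
    have h7 := mul_le_mul_of_nonneg_left h3 hlam.le
    rw [h4] at h6
    nlinarith
  have h8 : 0 ≤ c * ∑ i ∈ J, ⟪x i, D⟫ ^ 2 :=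
    mul_nonneg hc (Finset.sum_nonneg fun i _ => sq_nonneg _)
  -- Nonnegativity of the quadratic form forces the mass off the support to be at most three times
  -- that on it. This is the cone condition, with constant `1 + 3 = 4`.
  have h9 : 0 ≤ 3 / 2 * ∑ j ∈ S, |D j| - 1 / 2 * ∑ j ∈ Sᶜ, |D j| :=
    nonneg_of_mul_nonneg_right (h8.trans h5) hlam
  have h10 := sum_abs_le_sqrt_mul_norm hS D
  have hcone : l1Norm D ≤ 4 * √s * ‖D‖ := by rw [h4]; linarith
  refine ⟨hcone, ?_⟩
  have h11 := hre D hcone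
  have h12 : 0 ≤ ∑ j ∈ Sᶜ, |D j| := Finset.sum_nonneg fun _ _ => abs_nonneg _
  rcases (norm_nonneg D).eq_or_lt with h0 | h0
  · rw [← h0]; positivity
  · rw [le_div_iff₀ hρ]
    have h13 : ρ * ‖D‖ ^ 2 ≤ 3 / 2 * (lam * √s) * ‖D‖ := by
      refine (h11.trans h5).trans ?_
      have := mul_le_mul_of_nonneg_left h10 hlam.le
      nlinarith
    have : ‖D‖ * (ρ * ‖D‖) ≤ ‖D‖ * (3 / 2 * (lam * √s)) := by linarith
    linarith [le_of_mul_le_mul_left this h0]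

/-- A lower bound for the increase of the loss over the observations in `J` when the regression
coefficients are moved by `d`. -/
lemma segment_loss_ge {J : Finset ι} {x : ι → Vec p} {e : ι → ℝ} {d D₁ D₂ : Vec p} {V : ℝ}
    (hV : ∀ j, |∑ i ∈ J, e i * x i j| ≤ V) :
    1 / 2 * ∑ i ∈ J, ⟪x i, d⟫ ^ 2 - ∑ i ∈ J, ⟪x i, D₁⟫ ^ 2 - ∑ i ∈ J, ⟪x i, D₂⟫ ^ 2 -
        2 * |∑ i ∈ J, e i * ⟪x i, d⟫| - 2 * V * (l1Norm D₁ + l1Norm D₂) ≤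
      ∑ i ∈ J, ((e i - ⟪x i, d + D₁⟫) ^ 2 - (e i - ⟪x i, D₂⟫) ^ 2) := by
  have h1 := abs_sum_mul_inner_le hV D₁
  have h2 := abs_sum_mul_inner_le hV D₂
  have h3 : 1 / 2 * ∑ i ∈ J, ⟪x i, d⟫ ^ 2 - ∑ i ∈ J, ⟪x i, D₁⟫ ^ 2 - ∑ i ∈ J, ⟪x i, D₂⟫ ^ 2 -
      2 * ∑ i ∈ J, e i * ⟪x i, d⟫ - 2 * ∑ i ∈ J, e i * ⟪x i, D₁⟫ +
      2 * ∑ i ∈ J, e i * ⟪x i, D₂⟫ ≤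
      ∑ i ∈ J, ((e i - ⟪x i, d + D₁⟫) ^ 2 - (e i - ⟪x i, D₂⟫) ^ 2) := by
    simp only [Finset.mul_sum, ← Finset.sum_sub_distrib, ← Finset.sum_add_distrib]
    refine Finset.sum_le_sum fun i _ => ?_
    rw [inner_add_right]
    -- This square is twice the gap in `(a + b)² ≥ a²/2 - b²`; the noise parts match exactly.
    nlinarith [sq_nonneg (⟪x i, d⟫ + 2 * ⟪x i, D₁⟫)]
  have h4 := le_abs_self (∑ i ∈ J, e i * ⟪x i, d⟫)
  have h5 := (le_abs_self _).trans h1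
  have h6 := (neg_le_abs _).trans h2
  linarith

end Lasso

/-! ### Envelopes of nested segments -/

section Envelopes

/-- A countable subset that is both cofinal and coinitial. -/
lemma exists_countable_cofinal {T : Set ℝ} (hT : T.Nonempty) :
    ∃ (κ : Type) (_ : Countable κ) (_ : Nonempty κ) (c : κ → ℝ), (∀ k, c k ∈ T) ∧
      ∀ τ ∈ T, (∃ k, τ ≤ c k) ∧ ∃ k, c k ≤ τ := by
  have key : ∀ T : Set ℝ, T.Nonempty → ∃ c : Option ℚ → ℝ, (∀ k, c k ∈ T) ∧
      ∀ τ ∈ T, ∃ k, τ ≤ c k := by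
    intro T hT
    classical
    -- The default `m` is the largest element of `T` if there is one. Any other element has a larger
    -- one above it, with a rational in between.
    obtain ⟨m, hm, hmax⟩ : ∃ m ∈ T, (∃ m' ∈ T, ∀ τ ∈ T, τ ≤ m') → ∀ τ ∈ T, τ ≤ m := by
      by_cases h : ∃ m' ∈ T, ∀ τ ∈ T, τ ≤ m'
      · obtain ⟨m, hm, h'⟩ := h
        exact ⟨m, hm, fun _ => h'⟩
      · exact ⟨hT.some, hT.some_mem, fun h' => absurd h' h⟩
    refine ⟨fun k => k.elim m fun q => if h : ∃ τ ∈ T, (q : ℝ) ≤ τ then h.choose else m, ?_, ?_⟩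
    · rintro (_ | q)
      · exact hm
      · simp only [Option.elim]
        split_ifs with h
        · exact h.choose_spec.1
        · exact hm
    · intro τ hτ
      by_cases h : ∀ τ' ∈ T, τ' ≤ τ
      · exact ⟨none, hmax ⟨τ, hτ, h⟩ τ hτ⟩
      · push Not at h
        obtain ⟨τ', hτ', hlt⟩ := h
        obtain ⟨q, hq1, hq2⟩ := exists_rat_btwn hlt
        have hex : ∃ τ ∈ T, (q : ℝ) ≤ τ := ⟨τ', hτ', hq2.le⟩
        refine ⟨some q, ?_⟩
        simp only [Option.elim, hex, dite_true]
        exact hq1.le.trans hex.choose_spec.2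
  obtain ⟨c, hc, hcof⟩ := key T hT
  obtain ⟨d, hd, hdcof⟩ := key (-T) hT.neg
  refine ⟨Option ℚ ⊕ Option ℚ, inferInstance, inferInstance, Sum.elim c fun k => -d k, ?_, ?_⟩
  · rintro (k | k)
    · exact hc k
    · exact hd k
  · intro τ hτ
    refine ⟨(hcof τ hτ).imp' Sum.inl fun k h => h, ?_⟩
    obtain ⟨k, hk⟩ := hdcof (-τ) (by simpa using hτ)
    exact ⟨Sum.inr k, by simp only [Sum.elim_inr]; linarith⟩

/-- A chain of sets, indexed by `T`, has an envelope whose measure obeys the same bound, and an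
intersection whose measure obeys the same lower bound. -/
lemma exists_envelopes {ν : Measure ℝ} [IsFiniteMeasure ν] {T : Set ℝ} (hT : T.Nonempty)
    {D : ℝ → Set ℝ} (hD : Monotone D ∨ Antitone D) (hDm : ∀ τ, MeasurableSet (D τ)) {u v : ℝ}
    (hu : ∀ τ ∈ T, ν.real (D τ) ≤ u) (hv : ∀ τ ∈ T, v ≤ ν.real (D τ)) :
    ∃ I O : Set ℝ, MeasurableSet I ∧ MeasurableSet O ∧ (∀ τ ∈ T, I ⊆ D τ ∧ D τ ⊆ O) ∧
      (∀ a ∈ O, ∃ τ, a ∈ D τ) ∧ v ≤ ν.real I ∧ ν.real O ≤ u := by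
  obtain ⟨κ, _, _, c, hc, hcof⟩ := exists_countable_cofinal hT
  have htot : ∀ a b, D a ⊆ D b ∨ D b ⊆ D a := by
    intro a b
    rcases hD with h | h <;> rcases le_total a b with hab | hab
    · exact Or.inl (h hab)
    · exact Or.inr (h hab)
    · exact Or.inr (h hab)
    · exact Or.inl (h hab)
  have hcov : ∀ τ ∈ T, (∃ k, D (c k) ⊆ D τ) ∧ ∃ k, D τ ⊆ D (c k) := by
    intro τ hτ
    obtain ⟨⟨k, hk⟩, k', hk'⟩ := hcof τ hτ
    rcases hD with h | h
    · exact ⟨⟨k', h hk'⟩, k, h hk⟩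
    · exact ⟨⟨k, h hk⟩, k', h hk'⟩
  have hu0 : 0 ≤ u := measureReal_nonneg.trans (hu _ hT.some_mem)
  refine ⟨⋂ k, D (c k), ⋃ k, D (c k), MeasurableSet.iInter fun k => hDm _,
    MeasurableSet.iUnion fun k => hDm _, fun τ hτ => ⟨?_, ?_⟩, ?_, ?_, ?_⟩
  · obtain ⟨k, hk⟩ := (hcov τ hτ).1
    exact (Set.iInter_subset _ k).trans hk
  · obtain ⟨k, hk⟩ := (hcov τ hτ).2
    exact hk.trans (Set.subset_iUnion (fun k => D (c k)) k)
  · intro a ha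
    obtain ⟨k, hk⟩ := Set.mem_iUnion.1 ha
    exact ⟨_, hk⟩
  -- Nestedness makes the countable family directed, so continuity of the measure carries the bounds
  -- to the intersection and the union. No continuity of `Φ` is needed.
  · have hdir : Directed (· ⊇ ·) fun k => D (c k) := by
      intro a b
      rcases htot (c a) (c b) with h | h
      · exact ⟨a, subset_rfl, h⟩
      · exact ⟨b, h, subset_rfl⟩
    have h1 := hdir.measure_iInter (μ := ν) (fun k => (hDm (c k)).nullMeasurableSet)
      ⟨Classical.arbitrary κ, measure_ne_top _ _⟩
    rw [measureReal_def, ← ENNReal.ofReal_le_iff_le_toReal (measure_ne_top _ _), h1]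
    refine le_iInf fun k => ?_
    rw [ENNReal.ofReal_le_iff_le_toReal (measure_ne_top _ _)]
    exact hv _ (hc k)
  · have hdir : Directed (· ⊆ ·) fun k => D (c k) := by
      intro a b
      rcases htot (c a) (c b) with h | h
      · exact ⟨b, h, subset_rfl⟩
      · exact ⟨a, subset_rfl, h⟩
    rw [measureReal_def, hdir.measure_iUnion]
    refine ENNReal.toReal_le_of_le_ofReal hu0 (iSup_le fun k => ?_)
    rw [ENNReal.le_ofReal_iff_toReal_le (measure_ne_top _ _) hu0]
    exact hu _ (hc k)

end Envelopes

/-! ### Uniform bounds over the segments adjacent to the change point -/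

namespace Model

variable {n p : ℕ} {Ω : Type*} {M : Model n p Ω}

lemma abs_sum_obs_le_of_prefix {ω : Ω} {O : Set ℝ} {f : Fin n → ℝ} {V : ℝ}
    (h : ∀ τ : ℝ, |∑ i ∈ M.obs ω (O ∩ Set.Iic τ), f i| ≤ V) : |∑ i ∈ M.obs ω O, f i| ≤ V := by
  rcases isEmpty_or_nonempty (Fin n) with hn | hn
  · simpa [Finset.eq_empty_of_isEmpty] using h 0
  · obtain ⟨k, -, hk⟩ := Finset.exists_max_image Finset.univ (fun i => M.w i ω)
      Finset.univ_nonempty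
    have : M.obs ω (O ∩ Set.Iic (M.w k ω)) = M.obs ω O := by
      ext i; simp [mem_obs, hk i]
    exact this ▸ h (M.w k ω)

/-- A suffix is the total minus a prefix, and the total is itself a prefix; hence the factor `2`. -/
lemma abs_sum_obs_suffix_le {ω : Ω} {O : Set ℝ} {f : Fin n → ℝ} {V : ℝ}
    (h : ∀ τ : ℝ, |∑ i ∈ M.obs ω (O ∩ Set.Iic τ), f i| ≤ V) (τ : ℝ) :
    |∑ i ∈ M.obs ω (O ∩ Set.Ioi τ), f i| ≤ 2 * V := by
  classical
  have h1 : ∑ i ∈ M.obs ω O, f i =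
      ∑ i ∈ M.obs ω (O ∩ Set.Iic τ), f i + ∑ i ∈ M.obs ω (O ∩ Set.Ioi τ), f i := by
    rw [← Finset.sum_union]
    · refine Finset.sum_congr ?_ fun _ _ => rfl
      ext i
      simp only [mem_obs, Finset.mem_union, Set.mem_inter_iff, Set.mem_Iic, Set.mem_Ioi]
      have := le_or_gt (M.w i ω) τ
      tauto
    · rw [Finset.disjoint_left]
      intro i hi hi'
      simp only [mem_obs, Set.mem_inter_iff, Set.mem_Iic, Set.mem_Ioi] at hi hi'
      exact absurd hi.2 (not_le.2 hi'.2)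
  have h2 := abs_le.1 (abs_sum_obs_le_of_prefix h)
  have h3 := abs_le.1 (h τ)
  rw [abs_le]
  constructor <;> linarith

variable [MeasurableSpace Ω] {P : Measure Ω} [IsProbabilityMeasure P] {C : ℝ≥0} {κ φ : ℝ}

/-- The relative deviation level at which half of the curvature is left. -/
noncomputable def curvLevel (C : ℝ≥0) (κ : ℝ) : ℝ := min (1 / 2) (κ ^ 2 / (16 * devConst C ^ 2))

lemma curvLevel_pos (C : ℝ≥0) (hκ : 0 < κ) : 0 < curvLevel C κ := by
  have := devConst_pos C
  unfold curvLevel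
  positivity

namespace DistributionAssumptions

/-- For the single direction `d` no net is needed, so the deviation level may be a small multiple of
`n q` instead of `s log p`. The failure probability is then exponentially small in `n q`, and no
relation between `q` and the sparsity is required. -/
lemma le_sum_sq (h : M.DistributionAssumptions P C κ φ) (hκ : 0 < κ) {I : Set ℝ}
    (hI : MeasurableSet I) {q : ℝ} (hq0 : 0 ≤ q) (hq : q ≤ M.wLaw.real I) {d : Vec p}
    (hd : d ≠ 0) :
    HoldsExcept P (fun ω => κ / 4 * (n * q) * ‖d‖ ^ 2 ≤ ∑ i ∈ M.obs ω I, ⟪M.x i ω, d⟫ ^ 2)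
      (Real.exp (-(n * q / 10)) + 2 * Real.exp (-9 * (curvLevel C κ * (n * q)))) := by
  have hd0 := norm_pos_iff.2 hd
  set u : Vec p := (‖d‖⁻¹ : ℝ) • d with hu
  have hu1 : ‖u‖ = 1 := by rw [hu, norm_smul, norm_inv, norm_norm, inv_mul_cancel₀ hd0.ne']
  have hdu : ‖d‖ • u = d := by rw [hu, smul_smul, mul_inv_cancel₀ hd0.ne', one_smul]
  have hθ := curvLevel_pos C hκ
  set θ := curvLevel C κ with hθdef
  have hA := devConst_pos C
  have hnq : 0 ≤ n * q := by positivity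
  refine ((h.le_count hI hq0 hq).and (h.moment_sum hI hu1.le hu1.le (L := θ * (n * q))
    (by positivity)) (by positivity) (by positivity)).mono ?_ le_rfl
  rintro ω ⟨hN, hdev⟩
  set N : ℝ := ((M.obs ω I).card : ℝ) with hNdef
  have hN0 : 0 ≤ N := by positivity
  have h1 : κ * N ≤ ∑ i ∈ M.obs ω I, M.secondMoment P i u u := by
    refine le_trans (by rw [nsmul_eq_mul]; apply le_of_eq; ring)
      (Finset.card_nsmul_le_sum (M.obs ω I) _ κ fun i _ => ?_)
    simpa [hu1] using h.le_secondMoment i u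
  -- `θ` is small enough that, once `n q ≤ 2 N`, the deviation takes at most half of the curvature
  -- `κ N`.
  have h2 : devConst C * √((N + θ * (n * q)) * (θ * (n * q))) ≤ κ / 2 * N := by
    have h3 : √((N + θ * (n * q)) * (θ * (n * q))) ≤ κ / (2 * devConst C) * N := by
      rw [Real.sqrt_le_iff]
      refine ⟨by positivity, ?_⟩
      have h4 : θ * (n * q) ≤ 2 * θ * N := by nlinarith
      have h5 : θ ≤ 1 / 2 := min_le_left _ _
      have h6 : θ ≤ κ ^ 2 / (16 * devConst C ^ 2) := min_le_right _ _
      calc (N + θ * (n * q)) * (θ * (n * q)) ≤ (N + 2 * θ * N) * (2 * θ * N) := by gcongr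
        _ = (1 + 2 * θ) * (2 * θ) * N ^ 2 := by ring
        _ ≤ 4 * (κ ^ 2 / (16 * devConst C ^ 2)) * N ^ 2 := by
            refine mul_le_mul_of_nonneg_right ?_ (sq_nonneg N)
            nlinarith
        _ = (κ / (2 * devConst C) * N) ^ 2 := by field_simp; ring
    calc devConst C * √((N + θ * (n * q)) * (θ * (n * q)))
        ≤ devConst C * (κ / (2 * devConst C) * N) := by gcongr
      _ = κ / 2 * N := by field_simp
  rw [Finset.sum_sub_distrib] at hdev
  have h7 := (neg_le_abs _).trans (hdev.trans h2)
  have h8 : κ / 4 * (n * q) ≤ ∑ i ∈ M.obs ω I, ⟪M.x i ω, u⟫ * ⟪M.x i ω, u⟫ := by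
    have : κ * (n * q / 2) ≤ κ * N := by gcongr
    linarith
  have h9 : ∑ i ∈ M.obs ω I, ⟪M.x i ω, d⟫ ^ 2 =
      ‖d‖ ^ 2 * ∑ i ∈ M.obs ω I, ⟪M.x i ω, u⟫ * ⟪M.x i ω, u⟫ := by
    rw [Finset.mul_sum]
    refine Finset.sum_congr rfl fun i _ => ?_
    nth_rewrite 1 [← hdu]
    rw [real_inner_smul_right]; ring
  rw [h9, mul_comm]
  gcongr

lemma noise_prefix_dir (h : M.DistributionAssumptions P C κ φ) {I : Set ℝ}
    (hI : MeasurableSet I) {d : Vec p} (hd : d ≠ 0) {L : ℝ} (hL : 0 ≤ L) :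
    HoldsExcept P (fun ω => ∀ τ : ℝ, |∑ i ∈ M.obs ω (I ∩ Set.Iic τ), M.ε i ω * ⟪M.x i ω, d⟫| ≤
      devConst C * √(((M.obs ω I).card + L) * L) * ‖d‖) (2 * Real.exp (-9 * L)) := by
  have hd0 := norm_pos_iff.2 hd
  refine (h.noise_prefix hI (u := (‖d‖⁻¹ : ℝ) • d)
    (by rw [norm_smul, norm_inv, norm_norm, inv_mul_cancel₀ hd0.ne']) hL).mono
    (fun ω hω τ => ?_) le_rfl
  have h1 : ∑ i ∈ M.obs ω (I ∩ Set.Iic τ), M.ε i ω * ⟪M.x i ω, d⟫ =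
      (∑ i ∈ M.obs ω (I ∩ Set.Iic τ), M.ε i ω * ⟪M.x i ω, (‖d‖⁻¹ : ℝ) • d⟫) * ‖d‖ := by
    rw [Finset.sum_mul]
    refine Finset.sum_congr rfl fun i _ => ?_
    rw [real_inner_smul_right]
    field_simp
  rw [h1, abs_mul, abs_of_pos hd0]
  exact mul_le_mul_of_nonneg_right (hω τ) hd0.le

end DistributionAssumptions

/-- The bounds that hold, with large probability, simultaneously for the observations in the
segments `D`. -/
structure SegmentBounds (M : Model n p Ω) (C : ℝ≥0) (κ : ℝ) (s : ℕ) (u v : ℝ) (d : Vec p) (ω : Ω)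
    (D : Set ℝ) : Prop where
  curvature : κ / 4 * (n * v) * ‖d‖ ^ 2 ≤ ∑ i ∈ M.obs ω D, ⟪M.x i ω, d⟫ ^ 2
  quadratic : ∀ b : Vec p, ∑ i ∈ M.obs ω D, ⟪M.x i ω, b⟫ ^ 2 ≤
    5 * devConst C * (2 * (n * u) + 2 * (s * Real.log p)) * (‖b‖ + l1Norm b / √s) ^ 2
  noise : ∀ j, |∑ i ∈ M.obs ω D, M.ε i ω * M.x i ω j| ≤
    2 * devConst C * √((2 * (n * u) + 2 * Real.log p) * Real.log p)
  noise_dir : |∑ i ∈ M.obs ω D, M.ε i ω * ⟪M.x i ω, d⟫| ≤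
    2 * devConst C * √((2 * (n * u) + 2 * Real.log p) * Real.log p) * ‖d‖

/-- The exponent in the probability with which `SegmentBounds` fails. -/
noncomputable def segmentRate (C : ℝ≥0) (κ cv : ℝ) : ℝ :=
  min 1 (min (1 / 10) (9 * curvLevel C κ) * cv)

lemma segmentRate_pos (C : ℝ≥0) (hκ : 0 < κ) {cv : ℝ} (hcv : 0 < cv) :
    0 < segmentRate C κ cv := by
  have := curvLevel_pos C hκ
  unfold segmentRate
  positivity

namespace DistributionAssumptions

lemma segmentBounds (h : M.DistributionAssumptions P C κ φ) [IsFiniteMeasure M.wLaw] (hκ : 0 < κ)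
    (hp : 2 ≤ p) {s : ℕ} (hs : 1 ≤ s) {t₀ : ℝ} {T : Set ℝ} {D : ℝ → Set ℝ}
    (hD : (D = fun τ => Set.Ioc t₀ τ) ∨ (D = fun τ => Set.Ioc τ t₀)) {u v cv : ℝ} (hcv : 0 < cv)
    (hu : ∀ τ ∈ T, M.wLaw.real (D τ) ≤ u) (hv : ∀ τ ∈ T, v ≤ M.wLaw.real (D τ))
    (hvL : cv * Real.log p ≤ n * v) (hv0 : 0 ≤ v) {d : Vec p} (hd : d ≠ 0) :
    HoldsExcept P (fun ω => ∀ τ ∈ T, M.SegmentBounds C κ s u v d ω (D τ))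
      (10 * Real.exp (-segmentRate C κ cv * Real.log p)) := by
  rcases T.eq_empty_or_nonempty with rfl | hT
  · exact HoldsExcept.of_forall (by simp)
  have hL := Real.log_natCast_nonneg p
  have hA := devConst_pos C
  have hDm : ∀ τ, MeasurableSet (D τ) := by
    rcases hD with rfl | rfl
    · exact fun τ => measurableSet_Ioc
    · exact fun τ => measurableSet_Ioc
  have hmono : Monotone D ∨ Antitone D := by
    rcases hD with rfl | rfl
    · exact Or.inl fun a b hab => Set.Ioc_subset_Ioc_right hab
    · exact Or.inr fun a b hab => Set.Ioc_subset_Ioc_left hab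
  -- Sums of squares are monotone in the index set: the curvature is bounded below over the inner
  -- set `I`, everything else above over the outer set `O`.
  obtain ⟨I, O, hIm, hOm, hsub, hOD, hvI, huO⟩ := exists_envelopes hT hmono hDm hu hv
  have hall := ((((h.le_sum_sq hκ hIm hv0 hvI hd).and (h.gram hp hs hOm) (by positivity)
    (by positivity)).and (h.noise_coord (by omega) hOm) (by positivity) (by positivity)).and
    (h.noise_prefix_dir hOm hd hL) (by positivity) (by positivity)).and
    (h.count_le hOm huO (Real.log p)) (by positivity) (by positivity)
  refine hall.mono ?_ ?_
  · rintro ω ⟨⟨⟨⟨h1, h2⟩, h3⟩, h4⟩, h5⟩ τ hτ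
    obtain ⟨hID, hDO⟩ := hsub τ hτ
    set N : ℝ := ((M.obs ω O).card : ℝ) with hN
    have hs1 : (1 : ℝ) ≤ s := by exact_mod_cast hs
    have hsL : Real.log p ≤ s * Real.log p := le_mul_of_one_le_left hL hs1
    have hNL : N + Real.log p ≤ 2 * (n * u) + 2 * Real.log p := by linarith
    have hsqrt : devConst C * √((N + Real.log p) * Real.log p) ≤
        devConst C * √((2 * (n * u) + 2 * Real.log p) * Real.log p) := by gcongr
    set V := devConst C * √((2 * (n * u) + 2 * Real.log p) * Real.log p) with hV
    have hV0 : 0 ≤ V := by positivity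
    -- Noise sums are not monotone in the set. But `O` lies on one side of `t₀`, so each segment is
    -- a prefix or a suffix of `O`.
    have hprefix : ∀ (f : Fin n → ℝ) (B : ℝ), 0 ≤ B →
        (∀ τ : ℝ, |∑ i ∈ M.obs ω (O ∩ Set.Iic τ), f i| ≤ B) →
        |∑ i ∈ M.obs ω (D τ), f i| ≤ 2 * B := by
      intro f B hB hf
      rcases hD with rfl | rfl
      · have : Set.Ioc t₀ τ = O ∩ Set.Iic τ := by
          refine Set.Subset.antisymm (fun a ha => ⟨hDO ha, ha.2⟩) fun a ha => ?_
          obtain ⟨τ', hτ'⟩ := hOD a ha.1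
          exact ⟨hτ'.1, ha.2⟩
        simp only [this]
        linarith [hf τ]
      · have : Set.Ioc τ t₀ = O ∩ Set.Ioi τ := by
          refine Set.Subset.antisymm (fun a ha => ⟨hDO ha, ha.1⟩) fun a ha => ?_
          obtain ⟨τ', hτ'⟩ := hOD a ha.1
          exact ⟨ha.2, hτ'.2⟩
        simp only [this]
        exact abs_sum_obs_suffix_le hf τ
    refine ⟨?_, fun b => ?_, fun j => ?_, ?_⟩
    · exact h1.trans (Finset.sum_le_sum_of_subset_of_nonneg (M.obs_mono ω hID)
        fun i _ _ => sq_nonneg _)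
    · refine (Finset.sum_le_sum_of_subset_of_nonneg (M.obs_mono ω hDO)
        fun i _ _ => sq_nonneg _).trans ?_
      have hNs : N + s * Real.log p ≤ 2 * (n * u) + 2 * (s * Real.log p) := by linarith
      exact (h.sum_sq_le_of_gram (by positivity) (h2 b)).trans
        (mul_le_mul_of_nonneg_right (mul_le_mul_of_nonneg_left hNs (by positivity)) (sq_nonneg _))
    · have := hprefix (fun i => M.ε i ω * M.x i ω j) V hV0 fun τ => (h3 j τ).trans hsqrt
      rw [mul_assoc]
      exact this
    · have := hprefix (fun i => M.ε i ω * ⟪M.x i ω, d⟫) (V * ‖d‖) (by positivity)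
        fun τ => (h4 τ).trans (by gcongr)
      rw [mul_assoc 2, ← hV, mul_assoc]
      exact this
  · have hr1 : segmentRate C κ cv ≤ 1 := min_le_left _ _
    have hθ := curvLevel_pos C hκ
    have hr2 : segmentRate C κ cv ≤ 1 / 10 * cv :=
      (min_le_right _ _).trans (mul_le_mul_of_nonneg_right (min_le_left _ _) hcv.le)
    have hr3 : segmentRate C κ cv ≤ 9 * curvLevel C κ * cv :=
      (min_le_right _ _).trans (mul_le_mul_of_nonneg_right (min_le_right _ _) hcv.le)
    have e1 : Real.exp (-(n * v / 10)) ≤ Real.exp (-segmentRate C κ cv * Real.log p) := by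
      rw [Real.exp_le_exp]
      nlinarith [mul_le_mul_of_nonneg_right hr2 hL]
    have e2 : Real.exp (-9 * (curvLevel C κ * (n * v))) ≤
        Real.exp (-segmentRate C κ cv * Real.log p) := by
      rw [Real.exp_le_exp]
      nlinarith [mul_le_mul_of_nonneg_right hr3 hL,
        mul_le_mul_of_nonneg_left hvL (by positivity : 0 ≤ 9 * curvLevel C κ)]
    have e3 : Real.exp (-Real.log p) ≤ Real.exp (-segmentRate C κ cv * Real.log p) := by
      rw [Real.exp_le_exp]
      nlinarith
    have e4 : Real.exp (-9 * Real.log p) ≤ Real.exp (-segmentRate C κ cv * Real.log p) := by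
      rw [Real.exp_le_exp]
      nlinarith
    linarith

end DistributionAssumptions

end Model

/-! ### The criterion as a sum over a segment, and bounds for the initial estimation -/

namespace Model

variable {n p : ℕ} {Ω : Type*} {M : Model n p Ω}

lemma Q_eq (ω : Ω) (τ : WithBot ℝ) (β γ : Vec p) :
    M.Q ω τ β γ = 1 / (n : ℝ) * ∑ i, (if (M.w i ω : WithBot ℝ) ≤ τ
      then (M.y i ω - ⟪M.x i ω, β⟫) ^ 2 else (M.y i ω - ⟪M.x i ω, γ⟫) ^ 2) := by
  rw [Q, ← mul_add, ← Finset.sum_add_distrib]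
  congr 1
  refine Finset.sum_congr rfl fun i _ => ?_
  by_cases h : (M.w i ω : WithBot ℝ) ≤ τ
  · simp [h, not_lt.2 h]
  · simp [h, not_le.1 h]

lemma sum_obs_eq (ω : Ω) (D : Set ℝ) (f : Fin n → ℝ) [DecidablePred (· ∈ D)] :
    ∑ i ∈ M.obs ω D, f i = ∑ i, if M.w i ω ∈ D then f i else 0 := by
  rw [obs, sum_idx_eq]
  exact Finset.sum_congr rfl fun i _ => by simp only [Set.indicator]

lemma R_of_le {ω : Ω} {τ : WithBot ℝ} (hτ : M.τ₀ ≤ τ) (β γ : Vec p) :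
    M.R ω τ β γ = 1 / (n : ℝ) * ∑ i ∈ M.obs ω {a | M.τ₀ < (a : WithBot ℝ) ∧ (a : WithBot ℝ) ≤ τ},
      ((M.y i ω - ⟪M.x i ω, β⟫) ^ 2 - (M.y i ω - ⟪M.x i ω, γ⟫) ^ 2) := by
  classical
  rw [R, Q_eq, Q_eq, ← mul_sub, ← Finset.sum_sub_distrib, sum_obs_eq]
  congr 1
  refine Finset.sum_congr rfl fun i _ => ?_
  simp only [Set.mem_ofPred_eq]
  by_cases h1 : (M.w i ω : WithBot ℝ) ≤ M.τ₀
  · simp [h1, h1.trans hτ, not_lt.2 h1]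
  · by_cases h2 : (M.w i ω : WithBot ℝ) ≤ τ
    · simp [h1, h2, not_le.1 h1]
    · simp [h1, h2]

lemma R_of_ge {ω : Ω} {τ : WithBot ℝ} (hτ : τ ≤ M.τ₀) (β γ : Vec p) :
    M.R ω τ β γ = 1 / (n : ℝ) * ∑ i ∈ M.obs ω {a | τ < (a : WithBot ℝ) ∧ (a : WithBot ℝ) ≤ M.τ₀},
      ((M.y i ω - ⟪M.x i ω, γ⟫) ^ 2 - (M.y i ω - ⟪M.x i ω, β⟫) ^ 2) := by
  classical
  rw [R, Q_eq, Q_eq, ← mul_sub, ← Finset.sum_sub_distrib, sum_obs_eq]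
  congr 1
  refine Finset.sum_congr rfl fun i _ => ?_
  simp only [Set.mem_ofPred_eq]
  by_cases h1 : (M.w i ω : WithBot ℝ) ≤ τ
  · simp [h1, h1.trans hτ, not_lt.2 h1]
  · by_cases h2 : (M.w i ω : WithBot ℝ) ≤ M.τ₀
    · simp [h1, h2, not_le.1 h1]
    · simp [h1, h2]

lemma Q_coe_eq (ω : Ω) (τ : ℝ) (β γ : Vec p) :
    M.Q ω τ β γ = 1 / (n : ℝ) * ∑ i ∈ M.obs ω (Set.Iic τ), (M.y i ω - ⟪M.x i ω, β⟫) ^ 2 +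
      1 / (n : ℝ) * ∑ i ∈ M.obs ω (Set.Ioi τ), (M.y i ω - ⟪M.x i ω, γ⟫) ^ 2 := by
  classical
  rw [sum_obs_eq, sum_obs_eq, Q]
  simp only [WithBot.coe_le_coe, WithBot.coe_lt_coe, Set.mem_Iic, Set.mem_Ioi]

/-- The penalized loss separates in `β` and `γ`, so the initial estimates are two Lassos over
disjoint sets of observations. -/
lemma IsInitialEstimate.left {lam τ : ℝ} {ω : Ω} {b g : Vec p}
    (h : M.IsInitialEstimate lam τ ω b g) (β : Vec p) :
    1 / (n : ℝ) * ∑ i ∈ M.obs ω (Set.Iic τ), (M.y i ω - ⟪M.x i ω, b⟫) ^ 2 + lam * l1Norm b ≤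
      1 / (n : ℝ) * ∑ i ∈ M.obs ω (Set.Iic τ), (M.y i ω - ⟪M.x i ω, β⟫) ^ 2 + lam * l1Norm β := by
  have := h β g
  rw [Q_coe_eq, Q_coe_eq] at this
  linarith

lemma IsInitialEstimate.right {lam τ : ℝ} {ω : Ω} {b g : Vec p}
    (h : M.IsInitialEstimate lam τ ω b g) (γ : Vec p) :
    1 / (n : ℝ) * ∑ i ∈ M.obs ω (Set.Ioi τ), (M.y i ω - ⟪M.x i ω, g⟫) ^ 2 + lam * l1Norm g ≤
      1 / (n : ℝ) * ∑ i ∈ M.obs ω (Set.Ioi τ), (M.y i ω - ⟪M.x i ω, γ⟫) ^ 2 + lam * l1Norm γ := by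
  have := h b γ
  rw [Q_coe_eq, Q_coe_eq] at this
  linarith

lemma y_of_le {i : Fin n} {ω : Ω} (h : (M.w i ω : WithBot ℝ) ≤ M.τ₀) :
    M.y i ω = ⟪M.x i ω, M.β₀⟫ + M.ε i ω := by simp [y, h]

lemma y_of_lt {i : Fin n} {ω : Ω} (h : M.τ₀ < (M.w i ω : WithBot ℝ)) :
    M.y i ω = ⟪M.x i ω, M.γ₀⟫ + M.ε i ω := by simp [y, not_le.2 h]

lemma exists_support_finset (M : Model n p Ω) {s : ℕ} (hs : M.support.ncard ≤ s) :
    ∃ S : Finset (Fin p), S.card ≤ s ∧ (∀ j ∉ S, M.β₀ j = 0) ∧ ∀ j ∉ S, M.γ₀ j = 0 := by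
  classical
  have hmem : ∀ j ∉ M.support.toFinset, M.β₀ j = 0 ∧ M.γ₀ j = 0 := by
    intro j hj
    rw [Set.mem_toFinset] at hj
    simpa [support] using hj
  exact ⟨M.support.toFinset, by rwa [← Set.ncard_eq_toFinset_card'],
    fun j hj => (hmem j hj).1, fun j hj => (hmem j hj).2⟩

lemma Phi_coe (M : Model n p Ω) (τ : ℝ) : M.Phi τ = M.wLaw.real (Set.Iic τ) := by
  rw [Phi]; congr 1; ext a; simp

lemma one_sub_Phi_coe (M : Model n p Ω) [IsProbabilityMeasure M.wLaw] (τ : ℝ) :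
    1 - M.Phi τ = M.wLaw.real (Set.Ioi τ) := by
  rw [Phi_coe, ← Set.compl_Iic, probReal_compl_eq_one_sub measurableSet_Iic]

lemma measureReal_Ioc (M : Model n p Ω) [IsProbabilityMeasure M.wLaw] {a b : ℝ} (h : a ≤ b) :
    M.wLaw.real (Set.Ioc a b) = M.Phi b - M.Phi a := by
  have : Set.Ioc a b = Set.Iic b \ Set.Iic a := by
    ext x; simp [and_comm]
  rw [Phi_coe, Phi_coe, this, measureReal_sdiff (Set.Iic_subset_Iic.2 h) measurableSet_Iic]

lemma Phi_mono (M : Model n p Ω) [IsProbabilityMeasure M.wLaw] : Monotone M.Phi :=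
  fun _ _ h => measureReal_mono fun _ ha => le_trans ha h

lemma Phi_nonneg (M : Model n p Ω) (τ : WithBot ℝ) : 0 ≤ M.Phi τ := measureReal_nonneg

lemma PhiMin_le_one (M : Model n p Ω) (τ : WithBot ℝ) : M.PhiMin τ ≤ 1 :=
  (min_le_right _ _).trans (by linarith [M.Phi_nonneg τ])

variable {C : ℝ≥0} {κ φ : ℝ}

namespace DistributionAssumptions

lemma isProbabilityMeasure_wLaw [MeasurableSpace Ω] {P : Measure Ω}
    [IsProbabilityMeasure P] (h : M.DistributionAssumptions P C κ φ)
    (hn : 1 ≤ n) : IsProbabilityMeasure M.wLaw := by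
  rw [← h.law_w ⟨0, hn⟩]
  exact Measure.isProbabilityMeasure_map (h.measurable_w _).aemeasurable

end DistributionAssumptions

lemma sqrt_mul_div_le {n L : ℝ} (hn : 0 < n) (hL : 0 ≤ L) (hLn : L ≤ n) :
    1 / n * √((n + L) * L) ≤ 2 * √(L / n) := by
  have h1 : √((n + L) * L) ≤ 2 * (n * √(L / n)) := by
    rw [Real.sqrt_le_iff]
    refine ⟨by positivity, ?_⟩
    rw [mul_pow, mul_pow, Real.sq_sqrt (by positivity)]
    have : n ^ 2 * (L / n) = n * L := by field_simp
    rw [this]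
    nlinarith
  rw [one_div, inv_mul_le_iff₀ hn]
  linarith

/-- The restricted eigenvalue condition, with constant `ρ`, and the bound for the noise that the
Lasso over the observations in `I` needs. -/
structure EstimationBounds (M : Model n p Ω) (C : ℝ≥0) (ρ : ℝ) (s : ℕ) (ω : Ω) (I : Set ℝ) :
    Prop where
  eigen : ∀ v : Vec p, l1Norm v ≤ 4 * √s * ‖v‖ →
    ρ * ‖v‖ ^ 2 ≤ 1 / (n : ℝ) * ∑ i ∈ M.obs ω I, ⟪M.x i ω, v⟫ ^ 2
  noise : ∀ j, 1 / (n : ℝ) * |∑ i ∈ M.obs ω I, M.ε i ω * M.x i ω j| ≤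
    2 * devConst C * √(Real.log p / n)

/-- What is required of the sample size for the initial estimates to be accurate. -/
structure LargeSample (n p s : ℕ) (C : ℝ≥0) (κ m : ℝ) : Prop where
  one_le_n : 1 ≤ n
  two_le_p : 2 ≤ p
  one_le_s : 1 ≤ s
  log_le : s * Real.log p ≤ n
  log_le_mul : 10 * Real.log p ≤ n * m
  deviation : 100 * devConst C * √((n + s * Real.log p) * (s * Real.log p)) ≤ κ / 4 * (n * m)

lemma LargeSample.log_le' {s : ℕ} {m : ℝ} (hl : LargeSample n p s C κ m) : Real.log p ≤ n := by
  have hs1 : (1 : ℝ) ≤ s := by exact_mod_cast hl.one_le_s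
  exact (le_mul_of_one_le_left (Real.log_natCast_nonneg p) hs1).trans hl.log_le

lemma add_l1Norm_div_le {s : ℕ} (hs : 1 ≤ s) {v : Vec p} (hv : l1Norm v ≤ 4 * √s * ‖v‖) :
    ‖v‖ + l1Norm v / √s ≤ 5 * ‖v‖ := by
  have hs0 : 0 < √(s : ℝ) := Real.sqrt_pos.2 (by exact_mod_cast hs)
  have : l1Norm v / √s ≤ 4 * ‖v‖ := by
    rw [div_le_iff₀ hs0]; linarith
  linarith

lemma EstimationBounds.error {s : ℕ} {m lam : ℝ} {ω : Ω} {I : Set ℝ} {a b : Vec p}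
    {e : Fin n → ℝ} {S : Finset (Fin p)} (hE : M.EstimationBounds C (κ * m / 4) s ω I)
    (hκ : 0 < κ) (hm : 0 < m) (hlam : 0 < lam)
    (hy : ∀ i ∈ M.obs ω I, M.y i ω = ⟪M.x i ω, a⟫ + e i)
    (hmin : 1 / (n : ℝ) * ∑ i ∈ M.obs ω I, (M.y i ω - ⟪M.x i ω, b⟫) ^ 2 + lam * l1Norm b ≤
      1 / (n : ℝ) * ∑ i ∈ M.obs ω I, (M.y i ω - ⟪M.x i ω, a⟫) ^ 2 + lam * l1Norm a)
    (hnoise : ∀ j, 1 / (n : ℝ) * |∑ i ∈ M.obs ω I, e i * M.x i ω j| ≤ lam / 4)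
    (hS : S.card ≤ s) (hsupp : ∀ j ∉ S, a j = 0) :
    l1Norm (b - a) ≤ 4 * √s * ‖b - a‖ ∧ ‖b - a‖ ≤ 6 * (lam * √s) / (κ * m) := by
  have := lasso_error_bound (by positivity) hlam (by positivity : 0 < κ * m / 4) hy hmin hnoise hS
    hsupp hE.eigen
  refine ⟨this.1, this.2.trans (le_of_eq ?_)⟩
  field_simp; ring

lemma noise_scaled_le {s : ℕ} {m : ℝ} (hl : LargeSample n p s C κ m) {ω : Ω} {I : Set ℝ}
    (h : ∀ (j : Fin p) (τ : ℝ),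
      |∑ i ∈ M.obs ω (I ∩ Set.Iic τ), M.ε i ω * M.x i ω j| ≤
      devConst C * √(((M.obs ω I).card + Real.log p) * Real.log p)) (j : Fin p) (τ : ℝ) :
    1 / (n : ℝ) * |∑ i ∈ M.obs ω (I ∩ Set.Iic τ), M.ε i ω * M.x i ω j| ≤
      2 * devConst C * √(Real.log p / n) := by
  have hL := Real.log_natCast_nonneg p
  have hA := devConst_pos C
  have hn : (0 : ℝ) < n := by exact_mod_cast hl.one_le_n
  have hcard : ((M.obs ω I).card : ℝ) ≤ n := by
    exact_mod_cast (Finset.card_le_univ _).trans (by simp)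
  calc 1 / (n : ℝ) * |∑ i ∈ M.obs ω (I ∩ Set.Iic τ), M.ε i ω * M.x i ω j|
      ≤ 1 / (n : ℝ) * (devConst C * √((n + Real.log p) * Real.log p)) := by
        gcongr
        exact (h j τ).trans (by gcongr)
    _ = devConst C * (1 / (n : ℝ) * √((n + Real.log p) * Real.log p)) := by ring
    _ ≤ devConst C * (2 * √(Real.log p / n)) := by
        exact mul_le_mul_of_nonneg_left (sqrt_mul_div_le hn hL hl.log_le') hA.le
    _ = _ := by ring

namespace DistributionAssumptions

variable [MeasurableSpace Ω] {P : Measure Ω} [IsProbabilityMeasure P]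

lemma estimationBounds (h : M.DistributionAssumptions P C κ φ) (hκ : 0 < κ) {s : ℕ} {m : ℝ}
    (hl : LargeSample n p s C κ m) {I : Set ℝ} (hI : MeasurableSet I) (hm0 : 0 ≤ m)
    (hm : m ≤ M.wLaw.real I) :
    HoldsExcept P (fun ω => M.EstimationBounds C (κ * m / 4) s ω I)
      (5 * Real.exp (-Real.log p)) := by
  have hL := Real.log_natCast_nonneg p
  have hn : (0 : ℝ) < n := by exact_mod_cast hl.one_le_n
  have hp : 1 ≤ p := le_trans (by norm_num) hl.two_le_p
  refine (((h.le_count hI hm0 hm).and (h.gram hl.two_le_p hl.one_le_s hI) (by positivity)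
    (by positivity)).and (h.noise_coord hp hI) (by positivity) (by positivity)).mono ?_ ?_
  · rintro ω ⟨⟨h1, h2⟩, h3⟩
    refine ⟨fun v hv => ?_, fun j => ?_⟩
    · have h4 := h.le_sum_sq_of_gram (h2 v) (add_l1Norm_div_le hl.one_le_s hv) (by positivity)
      have h5 : κ * (n * m / 2) * ‖v‖ ^ 2 ≤ κ * (M.obs ω I).card * ‖v‖ ^ 2 := by gcongr
      have h6 := mul_le_mul_of_nonneg_right hl.deviation (sq_nonneg ‖v‖)
      rw [one_div, le_inv_mul_iff₀ hn]
      nlinarith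
    · have h6 : |∑ i ∈ M.obs ω I, M.ε i ω * M.x i ω j| ≤
          n * (2 * devConst C * √(Real.log p / n)) := abs_sum_obs_le_of_prefix fun τ => by
        have := noise_scaled_le hl h3 j τ
        rwa [one_div, inv_mul_le_iff₀ hn] at this
      rwa [one_div, inv_mul_le_iff₀ hn]
  · have : Real.exp (-(n * m / 10)) ≤ Real.exp (-Real.log p) := by
      rw [Real.exp_le_exp]
      linarith [hl.log_le_mul]
    linarith

end DistributionAssumptions

end Model

/-! ### The case of no change -/

namespace Model

variable {n p : ℕ} {Ω : Type*} {M : Model n p Ω} {C : ℝ≥0} {κ φ : ℝ}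

/-- The constant of the loss incurred when there is no change. -/
noncomputable def noChangeConst (C : ℝ≥0) (κ L₁ : ℝ) : ℝ :=
  500 * devConst C * (6 * L₁ / κ) ^ 2 + 32 * devConst C * (6 * L₁ / κ)

lemma noChangeConst_pos (hκ : 0 < κ) {L₁ : ℝ} (hL₁ : 0 < L₁) : 0 < noChangeConst C κ L₁ := by
  have := devConst_pos C
  unfold noChangeConst
  positivity

lemma log_div_pos {s : ℕ} {m : ℝ} (hl : LargeSample n p s C κ m) : 0 < √(Real.log p / n) := by
  have hn : (0 : ℝ) < n := by exact_mod_cast hl.one_le_n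
  have hL : 0 < Real.log p := Real.log_pos (by exact_mod_cast hl.two_le_p)
  positivity

/-- This is the segment bound without a jump. Quadratic terms over any segment are dominated by
those over the whole sample, and the cone condition turns `‖·‖₁` into `√s E`. -/
lemma no_change_loss_ge {s : ℕ} {m q E : ℝ} {ω : Ω} {D : Set ℝ} {D₁ D₂ : Vec p}
    (hl : LargeSample n p s C κ m)
    (hquad : ∀ b : Vec p, ∑ i ∈ M.obs ω Set.univ, ⟪M.x i ω, b⟫ ^ 2 ≤
      5 * devConst C * (n + s * Real.log p) * (‖b‖ + l1Norm b / √s) ^ 2)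
    (hnoise : ∀ j, 1 / (n : ℝ) * |∑ i ∈ M.obs ω D, M.ε i ω * M.x i ω j| ≤ 2 * devConst C * q)
    (hq : 0 ≤ q) (h₁ : l1Norm D₁ ≤ 4 * √s * ‖D₁‖) (h₂ : l1Norm D₂ ≤ 4 * √s * ‖D₂‖)
    (hE₁ : ‖D₁‖ ≤ E) (hE₂ : ‖D₂‖ ≤ E) :
    -(500 * devConst C * E ^ 2 + 32 * devConst C * (√s * q) * E) ≤
      1 / (n : ℝ) * ∑ i ∈ M.obs ω D,
        ((M.ε i ω - ⟪M.x i ω, D₁⟫) ^ 2 - (M.ε i ω - ⟪M.x i ω, D₂⟫) ^ 2) := by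
  have hA := devConst_pos C
  have hn : (0 : ℝ) < n := by exact_mod_cast hl.one_le_n
  have hE : 0 ≤ E := (norm_nonneg _).trans hE₁
  have hquad' : ∀ b : Vec p, l1Norm b ≤ 4 * √s * ‖b‖ → ‖b‖ ≤ E →
      ∑ i ∈ M.obs ω D, ⟪M.x i ω, b⟫ ^ 2 ≤ n * (250 * devConst C * E ^ 2) := by
    intro b hb hbE
    have h0 : 0 ≤ l1Norm b / √s := div_nonneg (l1Norm_nonneg b) (Real.sqrt_nonneg _)
    have h5 : ‖b‖ + l1Norm b / √s ≤ 5 * E := (add_l1Norm_div_le hl.one_le_s hb).trans (by linarith)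
    refine (Finset.sum_le_sum_of_subset_of_nonneg (M.obs_mono ω (Set.subset_univ D))
      fun i _ _ => sq_nonneg _).trans ((hquad b).trans ?_)
    calc 5 * devConst C * (n + s * Real.log p) * (‖b‖ + l1Norm b / √s) ^ 2
        ≤ 5 * devConst C * (n + n) * (5 * E) ^ 2 := by
          have := hl.log_le
          gcongr
      _ = n * (250 * devConst C * E ^ 2) := by ring
  have hV : ∀ j, |∑ i ∈ M.obs ω D, M.ε i ω * M.x i ω j| ≤ n * (2 * devConst C * q) := fun j => by
    have := hnoise j
    rwa [one_div, inv_mul_le_iff₀ hn] at this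
  have h3 := segment_loss_ge (J := M.obs ω D) (x := fun i => M.x i ω) (e := fun i => M.ε i ω)
    (d := 0) (D₁ := D₁) (D₂ := D₂) hV
  simp only [inner_zero_right, mul_zero, Finset.sum_const_zero, abs_zero, zero_add, ne_eq,
    OfNat.ofNat_ne_zero, not_false_eq_true, zero_pow, sub_zero, zero_sub] at h3
  have h4 : l1Norm D₁ + l1Norm D₂ ≤ 8 * √s * E := by
    have e1 : 4 * √s * ‖D₁‖ ≤ 4 * √s * E := by gcongr
    have e2 : 4 * √s * ‖D₂‖ ≤ 4 * √s * E := by gcongr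
    linarith
  have h5 : 2 * (n * (2 * devConst C * q)) * (l1Norm D₁ + l1Norm D₂) ≤
      2 * (n * (2 * devConst C * q)) * (8 * √s * E) := by gcongr
  have h6 := hquad' D₁ h₁ hE₁
  have h7 := hquad' D₂ h₂ hE₂
  rw [one_div, le_inv_mul_iff₀ hn]
  refine le_trans ?_ h3
  linarith

namespace DistributionAssumptions

variable [MeasurableSpace Ω] {P : Measure Ω}

/-- `Φ(τ₀) = 0` also allows a finite `τ₀` below almost all of the mass; almost surely no observation
then lies at or below `τ₀`. -/
lemma forall_lt_of_Phi_eq_zero (h : M.DistributionAssumptions P C κ φ)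
    [IsProbabilityMeasure M.wLaw] (hΦ : M.Phi M.τ₀ = 0) :
    HoldsExcept P (fun ω => ∀ i, M.τ₀ < (M.w i ω : WithBot ℝ)) 0 := by
  have hS : MeasurableSet {a : ℝ | (a : WithBot ℝ) ≤ M.τ₀} := by
    cases M.τ₀ with
    | bot => simp
    | coe t =>
      simp only [WithBot.coe_le_coe]
      exact measurableSet_Iic
  have h1 := HoldsExcept.finset_forall (P := P) (δ := 0) Finset.univ
    (G := fun i ω => M.τ₀ < (M.w i ω : WithBot ℝ)) fun i _ => by
      have h2 : M.wLaw {a : ℝ | (a : WithBot ℝ) ≤ M.τ₀} = 0 := by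
        rw [Phi, measureReal_def, ENNReal.toReal_eq_zero_iff] at hΦ
        exact hΦ.resolve_right (measure_ne_top _ _)
      rw [← h.law_w i, Measure.map_apply (h.measurable_w i) hS] at h2
      simp only [HoldsExcept, not_lt, ENNReal.ofReal_zero, nonpos_iff_eq_zero]
      exact h2
  exact h1.mono (fun ω hω i => hω i (Finset.mem_univ i)) (by simp)

variable [IsProbabilityMeasure P]

/-- The lower bound for the excess loss when there is no change. -/
lemma no_change_bound (h : M.DistributionAssumptions P C κ φ) (hκ : 0 < κ) {s : ℕ}
    {τi lam L₁ μ v : ℝ} {bhat ghat : Ω → Vec p}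
    (hl : LargeSample n p s C κ (M.PhiMin τi)) (hm : 0 < M.PhiMin τi)
    (hsupp : M.support.ncard ≤ s) (hΦ : M.Phi M.τ₀ = 0) (hL₁ : 0 < L₁)
    (hlo : 8 * devConst C * √(Real.log p / n) ≤ lam) (hhi : lam ≤ L₁ * √(Real.log p / n))
    (hest : ∀ ω, M.IsInitialEstimate lam τi ω (bhat ω) (ghat ω)) (hv : 0 < v) :
    HoldsExcept P (fun ω => ∀ τ ∈ M.H 1 v,
      μ - noChangeConst C κ L₁ * (s * Real.log p / (n * M.PhiMin τi ^ 2)) ≤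
        M.S μ ω (τ : ℝ) (bhat ω) (ghat ω)) (14 * Real.exp (-Real.log p)) := by
  have := h.isProbabilityMeasure_wLaw hl.one_le_n
  have hL := Real.log_natCast_nonneg p
  have hA := devConst_pos C
  have hn : (0 : ℝ) < n := by exact_mod_cast hl.one_le_n
  have hp : 1 ≤ p := le_trans (by norm_num) hl.two_le_p
  have hm1 : M.PhiMin τi ≤ 1 := M.PhiMin_le_one τi
  set m := M.PhiMin τi with hmdef
  set q := √(Real.log p / n) with hq
  have hq0 : 0 < q := log_div_pos hl
  have hlam : 0 < lam := lt_of_lt_of_le (by positivity) hlo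
  have hI₁ : m ≤ M.wLaw.real (Set.Iic τi) := by rw [← Phi_coe]; exact min_le_left _ _
  have hI₂ : m ≤ M.wLaw.real (Set.Ioi τi) := by rw [← one_sub_Phi_coe]; exact min_le_right _ _
  obtain ⟨S, hS, -, hSγ⟩ := M.exists_support_finset hsupp
  refine (((((h.estimationBounds hκ hl measurableSet_Iic hm.le hI₁).and
    (h.estimationBounds hκ hl measurableSet_Ioi hm.le hI₂) (by positivity) (by positivity)).and
    (h.gram hl.two_le_p hl.one_le_s MeasurableSet.univ) (by positivity) (by positivity)).and
    (h.noise_coord hp MeasurableSet.univ) (by positivity) (by positivity)).and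
    (h.forall_lt_of_Phi_eq_zero hΦ) (by positivity) le_rfl).mono ?_ (by linarith)
  rintro ω ⟨⟨⟨⟨hE₁, hE₂⟩, hG⟩, hN⟩, hlt⟩ τ ⟨hτv, -⟩
  have hy : ∀ i, M.y i ω = ⟪M.x i ω, M.γ₀⟫ + M.ε i ω := fun i => y_of_lt (hlt i)
  have hn4 : 2 * devConst C * q ≤ lam / 4 := by linarith
  obtain ⟨hb1, hb2⟩ := hE₁.error hκ hm hlam (fun i _ => hy i) ((hest ω).left M.γ₀)
    (fun j => (hE₁.noise j).trans hn4) hS hSγ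
  obtain ⟨hg1, hg2⟩ := hE₂.error hκ hm hlam (fun i _ => hy i) ((hest ω).right M.γ₀)
    (fun j => (hE₂.noise j).trans hn4) hS hSγ
  set E := 6 * L₁ / κ * (√s * q) / m with hE
  have hEle : 6 * (lam * √s) / (κ * m) ≤ E := by
    rw [hE]
    calc 6 * (lam * √s) / (κ * m) ≤ 6 * (L₁ * q * √s) / (κ * m) := by gcongr
      _ = 6 * L₁ / κ * (√s * q) / m := by field_simp
  -- Positivity of `v` enters here: `Φ(τ) ≥ v > 0` places `τ` to the right of `τ₀` and makes the
  -- penalty difference equal to `μ`.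
  rw [hΦ, sub_zero, abs_of_nonneg (M.Phi_nonneg _)] at hτv
  have hτ : M.τ₀ ≤ (τ : WithBot ℝ) := by
    by_contra! hcon
    have := M.Phi_mono hcon.le
    linarith
  have hobs : M.obs ω {a | M.τ₀ < (a : WithBot ℝ) ∧ (a : WithBot ℝ) ≤ (τ : WithBot ℝ)} =
      M.obs ω (Set.univ ∩ Set.Iic τ) := by
    ext i
    simp only [mem_obs, Set.mem_ofPred_eq, Set.univ_inter, Set.mem_Iic, WithBot.coe_le_coe,
      hlt i, true_and]
  have hcardle : ((M.obs ω Set.univ).card : ℝ) ≤ n := by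
    exact_mod_cast (Finset.card_le_univ _).trans (by simp)
  have hR := no_change_loss_ge (D := Set.univ ∩ Set.Iic τ) (D₁ := bhat ω - M.γ₀)
    (D₂ := ghat ω - M.γ₀) (q := q) (E := E) hl (fun b => by
      refine (h.sum_sq_le_of_gram (by positivity) (hG b)).trans ?_
      refine mul_le_mul_of_nonneg_right (mul_le_mul_of_nonneg_left ?_ (by positivity))
        (sq_nonneg _)
      linarith) (fun j => noise_scaled_le hl hN j τ) hq0.le hb1 hg1 (hb2.trans hEle)
    (hg2.trans hEle)
  have hSeq : M.S μ ω (τ : ℝ) (bhat ω) (ghat ω) = 1 / (n : ℝ) *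
      ∑ i ∈ M.obs ω (Set.univ ∩ Set.Iic τ), ((M.ε i ω - ⟪M.x i ω, bhat ω - M.γ₀⟫) ^ 2 -
        (M.ε i ω - ⟪M.x i ω, ghat ω - M.γ₀⟫) ^ 2) + μ := by
    rw [Model.S, R_of_le hτ, hobs, hΦ]
    have hne : M.Phi (τ : ℝ) ≠ 0 := by linarith
    simp only [l0Norm, hne, if_false, if_true, sub_zero, mul_one]
    congr 2
    refine Finset.sum_congr rfl fun i _ => ?_
    rw [hy i, inner_sub_right, inner_sub_right]
    ring
  rw [hSeq]
  have hsq : (√s * q) ^ 2 = s * Real.log p / n := by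
    rw [mul_pow, hq, Real.sq_sqrt (by positivity), Real.sq_sqrt (by positivity), mul_div_assoc]
  have hfinal : 500 * devConst C * E ^ 2 + 32 * devConst C * (√s * q) * E ≤
      noChangeConst C κ L₁ * (s * Real.log p / (n * m ^ 2)) := by
    have e1 : E ^ 2 = (6 * L₁ / κ) ^ 2 * (s * Real.log p / (n * m ^ 2)) := by
      rw [hE, div_pow, mul_pow, hsq]; field_simp
    -- The noise term carries only one factor `1 / m`; the second is added for free because `m ≤ 1`.
    have e2 : (√s * q) * E ≤ 6 * L₁ / κ * (s * Real.log p / (n * m ^ 2)) := by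
      have : (√s * q) * E = 6 * L₁ / κ * ((√s * q) ^ 2 / m) := by rw [hE]; ring
      rw [this, hsq, div_div]
      have hm2 : m ^ 2 ≤ m := by nlinarith
      gcongr
    unfold noChangeConst
    rw [e1]
    nlinarith [mul_le_mul_of_nonneg_left e2 hA.le]
  linarith

end DistributionAssumptions

end Model

/-! ### The case of a finite change point -/

namespace Model

variable {n p : ℕ} {Ω : Type*} {M : Model n p Ω} {C : ℝ≥0} {κ φ : ℝ}

lemma sum_obs_ite (ω : Ω) (I K : Set ℝ) [DecidablePred (· ∈ K)] (f : Fin n → ℝ) :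
    ∑ i ∈ M.obs ω I, (if M.w i ω ∈ K then f i else 0) = ∑ i ∈ M.obs ω (I ∩ K), f i := by
  classical
  rw [← Finset.sum_filter]
  refine Finset.sum_congr ?_ fun _ _ => rfl
  ext i
  simp [mem_obs]

/-- The initial estimates in the presence of a change point. -/
lemma change_error {s : ℕ} {τi t₀ lam m B q : ℝ} {ω : Ω} {b g : Vec p} (hκ : 0 < κ) (hm : 0 < m)
    (hlam : 0 < lam) (ht₀ : M.τ₀ = (t₀ : WithBot ℝ)) (hsupp : M.support.ncard ≤ s)
    (hE₁ : M.EstimationBounds C (κ * m / 4) s ω (Set.Iic τi))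
    (hE₂ : M.EstimationBounds C (κ * m / 4) s ω (Set.Ioi τi))
    (hq : q = √(Real.log p / n))
    (hB : ∀ j, 1 / (n : ℝ) *
      |∑ i ∈ M.obs ω (Set.uIoc τi t₀), ⟪M.x i ω, M.β₀ - M.γ₀⟫ * M.x i ω j| ≤ B)
    (hlamB : 2 * devConst C * q + B ≤ lam / 4) (hest : M.IsInitialEstimate lam τi ω b g) :
    (l1Norm (b - M.β₀) ≤ 4 * √s * ‖b - M.β₀‖ ∧ ‖b - M.β₀‖ ≤ 6 * (lam * √s) / (κ * m)) ∧
      (l1Norm (g - M.γ₀) ≤ 4 * √s * ‖g - M.γ₀‖ ∧ ‖g - M.γ₀‖ ≤ 6 * (lam * √s) / (κ * m)) := by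
  classical
  obtain ⟨A₀, hA₀, hβ, hγ⟩ := M.exists_support_finset hsupp
  have hn : 0 ≤ 1 / (n : ℝ) := by positivity
  have hempty : ∀ f : Fin n → ℝ, ∑ i ∈ M.obs ω ∅, f i = 0 := by
    intro f
    have : M.obs ω ∅ = ∅ := by ext i; simp [mem_obs]
    rw [this, Finset.sum_empty]
  have hB₁ : ∀ j, 1 / (n : ℝ) *
      |∑ i ∈ M.obs ω (Set.Iic τi ∩ Set.Ioi t₀), ⟪M.x i ω, M.β₀ - M.γ₀⟫ * M.x i ω j| ≤ B := by
    intro j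
    have h0 := (mul_nonneg hn (abs_nonneg _)).trans (hB j)
    rcases le_total t₀ τi with h | h
    · rw [show Set.Iic τi ∩ Set.Ioi t₀ = Set.uIoc τi t₀ by
        rw [Set.uIoc_comm, Set.uIoc_of_le h]; ext; simp [and_comm]]
      exact hB j
    · rw [show Set.Iic τi ∩ Set.Ioi t₀ = ∅ by
        ext a; simp only [Set.mem_inter_iff, Set.mem_Iic, Set.mem_Ioi, Set.mem_empty_iff_false,
          iff_false, not_and, not_lt]; intro ha; linarith]
      simpa [hempty] using h0
  have hB₂ : ∀ j, 1 / (n : ℝ) *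
      |∑ i ∈ M.obs ω (Set.Ioi τi ∩ Set.Iic t₀), ⟪M.x i ω, M.β₀ - M.γ₀⟫ * M.x i ω j| ≤ B := by
    intro j
    have h0 := (mul_nonneg hn (abs_nonneg _)).trans (hB j)
    rcases le_total τi t₀ with h | h
    · rw [show Set.Ioi τi ∩ Set.Iic t₀ = Set.uIoc τi t₀ by
        rw [Set.uIoc_of_le h]; ext; simp]
      exact hB j
    · rw [show Set.Ioi τi ∩ Set.Iic t₀ = ∅ by
        ext a; simp only [Set.mem_inter_iff, Set.mem_Iic, Set.mem_Ioi, Set.mem_empty_iff_false,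
          iff_false, not_and, not_le]; intro ha; linarith]
      simpa [hempty] using h0
  constructor
  -- Observations to the left of `τi` but to the right of `t₀` follow `γ₀`. Relative to `β₀` their
  -- misfit is added to the error.
  · refine hE₁.error (e := fun i => M.ε i ω -
      if M.w i ω ∈ Set.Ioi t₀ then ⟪M.x i ω, M.β₀ - M.γ₀⟫ else 0) hκ hm hlam (fun i _ => ?_)
      (hest.left M.β₀) (fun j => ?_) hA₀ hβ
    · by_cases h : t₀ < M.w i ω
      · rw [y_of_lt (by rw [ht₀]; exact_mod_cast h), if_pos (show M.w i ω ∈ Set.Ioi t₀ from h),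
          inner_sub_right]
        ring
      · rw [y_of_le (by rw [ht₀]; exact_mod_cast not_lt.1 h),
          if_neg (show M.w i ω ∉ Set.Ioi t₀ from h), sub_zero]
    · simp only [sub_mul, ite_mul, zero_mul, Finset.sum_sub_distrib, sum_obs_ite]
      have h1 := mul_le_mul_of_nonneg_left (abs_sub
        (∑ i ∈ M.obs ω (Set.Iic τi), M.ε i ω * M.x i ω j)
        (∑ i ∈ M.obs ω (Set.Iic τi ∩ Set.Ioi t₀), ⟪M.x i ω, M.β₀ - M.γ₀⟫ * M.x i ω j)) hn
      have h2 := hE₁.noise j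
      rw [← hq] at h2
      have h3 := hB₁ j
      rw [mul_add] at h1
      linarith
  · refine hE₂.error (e := fun i => M.ε i ω +
      if M.w i ω ∈ Set.Iic t₀ then ⟪M.x i ω, M.β₀ - M.γ₀⟫ else 0) hκ hm hlam (fun i _ => ?_)
      (hest.right M.γ₀) (fun j => ?_) hA₀ hγ
    · by_cases h : M.w i ω ≤ t₀
      · rw [y_of_le (by rw [ht₀]; exact_mod_cast h), if_pos (show M.w i ω ∈ Set.Iic t₀ from h),
          inner_sub_right]
        ring
      · rw [y_of_lt (by rw [ht₀]; exact_mod_cast not_le.1 h),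
          if_neg (show M.w i ω ∉ Set.Iic t₀ from h), add_zero]
    · simp only [add_mul, ite_mul, zero_mul, Finset.sum_add_distrib, sum_obs_ite]
      have h1 := mul_le_mul_of_nonneg_left (abs_add_le
        (∑ i ∈ M.obs ω (Set.Ioi τi), M.ε i ω * M.x i ω j)
        (∑ i ∈ M.obs ω (Set.Ioi τi ∩ Set.Iic t₀), ⟪M.x i ω, M.β₀ - M.γ₀⟫ * M.x i ω j)) hn
      have h2 := hE₂.noise j
      rw [← hq] at h2
      have h3 := hB₂ j
      rw [mul_add] at h1
      linarith

/-- The excess loss over a segment on which the bounds of `SegmentBounds` hold. -/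
lemma SegmentBounds.loss_ge {s : ℕ} {u v q E : ℝ} {ω : Ω} {D : Set ℝ} {d D₁ D₂ : Vec p}
    (hS : M.SegmentBounds C κ s u v d ω D) (hn : 1 ≤ n) (hs : 1 ≤ s) (hu : 0 ≤ u)
    (hq : q = √(Real.log p / n)) (h₁ : l1Norm D₁ ≤ 4 * √s * ‖D₁‖)
    (h₂ : l1Norm D₂ ≤ 4 * √s * ‖D₂‖) (hE₁ : ‖D₁‖ ≤ E) (hE₂ : ‖D₂‖ ≤ E) :
    κ / 8 * v * ‖d‖ ^ 2 - 1000 * devConst C * E ^ 2 * max (s * Real.log p / n) u -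
        (8 * devConst C * ‖d‖ * q + 64 * devConst C * E * (√s * q)) * max q (√u) ≤
      1 / (n : ℝ) * ∑ i ∈ M.obs ω D,
        ((M.ε i ω - ⟪M.x i ω, d + D₁⟫) ^ 2 - (M.ε i ω - ⟪M.x i ω, D₂⟫) ^ 2) := by
  have hA := devConst_pos C
  have hn0 : (0 : ℝ) < n := by exact_mod_cast hn
  have hL := Real.log_natCast_nonneg p
  have hE : 0 ≤ E := (norm_nonneg _).trans hE₁
  have hq0 : 0 ≤ q := by rw [hq]; positivity
  have hq2 : n * q ^ 2 = Real.log p := by rw [hq, Real.sq_sqrt (by positivity)]; field_simp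
  set mx := max q (√u) with hmx
  have hmx0 : 0 ≤ mx := hq0.trans (le_max_left _ _)
  -- With `log p = n q²` and `u ≤ mx²`, the noise level over a segment of mass `u` is of order `n q
  -- max(q, √u)`.
  have hW : √((2 * (n * u) + 2 * Real.log p) * Real.log p) ≤ n * (2 * q * mx) := by
    rw [Real.sqrt_le_iff]
    refine ⟨by positivity, ?_⟩
    have h1 : q ^ 2 ≤ mx ^ 2 := pow_le_pow_left₀ hq0 (le_max_left _ _) 2
    have h2 : u ≤ mx ^ 2 := by
      rw [← Real.sq_sqrt hu]; exact pow_le_pow_left₀ (Real.sqrt_nonneg _) (le_max_right _ _) 2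
    calc (2 * (n * u) + 2 * Real.log p) * Real.log p = n ^ 2 * ((2 * u + 2 * q ^ 2) * q ^ 2) := by
          rw [← hq2]; ring
      _ ≤ n ^ 2 * ((2 * mx ^ 2 + 2 * mx ^ 2) * q ^ 2) := by gcongr
      _ = (n * (2 * q * mx)) ^ 2 := by ring
  set mu := max (s * Real.log p / n) u with hmu
  have hquad' : ∀ b : Vec p, l1Norm b ≤ 4 * √s * ‖b‖ → ‖b‖ ≤ E →
      ∑ i ∈ M.obs ω D, ⟪M.x i ω, b⟫ ^ 2 ≤ n * (500 * devConst C * E ^ 2 * mu) := by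
    intro b hb hbE
    have h0 : 0 ≤ l1Norm b / √s := div_nonneg (l1Norm_nonneg b) (Real.sqrt_nonneg _)
    have h5 : ‖b‖ + l1Norm b / √s ≤ 5 * E := (add_l1Norm_div_le hs hb).trans (by linarith)
    have h6 : 2 * (n * u) + 2 * (s * Real.log p) ≤ 4 * (n * mu) := by
      have e1 : n * u ≤ n * mu := by gcongr; exact le_max_right _ _
      have e2 : s * Real.log p ≤ n * mu := by
        rw [← div_le_iff₀' hn0]; exact le_max_left _ _
      linarith
    refine (hS.quadratic b).trans ?_
    calc 5 * devConst C * (2 * (n * u) + 2 * (s * Real.log p)) * (‖b‖ + l1Norm b / √s) ^ 2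
        ≤ 5 * devConst C * (4 * (n * mu)) * (5 * E) ^ 2 := by
          refine mul_le_mul (mul_le_mul_of_nonneg_left h6 (by positivity))
            (pow_le_pow_left₀ (by positivity) h5 2) (by positivity) ?_
          have : 0 ≤ mu := hu.trans (le_max_right _ _)
          positivity
      _ = n * (500 * devConst C * E ^ 2 * mu) := by ring
  have hV : ∀ j, |∑ i ∈ M.obs ω D, M.ε i ω * M.x i ω j| ≤
      2 * devConst C * (n * (2 * q * mx)) := fun j =>
    (hS.noise j).trans (mul_le_mul_of_nonneg_left hW (by positivity))
  have h3 := segment_loss_ge (J := M.obs ω D) (x := fun i => M.x i ω) (e := fun i => M.ε i ω)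
    (d := d) (D₁ := D₁) (D₂ := D₂) hV
  have h4 : l1Norm D₁ + l1Norm D₂ ≤ 8 * √s * E := by
    have e1 : 4 * √s * ‖D₁‖ ≤ 4 * √s * E := by gcongr
    have e2 : 4 * √s * ‖D₂‖ ≤ 4 * √s * E := by gcongr
    linarith
  have h5 : 2 * (2 * devConst C * (n * (2 * q * mx))) * (l1Norm D₁ + l1Norm D₂) ≤
      2 * (2 * devConst C * (n * (2 * q * mx))) * (8 * √s * E) := by gcongr
  have h6 := hquad' D₁ h₁ hE₁
  have h7 := hquad' D₂ h₂ hE₂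
  have h8 : |∑ i ∈ M.obs ω D, M.ε i ω * ⟪M.x i ω, d⟫| ≤
      2 * devConst C * (n * (2 * q * mx)) * ‖d‖ :=
    hS.noise_dir.trans (by gcongr)
  have h9 := hS.curvature
  rw [one_div, le_inv_mul_iff₀ hn0]
  refine le_trans ?_ h3
  linarith

/-- What is required, beyond `LargeSample`, of the sample size when there is a change. -/
structure LargeSampleChange (M : Model n p Ω) (s : ℕ) (B τi u₀ r : ℝ) : Prop where
  half_le : M.PhiMin M.τ₀ / 2 ≤ M.PhiMin τi
  log_div_le : Real.log p / n ≤ B * u₀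
  close : |M.Phi τi - M.Phi M.τ₀| ≤ u₀
  rate_le : r ≤ M.jump
  rate_eq : r = estRate M s u₀

/-- The constants of the lower bound with a finite change point. -/
noncomputable def crossConst (C : ℝ≥0) (κ L₁ cξ : ℝ) : ℝ :=
  (8 * devConst C + 64 * devConst C * (12 * L₁ / κ)) * max 1 (1 / cξ)

noncomputable def quadConst (C : ℝ≥0) (κ L₁ cξ : ℝ) : ℝ :=
  1000 * devConst C * (12 * L₁ / κ) ^ 2 * max 1 (1 / cξ ^ 2)

/-- A jump bounded below by `c` is comparable to its maximum with `1`. This converts factors of `ξ`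
into the normalization by `1 ∨ ξ`. -/
lemma one_le_max_mul_div {a b c : ℝ} (hc : 0 < c) (hcb : c ≤ b) (ha : a = b) :
    1 ≤ a / max 1 b * max 1 (1 / c) := by
  subst ha
  have ha : 0 < a := hc.trans_le hcb
  rcases le_total 1 a with h | h
  · rw [max_eq_right h, div_self ha.ne', one_mul]
    exact le_max_left _ _
  · rw [max_eq_left h, div_one]
    calc (1 : ℝ) ≤ a * (1 / c) := by rw [mul_one_div, one_le_div hc]; exact hcb
      _ ≤ a * max 1 (1 / c) := by gcongr; exact le_max_right _ _

/-- The form in which the lower bound is stated follows from the one that the analysis gives. -/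
lemma change_bound_arith {s : ℕ} {ξ cξ v L₁ q Q mx mu r μ F₀ : ℝ} (hκ : 0 < κ) (hL₁ : 0 < L₁)
    (hcξ : 0 < cξ) (hξ : cξ ≤ ξ) (hq : q ≤ Q) (hQ : 0 ≤ Q) (hQ2 : Q ^ 2 = s * Real.log p / n)
    (hmx : 0 ≤ mx) (hmu : 0 ≤ mu) (hrξ : r ≤ ξ) (hμ : 0 ≤ μ) (hF : 0 ≤ F₀) :
    ξ ^ 2 * (κ / 8 * v - 1 * (s * Real.log p / n) - crossConst C κ L₁ cξ / max 1 ξ * Q * mx -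
        quadConst C κ L₁ cξ * (r ^ 2 / max 1 (ξ ^ 2)) * mu -
        max 1 (1 / cξ ^ 2) * μ / max 1 (ξ ^ 2) * F₀) ≤
      κ / 8 * v * ξ ^ 2 - 1000 * devConst C * (12 * L₁ / κ * r) ^ 2 * mu -
        (8 * devConst C * ξ * q + 64 * devConst C * (12 * L₁ / κ * r) * Q) * mx - μ * F₀ := by
  have hA := devConst_pos C
  have hξ0 : 0 < ξ := hcξ.trans_le hξ
  have h1 := one_le_max_mul_div hcξ hξ rfl
  have h2 := one_le_max_mul_div (b := ξ ^ 2) (pow_pos hcξ 2) (pow_le_pow_left₀ hcξ.le hξ 2) rfl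
  have e0 : 0 ≤ ξ ^ 2 * (s * Real.log p / n) := by rw [← hQ2]; positivity
  -- In the cross term the rate `r` is replaced by `ξ`, which dominates it for large `n`. The error
  -- term then has the form of the noise in direction `d`.
  have e1 : (8 * devConst C * ξ * q + 64 * devConst C * (12 * L₁ / κ * r) * Q) * mx ≤
      ξ ^ 2 * (crossConst C κ L₁ cξ / max 1 ξ * Q * mx) := by
    have h3 : (8 * devConst C * ξ * q + 64 * devConst C * (12 * L₁ / κ * r) * Q) * mx ≤
        (8 * devConst C * ξ * Q + 64 * devConst C * (12 * L₁ / κ * ξ) * Q) * mx := by gcongr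
    have h4 : (8 * devConst C * ξ * Q + 64 * devConst C * (12 * L₁ / κ * ξ) * Q) * mx =
        ξ * ((8 * devConst C + 64 * devConst C * (12 * L₁ / κ)) * Q * mx) * 1 := by ring
    have h5 : ξ ^ 2 * (crossConst C κ L₁ cξ / max 1 ξ * Q * mx) =
        ξ * ((8 * devConst C + 64 * devConst C * (12 * L₁ / κ)) * Q * mx) *
          (ξ / max 1 ξ * max 1 (1 / cξ)) := by
      unfold crossConst; ring
    rw [h5]
    refine h3.trans (h4.trans_le ?_)
    gcongr
  have e2 : 1000 * devConst C * (12 * L₁ / κ * r) ^ 2 * mu ≤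
      ξ ^ 2 * (quadConst C κ L₁ cξ * (r ^ 2 / max 1 (ξ ^ 2)) * mu) := by
    have h5 : ξ ^ 2 * (quadConst C κ L₁ cξ * (r ^ 2 / max 1 (ξ ^ 2)) * mu) =
        (1000 * devConst C * (12 * L₁ / κ * r) ^ 2 * mu) *
          (ξ ^ 2 / max 1 (ξ ^ 2) * max 1 (1 / cξ ^ 2)) := by
      unfold quadConst; ring
    rw [h5]
    exact le_mul_of_one_le_right (by positivity) h2
  have e3 : μ * F₀ ≤ ξ ^ 2 * (max 1 (1 / cξ ^ 2) * μ / max 1 (ξ ^ 2) * F₀) := by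
    have h5 : ξ ^ 2 * (max 1 (1 / cξ ^ 2) * μ / max 1 (ξ ^ 2) * F₀) =
        (μ * F₀) * (ξ ^ 2 / max 1 (ξ ^ 2) * max 1 (1 / cξ ^ 2)) := by ring
    rw [h5]
    exact le_mul_of_one_le_right (by positivity) h2
  linarith

end Model

namespace Model

variable {n p : ℕ} {Ω : Type*} {M : Model n p Ω} {C : ℝ≥0} {κ φ : ℝ}

/-- The segment bounds to the right of the change point control the criterion there. -/
lemma R_ge_right {s : ℕ} {u v q E t₀ τ : ℝ} {ω : Ω} {b g : Vec p} (ht₀ : M.τ₀ = (t₀ : WithBot ℝ))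
    (hτ : t₀ ≤ τ) (hS : M.SegmentBounds C κ s u v (M.β₀ - M.γ₀) ω (Set.Ioc t₀ τ)) (hn : 1 ≤ n)
    (hs : 1 ≤ s) (hu : 0 ≤ u) (hq : q = √(Real.log p / n))
    (h₁ : l1Norm (b - M.β₀) ≤ 4 * √s * ‖b - M.β₀‖) (h₂ : l1Norm (g - M.γ₀) ≤ 4 * √s * ‖g - M.γ₀‖)
    (hE₁ : ‖b - M.β₀‖ ≤ E) (hE₂ : ‖g - M.γ₀‖ ≤ E) :
    κ / 8 * v * M.jump ^ 2 - 1000 * devConst C * E ^ 2 * max (s * Real.log p / n) u -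
        (8 * devConst C * M.jump * q + 64 * devConst C * E * (√s * q)) * max q (√u) ≤
      M.R ω (τ : ℝ) b g := by
  have hset : {a : ℝ | M.τ₀ < (a : WithBot ℝ) ∧ (a : WithBot ℝ) ≤ (τ : WithBot ℝ)} =
      Set.Ioc t₀ τ := by
    ext a; simp [ht₀, Set.mem_Ioc]
  rw [R_of_le (by rw [ht₀]; exact_mod_cast hτ), hset]
  refine (hS.loss_ge hn hs hu hq h₁ h₂ hE₁ hE₂).trans (le_of_eq ?_)
  congr 1
  refine Finset.sum_congr rfl fun i hi => ?_
  rw [mem_obs] at hi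
  rw [y_of_lt (by rw [ht₀]; exact_mod_cast hi.1)]
  simp only [inner_add_right, inner_sub_right]
  ring

/-- The segment bounds to the left of the change point control the criterion there. -/
lemma R_ge_left {s : ℕ} {u v q E t₀ τ : ℝ} {ω : Ω} {b g : Vec p} (ht₀ : M.τ₀ = (t₀ : WithBot ℝ))
    (hτ : τ ≤ t₀) (hS : M.SegmentBounds C κ s u v (M.γ₀ - M.β₀) ω (Set.Ioc τ t₀)) (hn : 1 ≤ n)
    (hs : 1 ≤ s) (hu : 0 ≤ u) (hq : q = √(Real.log p / n))
    (h₁ : l1Norm (b - M.β₀) ≤ 4 * √s * ‖b - M.β₀‖) (h₂ : l1Norm (g - M.γ₀) ≤ 4 * √s * ‖g - M.γ₀‖)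
    (hE₁ : ‖b - M.β₀‖ ≤ E) (hE₂ : ‖g - M.γ₀‖ ≤ E) :
    κ / 8 * v * M.jump ^ 2 - 1000 * devConst C * E ^ 2 * max (s * Real.log p / n) u -
        (8 * devConst C * M.jump * q + 64 * devConst C * E * (√s * q)) * max q (√u) ≤
      M.R ω (τ : ℝ) b g := by
  have hset : {a : ℝ | (τ : WithBot ℝ) < (a : WithBot ℝ) ∧ (a : WithBot ℝ) ≤ M.τ₀} =
      Set.Ioc τ t₀ := by
    ext a; simp [ht₀, Set.mem_Ioc]
  -- To the left of `t₀` the data follow `β₀` while the wrong fit uses `g`; hence `d = γ₀ - β₀` and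
  -- the two errors are exchanged.
  rw [R_of_ge (by rw [ht₀]; exact_mod_cast hτ), hset, jump, norm_sub_rev]
  refine (hS.loss_ge hn hs hu hq h₂ h₁ hE₂ hE₁).trans (le_of_eq ?_)
  congr 1
  refine Finset.sum_congr rfl fun i hi => ?_
  rw [mem_obs] at hi
  rw [y_of_le (by rw [ht₀]; exact_mod_cast hi.2)]
  simp only [inner_add_right, inner_sub_right]
  ring

/-- The penalty changes by at most `μ`, and only when `Φ(τ₀) ≤ u`. -/
lemma S_ge [IsProbabilityMeasure M.wLaw] {μ u v F₀ τ : ℝ} {ω : Ω} {b g : Vec p} (hμ : 0 ≤ μ)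
    (hF : 0 ≤ F₀) (hFu : F₀ = 1 ∨ u < M.PhiMin M.τ₀) (hpos : 0 < M.PhiMin M.τ₀)
    (hτ : τ ∈ M.H u v) : M.R ω (τ : ℝ) b g - μ * F₀ ≤ M.S μ ω (τ : ℝ) b g := by
  have h0 : M.PhiMin M.τ₀ ≤ M.Phi M.τ₀ := min_le_left _ _
  have hne : M.Phi M.τ₀ ≠ 0 := by linarith
  simp only [S, l0Norm, hne, if_false]
  have hμF := mul_nonneg hμ hF
  split_ifs with hz
  · rcases hFu with rfl | hu
    · linarith
    · have := hτ.2
      rw [hz, zero_sub, abs_neg, abs_of_nonneg (M.Phi_nonneg _)] at this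
      linarith
  · linarith

namespace DistributionAssumptions

variable [MeasurableSpace Ω] {P : Measure Ω} [IsProbabilityMeasure P]

/-- The bias of the initial estimates that stems from the observations between the initializer and
the change point. -/
lemma contamination_le (h : M.DistributionAssumptions P C κ φ) (hn : 1 ≤ n) (hp : 1 ≤ p)
    {τi t₀ u₀ B : ℝ} (ht₀ : M.τ₀ = (t₀ : WithBot ℝ))
    (hclose : |M.Phi τi - M.Phi M.τ₀| ≤ u₀) (hB : Real.log p / n ≤ B * u₀) (hξ : 0 < M.jump) :
    HoldsExcept P (fun ω => ∀ j, 1 / (n : ℝ) *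
        |∑ i ∈ M.obs ω (Set.uIoc τi t₀), ⟪M.x i ω, M.β₀ - M.γ₀⟫ * M.x i ω j| ≤
      4 * devConst C * (1 + B) * (M.jump * u₀)) (3 * Real.exp (-Real.log p)) := by
  have := h.isProbabilityMeasure_wLaw hn
  have hA := devConst_pos C
  have hn0 : (0 : ℝ) < n := by exact_mod_cast hn
  have hI : MeasurableSet (Set.uIoc τi t₀) := measurableSet_uIoc
  have hq : M.wLaw.real (Set.uIoc τi t₀) ≤ u₀ := by
    rw [ht₀] at hclose
    rcases le_total τi t₀ with hle | hle
    · rw [Set.uIoc_of_le hle, M.measureReal_Ioc hle]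
      exact (le_abs_self _).trans (by rwa [abs_sub_comm])
    · rw [Set.uIoc_comm, Set.uIoc_of_le hle, M.measureReal_Ioc hle]
      exact (le_abs_self _).trans hclose
  have hu : ‖M.jump⁻¹ • (M.β₀ - M.γ₀)‖ ≤ 1 := by
    rw [norm_smul, norm_inv, Real.norm_of_nonneg hξ.le, ← jump, inv_mul_cancel₀ hξ.ne']
  refine ((h.gram_coord_le hp hI hu).and (h.count_le hI hq (Real.log p)) (by positivity)
    (by positivity)).mono ?_ (by linarith)
  rintro ω ⟨h1, h2⟩ j
  have h3 := h1 j
  have h4 : ∑ i ∈ M.obs ω (Set.uIoc τi t₀), ⟪M.x i ω, M.β₀ - M.γ₀⟫ * M.x i ω j =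
      M.jump * ∑ i ∈ M.obs ω (Set.uIoc τi t₀),
        ⟪M.x i ω, M.jump⁻¹ • (M.β₀ - M.γ₀)⟫ * M.x i ω j := by
    rw [Finset.mul_sum]
    refine Finset.sum_congr rfl fun i _ => ?_
    rw [inner_smul_right]
    field_simp
  rw [h4, abs_mul, abs_of_pos hξ, one_div, inv_mul_le_iff₀ hn0]
  rw [div_le_iff₀ hn0] at hB
  calc M.jump * |∑ i ∈ M.obs ω (Set.uIoc τi t₀),
        ⟪M.x i ω, M.jump⁻¹ • (M.β₀ - M.γ₀)⟫ * M.x i ω j|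
      ≤ M.jump * (2 * devConst C * (2 * (n * u₀) + 2 * (B * u₀ * n))) := by
        refine mul_le_mul_of_nonneg_left (h3.trans ?_) hξ.le
        refine mul_le_mul_of_nonneg_left ?_ (by positivity)
        linarith
    _ = _ := by ring

/-- The lower bound for the criterion when there is a change point. -/
lemma change_bound (h : M.DistributionAssumptions P C κ φ) (hκ : 0 < κ) {s : ℕ}
    {τi t₀ lam L₁ μ u v u₀ r B cξ cv F₀ : ℝ} {bhat ghat : Ω → Vec p}
    (hl : LargeSample n p s C κ (M.PhiMin τi)) (hlc : LargeSampleChange M s B τi u₀ r)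
    (ht₀ : M.τ₀ = (t₀ : WithBot ℝ)) (hpos : 0 < M.PhiMin M.τ₀)
    (hsupp : M.support.ncard ≤ s) (hL₁ : 0 < L₁) (hB : 0 ≤ B) (hcξ : 0 < cξ) (hξ : cξ ≤ M.jump)
    (hlo : 8 * devConst C * (3 + 2 * B) * max (√(Real.log p / n)) (M.jump * u₀) ≤ lam)
    (hhi : lam ≤ L₁ * max (√(Real.log p / n)) (M.jump * u₀))
    (hest : ∀ ω, M.IsInitialEstimate lam τi ω (bhat ω) (ghat ω)) (hμ : 0 ≤ μ) (hu : 0 ≤ u)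
    (hcv : 0 < cv) (hv : cv * (Real.log p / n) ≤ v) (hF : 0 ≤ F₀)
    (hFu : F₀ = 1 ∨ u < M.PhiMin M.τ₀) :
    HoldsExcept P (fun ω => ∀ τ ∈ M.H u v,
      M.jump ^ 2 * (κ / 8 * v - 1 * (s * Real.log p / n) -
        crossConst C κ L₁ cξ / max 1 M.jump * √(s * Real.log p / n) *
          max (√(Real.log p / n)) (√u) -
        quadConst C κ L₁ cξ * (r ^ 2 / max 1 (M.jump ^ 2)) * max (s * Real.log p / n) u -
        max 1 (1 / cξ ^ 2) * μ / max 1 (M.jump ^ 2) * F₀) ≤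
          M.S μ ω (τ : ℝ) (bhat ω) (ghat ω))
      (33 * Real.exp (-segmentRate C κ cv * Real.log p)) := by
  have := h.isProbabilityMeasure_wLaw hl.one_le_n
  have hL := Real.log_natCast_nonneg p
  have hA := devConst_pos C
  have hn : (0 : ℝ) < n := by exact_mod_cast hl.one_le_n
  have hp : 1 ≤ p := le_trans (by norm_num) hl.two_le_p
  have hξ0 : 0 < M.jump := hcξ.trans_le hξ
  have hs1 : (1 : ℝ) ≤ s := by exact_mod_cast hl.one_le_s
  have hm : 0 < M.PhiMin τi := by linarith [hlc.half_le]
  have hu₀ : 0 ≤ u₀ := (abs_nonneg _).trans hlc.close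
  set m := M.PhiMin τi with hmdef
  set q := √(Real.log p / n) with hq
  have hq0 : 0 < q := log_div_pos hl
  set ρ := max q (M.jump * u₀) with hρ
  have hρ0 : 0 < ρ := hq0.trans_le (le_max_left _ _)
  have hlam : 0 < lam := lt_of_lt_of_le (by positivity) hlo
  have hI₁ : m ≤ M.wLaw.real (Set.Iic τi) := by rw [← Phi_coe]; exact min_le_left _ _
  have hI₂ : m ≤ M.wLaw.real (Set.Ioi τi) := by rw [← one_sub_Phi_coe]; exact min_le_right _ _
  have hd : M.β₀ - M.γ₀ ≠ 0 := by rw [← norm_pos_iff]; exact hξ0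
  have hv0 : 0 ≤ v := le_trans (by positivity) hv
  have hvL : cv * Real.log p ≤ n * v := by
    calc cv * Real.log p = n * (cv * (Real.log p / n)) := by field_simp
      _ ≤ n * v := by gcongr
  set Q := √(s * Real.log p / n) with hQ
  have hQsq : Q = √s * q := by
    rw [hQ, hq, mul_div_assoc, Real.sqrt_mul (by positivity)]
  have hΦ : ∀ {a b : ℝ}, a ≤ b → M.Phi a ≤ M.Phi b := fun hab =>
    M.Phi_mono (WithBot.coe_le_coe.2 hab)
  have hright : ∀ τ ∈ {τ ∈ M.H u v | t₀ ≤ τ}, M.wLaw.real (Set.Ioc t₀ τ) =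
      |M.Phi τ - M.Phi M.τ₀| := by
    rintro τ ⟨-, hτ⟩
    rw [M.measureReal_Ioc hτ, ht₀, abs_of_nonneg (sub_nonneg.2 (hΦ hτ))]
  have hleft : ∀ τ ∈ {τ ∈ M.H u v | τ ≤ t₀}, M.wLaw.real (Set.Ioc τ t₀) =
      |M.Phi τ - M.Phi M.τ₀| := by
    rintro τ ⟨-, hτ⟩
    rw [M.measureReal_Ioc hτ, ht₀, abs_sub_comm, abs_of_nonneg (sub_nonneg.2 (hΦ hτ))]
  have hsr := h.segmentBounds hκ hl.two_le_p hl.one_le_s (Or.inl rfl) hcv (u := u) (v := v)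
    (fun τ hτ => (hright τ hτ).trans_le hτ.1.2)
    (fun τ hτ => hτ.1.1.trans_eq (hright τ hτ).symm) hvL hv0 hd
  have hsl := h.segmentBounds hκ hl.two_le_p hl.one_le_s (Or.inr rfl) hcv (u := u) (v := v)
    (fun τ hτ => (hleft τ hτ).trans_le hτ.1.2)
    (fun τ hτ => hτ.1.1.trans_eq (hleft τ hτ).symm) hvL hv0 (d := M.γ₀ - M.β₀)
    (by rw [← neg_sub]; exact neg_ne_zero.2 hd)
  refine (((((h.estimationBounds hκ hl measurableSet_Iic hm.le hI₁).and
    (h.estimationBounds hκ hl measurableSet_Ioi hm.le hI₂) (by positivity) (by positivity)).and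
    (h.contamination_le hl.one_le_n hp ht₀ hlc.close hlc.log_div_le hξ0) (by positivity)
    (by positivity)).and hsr (by positivity) (by positivity)).and hsl (by positivity)
    (by positivity)).mono ?_ ?_
  · rintro ω ⟨⟨⟨⟨hE₁, hE₂⟩, hcont⟩, hr⟩, hl'⟩ τ hτ
    -- Noise and contamination together need `lam / 4 ≥ (6 + 4 B) devConst C ρ`, which is where the
    -- lower bound required of `lam` comes from.
    have hlamB : 2 * devConst C * q + 4 * devConst C * (1 + B) * (M.jump * u₀) ≤ lam / 4 := by
      have e1 : 2 * devConst C * q ≤ 2 * devConst C * ρ := by gcongr; exact le_max_left _ _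
      have e2 : 4 * devConst C * (1 + B) * (M.jump * u₀) ≤ 4 * devConst C * (1 + B) * ρ := by
        gcongr; exact le_max_right _ _
      linarith
    obtain ⟨⟨hb1, hb2⟩, hg1, hg2⟩ := change_error hκ hm hlam ht₀ hsupp hE₁ hE₂ hq hcont hlamB
      (hest ω)
    -- The rate `r` is the Lasso rate `√s ρ` divided by the curvature factor `Φ_min(τ₀)`. Replacing
    -- `Φ_min(τ₀)` by `Φ_min(τi)` costs a factor `2`.
    have hr_eq : √s * ρ = M.PhiMin M.τ₀ * r := by
      rw [hlc.rate_eq, estRate, mul_div_cancel₀ _ hpos.ne', hρ, ← hQ, hQsq,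
        mul_max_of_nonneg _ _ (Real.sqrt_nonneg _), mul_assoc]
    have hr0 : 0 ≤ r := by
      have : 0 ≤ M.PhiMin M.τ₀ * r := by rw [← hr_eq]; positivity
      exact nonneg_of_mul_nonneg_right this hpos
    have hEle : 6 * (lam * √s) / (κ * m) ≤ 12 * L₁ / κ * r := by
      rw [div_le_iff₀ (by positivity)]
      calc 6 * (lam * √s) ≤ 6 * (L₁ * ρ * √s) := by gcongr
        _ = 6 * L₁ * (√s * ρ) := by ring
        _ = 12 * L₁ * r * (M.PhiMin M.τ₀ / 2) := by rw [hr_eq]; ring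
        _ ≤ 12 * L₁ * r * m := by gcongr; exact hlc.half_le
        _ = 12 * L₁ / κ * r * (κ * m) := by field_simp
    have hR : κ / 8 * v * M.jump ^ 2 - 1000 * devConst C * (12 * L₁ / κ * r) ^ 2 *
          max (s * Real.log p / n) u - (8 * devConst C * M.jump * q +
          64 * devConst C * (12 * L₁ / κ * r) * (√s * q)) * max q (√u) ≤
        M.R ω (τ : ℝ) (bhat ω) (ghat ω) := by
      rcases le_total t₀ τ with hle | hle
      · exact R_ge_right ht₀ hle (hr τ ⟨hτ, hle⟩) hl.one_le_n hl.one_le_s hu hq hb1 hg1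
          (hb2.trans hEle) (hg2.trans hEle)
      · exact R_ge_left ht₀ hle (hl' τ ⟨hτ, hle⟩) hl.one_le_n hl.one_le_s hu hq hb1 hg1
          (hb2.trans hEle) (hg2.trans hEle)
    have hqQ : q ≤ Q := by
      rw [hQsq]
      exact le_mul_of_one_le_left hq0.le (Real.one_le_sqrt.2 hs1)
    have hfin := change_bound_arith (C := C) (v := v) (mx := max q (√u))
      (mu := max (s * Real.log p / n) u) (r := r) (μ := μ) (F₀ := F₀) hκ hL₁ hcξ hξ hqQ
      (Real.sqrt_nonneg _) (Real.sq_sqrt (by positivity)) (le_max_of_le_left hq0.le)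
      (le_max_of_le_right hu) hlc.rate_le hμ hF
    rw [← hQsq] at hR
    have := S_ge (ω := ω) (b := bhat ω) (g := ghat ω) hμ hF hFu hpos hτ
    linarith
  · have : Real.exp (-Real.log p) ≤ Real.exp (-segmentRate C κ cv * Real.log p) := by
      rw [Real.exp_le_exp]
      have : segmentRate C κ cv ≤ 1 := min_le_left _ _
      nlinarith
    linarith

end DistributionAssumptions

end Model

/-! ### Thresholds for the sample size and degenerate cases -/

/-- Every requirement reduces to smallness of `a = s log p / (n l²)`, since `s log p = a n l²` and
`m ≥ cI l`. The last one holds because the square root is at most `√(2 a) n l`. -/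
lemma exists_largeSample (C : ℝ≥0) {κ cI : ℝ} (hκ : 0 < κ) (hcI : 0 < cI) :
    ∃ δ > (0 : ℝ), ∀ {n p s : ℕ} {l m : ℝ}, 1 ≤ n → 2 ≤ p → 1 ≤ s → 0 < l → l ≤ 1 / 2 →
      cI * l ≤ m → s * Real.log p / (n * l ^ 2) ≤ δ → Model.LargeSample n p s C κ m := by
  have hA := Model.devConst_pos C
  refine ⟨min 1 (min (cI / 5) ((κ * cI / (400 * Model.devConst C)) ^ 2 / 2)), by positivity, ?_⟩
  intro n p s l m hn hp hs hl hl2 hm hδ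
  have hn0 : (0 : ℝ) < n := by exact_mod_cast hn
  have hs1 : (1 : ℝ) ≤ s := by exact_mod_cast hs
  have hL := Real.log_natCast_nonneg p
  set a := s * Real.log p / (n * l ^ 2) with ha
  have ha0 : 0 ≤ a := by positivity
  have h1 : a ≤ 1 := hδ.trans (min_le_left _ _)
  have h2 : a ≤ cI / 5 := hδ.trans ((min_le_right _ _).trans (min_le_left _ _))
  have h3 : a ≤ (κ * cI / (400 * Model.devConst C)) ^ 2 / 2 :=
    hδ.trans ((min_le_right _ _).trans (min_le_right _ _))
  have hsL : s * Real.log p = a * (n * l ^ 2) := by rw [ha]; field_simp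
  have hl1 : l ^ 2 ≤ 1 := by nlinarith
  have hle : s * Real.log p ≤ n := by
    rw [hsL]
    calc a * (n * l ^ 2) ≤ 1 * (n * 1) := by gcongr
      _ = n := by ring
  refine ⟨hn, hp, hs, hle, ?_, ?_⟩
  · calc 10 * Real.log p ≤ 10 * (s * Real.log p) := by
          gcongr; exact le_mul_of_one_le_left hL hs1
      _ = 10 * a * l * (n * l) := by rw [hsL]; ring
      _ ≤ 10 * (cI / 5) * (1 / 2) * (n * l) := by gcongr
      _ = n * (cI * l) := by ring
      _ ≤ n * m := by gcongr
  · have h4 : √((n + s * Real.log p) * (s * Real.log p)) ≤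
        κ * cI / (400 * Model.devConst C) * (n * l) := by
      rw [Real.sqrt_le_iff]
      refine ⟨by positivity, ?_⟩
      calc (n + s * Real.log p) * (s * Real.log p) ≤ (n + n) * (s * Real.log p) := by gcongr
        _ = 2 * a * (n * l) ^ 2 := by rw [hsL]; ring
        _ ≤ (κ * cI / (400 * Model.devConst C)) ^ 2 * (n * l) ^ 2 := by gcongr; linarith
        _ = _ := by ring
    calc 100 * Model.devConst C * √((n + s * Real.log p) * (s * Real.log p))
        ≤ 100 * Model.devConst C * (κ * cI / (400 * Model.devConst C) * (n * l)) := by gcongr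
      _ = κ / 4 * (n * (cI * l)) := by field_simp; norm_num
      _ ≤ κ / 4 * (n * m) := by gcongr

lemma Model.abs_PhiMin_sub_le {n p : ℕ} {Ω : Type*} (M : Model n p Ω) (τ τ' : WithBot ℝ) :
    |M.PhiMin τ - M.PhiMin τ'| ≤ |M.Phi τ - M.Phi τ'| := by
  refine (abs_min_sub_min_le_max _ _ _ _).trans (max_le le_rfl (le_of_eq ?_))
  rw [abs_sub_comm]
  congr 1
  ring

lemma initRadius_nonneg {cu k l : ℝ} (hcu : 0 ≤ cu) (n p s : ℕ) : 0 ≤ initRadius cu k n p s l := by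
  have := Real.log_natCast_nonneg p
  unfold initRadius
  positivity

/-- The second smallness condition yields `s u₀ ≤ cl l²`, which is at most half of `Φ_min(τ₀)`. This
keeps the initial value away from the boundary and makes `√s ξ u₀ ≤ ξ Φ_min(τ₀)`; the other part of
`r ≤ ξ` follows from `s log p / n = a l²`. -/
lemma exists_largeSampleChange {cu cl cξ : ℝ} (hcu : 0 < cu) (hcl : 0 < cl) (hcξ : 0 < cξ) :
    ∃ δ > (0 : ℝ), ∀ {n p s : ℕ} {Ω : Type*} {M : Model n p Ω} {k l τi : ℝ}, 1 ≤ n → 1 ≤ s →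
      0 < l → l ≤ 1 / 2 → 1 ≤ k → cl * l ≤ M.PhiMin M.τ₀ → cξ < M.jump →
      |M.Phi τi - M.Phi M.τ₀| ≤ initRadius cu k n p s l → s * Real.log p / (n * l ^ 2) ≤ δ →
      s / l ^ 2 * (s * Real.log p / (n * l ^ 2)) ^ (1 / k) ≤ δ →
      Model.LargeSampleChange M s (1 / min 1 cu) τi (initRadius cu k n p s l)
        (estRate M s (initRadius cu k n p s l)) := by
  refine ⟨min 1 (min ((cξ * cl) ^ 2) (cl / cu)), by positivity, ?_⟩
  intro n p s Ω M k l τi hn hs hl hl2 hk hcll hξ hclose hδ hδ'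
  have hn0 : (0 : ℝ) < n := by exact_mod_cast hn
  have hs1 : (1 : ℝ) ≤ s := by exact_mod_cast hs
  have hL := Real.log_natCast_nonneg p
  have hu0 := initRadius_nonneg (k := k) (l := l) hcu.le n p s
  set u₀ := initRadius cu k n p s l with hu₀
  set a := s * Real.log p / (n * l ^ 2) with ha
  have ha0 : 0 ≤ a := by positivity
  have h1 : a ≤ 1 := hδ.trans (min_le_left _ _)
  have h2 : a ≤ (cξ * cl) ^ 2 := hδ.trans ((min_le_right _ _).trans (min_le_left _ _))
  have h3 : s / l ^ 2 * a ^ (1 / k) ≤ cl / cu :=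
    hδ'.trans ((min_le_right _ _).trans (min_le_right _ _))
  have hsu : s * u₀ ≤ cl * l ^ 2 := by
    calc s * u₀ ≤ s * (cu * a ^ (1 / k)) := by gcongr; exact min_le_right _ _
      _ = cu * (s / l ^ 2 * a ^ (1 / k)) * l ^ 2 := by field_simp
      _ ≤ cu * (cl / cu) * l ^ 2 := by gcongr
      _ = cl * l ^ 2 := by field_simp
  have hu_le : u₀ ≤ s * u₀ := le_mul_of_one_le_left hu0 hs1
  have hl3 : cl * l ^ 2 ≤ cl * l / 2 := by nlinarith [mul_pos hcl hl]
  have hpos : 0 < M.PhiMin M.τ₀ := lt_of_lt_of_le (by positivity) hcll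
  have hξ0 : 0 < M.jump := hcξ.trans hξ
  refine ⟨?_, ?_, hclose, ?_, rfl⟩
  · have := (abs_le.1 ((M.abs_PhiMin_sub_le τi M.τ₀).trans hclose)).1
    linarith
  · have e1 : Real.log p / n ≤ a := by
      rw [ha, div_le_div_iff₀ hn0 (by positivity)]
      have e3 : l ^ 2 ≤ s := by nlinarith
      calc Real.log p * (n * l ^ 2) ≤ Real.log p * (n * s) := by gcongr
        _ = _ := by ring
    have e2 : min 1 cu * a ≤ u₀ := by
      rw [hu₀, initRadius, ← ha]
      refine le_min ?_ ?_
      · calc min 1 cu * a ≤ 1 * 1 := by gcongr; exact min_le_left _ _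
          _ = 1 := one_mul 1
      -- For `a ≤ 1` and `k ≥ 1` the radius dominates a multiple of `a`, hence of `log p / n`. So
      -- the logarithmic fluctuation in the count of contaminated observations is absorbed.
      · have : a ≤ a ^ (1 / k) := by
          rcases ha0.eq_or_lt with h0 | h0
          · rw [← h0]; exact Real.rpow_nonneg le_rfl _
          · calc a = a ^ (1 : ℝ) := (Real.rpow_one a).symm
              _ ≤ a ^ (1 / k) := Real.rpow_le_rpow_of_exponent_ge h0 h1
                ((div_le_one (by linarith)).2 hk)
        exact mul_le_mul (min_le_right _ _) this ha0 hcu.le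
    rw [one_div, le_inv_mul_iff₀ (by positivity)]
    exact (mul_le_mul_of_nonneg_left e1 (by positivity)).trans e2
  · rw [estRate, div_le_iff₀ hpos]
    refine max_le ?_ ?_
    · have e1 : √(s * Real.log p / n) ≤ cξ * (cl * l) := by
        rw [Real.sqrt_le_iff]
        refine ⟨by positivity, ?_⟩
        calc s * Real.log p / n = a * l ^ 2 := by rw [ha]; field_simp
          _ ≤ (cξ * cl) ^ 2 * l ^ 2 := by gcongr
          _ = _ := by ring
      exact e1.trans (mul_le_mul hξ.le hcll (by positivity) hξ0.le)
    · have e1 : √(s : ℝ) ≤ s := by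
        rw [Real.sqrt_le_iff]
        exact ⟨by positivity, by nlinarith⟩
      calc √s * M.jump * u₀ ≤ s * M.jump * u₀ := by gcongr
        _ = M.jump * (s * u₀) := by ring
        _ ≤ M.jump * M.PhiMin M.τ₀ := by
          gcongr
          have := mul_pos hcl hl
          linarith

lemma HoldsExcept.le_iInf {Ω : Type*} [MeasurableSpace Ω] {P : Measure Ω} {T : Set ℝ} {a δ : ℝ}
    {f : Ω → ℝ → ℝ} (h : HoldsExcept P (fun ω => ∀ τ ∈ T, a ≤ f ω τ) δ) :
    HoldsExcept P (fun ω => (a : EReal) ≤ ⨅ τ ∈ T, (f ω τ : EReal)) δ :=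
  h.mono (fun _ hω => le_iInf₂ fun τ hτ => EReal.coe_le_coe_iff.2 (hω τ hτ)) le_rfl

lemma holdsExcept_of_one_le {Ω : Type*} [MeasurableSpace Ω] {P : Measure Ω} [IsProbabilityMeasure P]
    {G : Ω → Prop} {δ : ℝ} (h : 1 ≤ δ) : HoldsExcept P G δ :=
  prob_le_one.trans (by simpa using ENNReal.ofReal_le_ofReal h)

lemma log_natCast_eq_zero_of_le_one {p : ℕ} (hp : p ≤ 1) : Real.log p = 0 := by
  interval_cases p <;> simp

lemma Model.exists_coe_eq_of_PhiMin_pos {n p : ℕ} {Ω : Type*} (M : Model n p Ω) {τ : WithBot ℝ}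
    (h : 0 < M.PhiMin τ) : ∃ t : ℝ, τ = t := by
  induction τ with
  | bot => simp [PhiMin, Phi] at h
  | coe t => exact ⟨t, rfl⟩

lemma Model.crossConst_pos {C : ℝ≥0} {κ L₁ cξ : ℝ} (hκ : 0 < κ) (hL₁ : 0 < L₁) :
    0 < crossConst C κ L₁ cξ := by
  have := devConst_pos C
  unfold crossConst
  positivity

lemma Model.quadConst_pos {C : ℝ≥0} {κ L₁ cξ : ℝ} (hκ : 0 < κ) (hL₁ : 0 < L₁) :
    0 < quadConst C κ L₁ cξ := by
  have := devConst_pos C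
  unfold quadConst
  positivity

end ChangePoint

/-! ### Assembly of the two cases -/

theorem lemmal5 :
    -- no change
    (∀ (C : ℝ≥0) (κ φ cI : ℝ), 0 < κ → 0 < cI →
      ∃ L₀ > (0 : ℝ), ∀ L₁ ≥ L₀, ∃ c > (0 : ℝ), ∃ c₁ > (0 : ℝ), ∃ c₂ > (0 : ℝ),
      ∀ (Ω : ℕ → Type*) [∀ n, MeasurableSpace (Ω n)]
        (P : ∀ n, Measure (Ω n)) [∀ n, IsProbabilityMeasure (P n)]
        (p s : ℕ → ℕ) (M : ∀ n, ChangePoint.Model n (p n) (Ω n))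
        (l τi lam μ v : ℕ → ℝ) (βhat γhat : ∀ n, Ω n → ChangePoint.Vec (p n)),
        ChangePoint.BasicAssumptions P M s l τi C κ φ cI →
        (∀ n ≥ 1, (M n).Phi (M n).τ₀ = 0) →
        (∀ n ≥ 1, L₀ * √(Real.log (p n) / n) ≤ lam n ∧ lam n ≤ L₁ * √(Real.log (p n) / n)) →
        (∀ n ≥ 1, ∀ ω, (M n).IsInitialEstimate (lam n) (τi n) ω (βhat n ω) (γhat n ω)) →
        (∀ n ≥ 1, 0 < μ n) →
        (∀ n ≥ 1, 0 < v n) →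
        ∀ᶠ n : ℕ in atTop,
          P n {ω | ¬ (((μ n - c * (s n * Real.log (p n) / (n * (M n).PhiMin (τi n) ^ 2)) : ℝ) :
                EReal) ≤
              ⨅ τ ∈ (M n).H 1 (v n), (((M n).S (μ n) ω (τ : ℝ) (βhat n ω) (γhat n ω) : ℝ) : EReal))}
            ≤ ENNReal.ofReal (c₁ * Real.exp (-c₂ * Real.log (p n)))) ∧
    -- finite change point
    (∀ cξ : ℝ, 0 < cξ → ∃ cμ > (0 : ℝ),
      ∀ (C : ℝ≥0) (κ φ cI cu cl cv : ℝ), 0 < κ → 0 < cI → 0 < cu → 0 < cl → 0 < cv →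
      ∃ L₀ > (0 : ℝ), ∀ L₁ ≥ L₀,
      ∃ c₃ > (0 : ℝ), ∃ c₄ > (0 : ℝ), ∃ c₅ > (0 : ℝ), ∃ c₆ > (0 : ℝ),
      ∃ c₁ > (0 : ℝ), ∃ c₂ > (0 : ℝ),
      ∀ (Ω : ℕ → Type*) [∀ n, MeasurableSpace (Ω n)]
        (P : ∀ n, Measure (Ω n)) [∀ n, IsProbabilityMeasure (P n)]
        (p s : ℕ → ℕ) (M : ∀ n, ChangePoint.Model n (p n) (Ω n)) (k : ℝ)
        (l τi lam μ u v u₀ r : ℕ → ℝ) (βhat γhat : ∀ n, Ω n → ChangePoint.Vec (p n)),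
        ChangePoint.BasicAssumptions P M s l τi C κ φ cI →
        ChangePoint.ChangeAssumptions M s l τi k cu cl cξ →
        (∀ n, u₀ n = ChangePoint.initRadius cu k n (p n) (s n) (l n)) →
        (∀ n, r n = ChangePoint.estRate (M n) (s n) (u₀ n)) →
        (∀ n ≥ 1, L₀ * max (√(Real.log (p n) / n)) ((M n).jump * u₀ n) ≤ lam n ∧
          lam n ≤ L₁ * max (√(Real.log (p n) / n)) ((M n).jump * u₀ n)) →
        (∀ n ≥ 1, ∀ ω, (M n).IsInitialEstimate (lam n) (τi n) ω (βhat n ω) (γhat n ω)) →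
        (∀ n ≥ 1, 0 < μ n) →
        (∀ n ≥ 1, 0 ≤ u n) →
        (∀ n ≥ 1, cv * (Real.log (p n) / n) ≤ v n) →
        ∀ᶠ n : ℕ in atTop,
          P n {ω | ¬ ((((M n).jump ^ 2 *
                (c₃ * v n
                  - c₄ * (s n * Real.log (p n) / n)
                  - c₅ / max 1 (M n).jump * √(s n * Real.log (p n) / n) *
                      max (√(Real.log (p n) / n)) (√(u n))
                  - c₆ * (r n ^ 2 / max 1 ((M n).jump ^ 2)) * max (s n * Real.log (p n) / n) (u n)
                  - cμ * μ n / max 1 ((M n).jump ^ 2) *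
                      ChangePoint.F u (fun m => (M m).PhiMin (M m).τ₀)) : ℝ) : EReal) ≤
              ⨅ τ ∈ (M n).H (u n) (v n),
                (((M n).S (μ n) ω (τ : ℝ) (βhat n ω) (γhat n ω) : ℝ) : EReal))}
            ≤ ENNReal.ofReal (c₁ * Real.exp (-c₂ * Real.log (p n)))) := by
  refine ⟨fun C κ φ cI hκ hcI => ?_, fun cξ hcξ => ?_⟩
  · refine ⟨8 * ChangePoint.Model.devConst C, mul_pos (by norm_num) (ChangePoint.Model.devConst_pos C),
      fun L₁ hL₁ => ?_⟩
    have hL₁0 : 0 < L₁ := (mul_pos (by norm_num) (ChangePoint.Model.devConst_pos C)).trans_le hL₁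
    refine ⟨_, ChangePoint.Model.noChangeConst_pos (C := C) hκ hL₁0, 14, by norm_num, 1, one_pos,
      ?_⟩
    intro Ω _ P _ p s M l τi lam μ v βhat γhat hb hΦ hlam hest hμ hv
    obtain ⟨δ, hδ, hls⟩ := ChangePoint.exists_largeSample C hκ hcI
    filter_upwards [eventually_ge_atTop 1, hb.dimensions_l.eventually_le_const hδ] with n hn hδn
    -- If `p ≤ 1` then `log p = 0`, and the claimed failure probability is at least one.
    rcases le_or_gt (p n) 1 with hp | hp
    · refine ChangePoint.holdsExcept_of_one_le ?_
      rw [ChangePoint.log_natCast_eq_zero_of_le_one hp]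
      norm_num
    have hl := hls hn hp (hb.one_le_s n hn) (hb.l_pos n hn) (hb.l_le n hn) (hb.init_boundary n hn)
      hδn
    have hm : 0 < (M n).PhiMin (τi n) :=
      (mul_pos hcI (hb.l_pos n hn)).trans_le (hb.init_boundary n hn)
    have := (hb.distributions n hn).no_change_bound hκ hl hm (hb.sparsity n hn) (hΦ n hn) hL₁0
      (hlam n hn).1 (hlam n hn).2 (hest n hn) (hv n hn) (μ := μ n)
    rw [neg_one_mul]
    exact this.le_iInf
  · refine ⟨max 1 (1 / cξ ^ 2), by positivity, fun C κ φ cI cu cl cv hκ hcI hcu hcl hcv => ?_⟩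
    have hA := ChangePoint.Model.devConst_pos C
    have hB : 0 ≤ 1 / min 1 cu := by positivity
    have hL₀ : 0 < 8 * ChangePoint.Model.devConst C * (3 + 2 * (1 / min 1 cu)) := by positivity
    refine ⟨_, hL₀, fun L₁ hL₁ => ?_⟩
    have hL₁0 : 0 < L₁ := hL₀.trans_le hL₁
    -- The term with `c₄` is mere slack, so any positive value would do; `1` is taken.
    refine ⟨κ / 8, by positivity, 1, one_pos, ChangePoint.Model.crossConst C κ L₁ cξ,
      ChangePoint.Model.crossConst_pos hκ hL₁0, ChangePoint.Model.quadConst C κ L₁ cξ,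
      ChangePoint.Model.quadConst_pos hκ hL₁0, 33, by norm_num,
      ChangePoint.Model.segmentRate C κ cv, ChangePoint.Model.segmentRate_pos C hκ hcv, ?_⟩
    intro Ω _ P _ p s M k l τi lam μ u v u₀ r βhat γhat hb hc hu₀ hr hlam hest hμ hu hv
    obtain ⟨δ, hδ, hls⟩ := ChangePoint.exists_largeSample C hκ hcI
    obtain ⟨δ', hδ', hlc⟩ := ChangePoint.exists_largeSampleChange hcu hcl hcξ
    -- If `F` vanishes, eventually `u n < Φ_min(τ₀)`, so `Φ(τ) > 0` on the collection `H` and the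
    -- penalties cancel. Otherwise the penalty can drop by `μ`, and the term with `cμ` pays for it.
    have hF : ∀ᶠ n in atTop, ChangePoint.F u (fun m => (M m).PhiMin (M m).τ₀) = 1 ∨
        u n < (M n).PhiMin (M n).τ₀ := by
      unfold ChangePoint.F
      split_ifs with ht
      · filter_upwards [eventually_ge_atTop 1, ht.eventually_lt_const one_pos] with n hn h1
        exact Or.inr ((div_lt_one (hc.change n hn)).1 h1)
      · exact Eventually.of_forall fun _ => Or.inl rfl
    have hF0 : 0 ≤ ChangePoint.F u (fun m => (M m).PhiMin (M m).τ₀) := by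
      unfold ChangePoint.F
      split_ifs <;> norm_num
    filter_upwards [eventually_ge_atTop 1, hb.dimensions_l.eventually_le_const hδ,
      hb.dimensions_l.eventually_le_const hδ', hc.dimensions_k.eventually_le_const hδ', hF]
      with n hn hδn hδn' hδk hFn
    rcases le_or_gt (p n) 1 with hp | hp
    · refine ChangePoint.holdsExcept_of_one_le ?_
      rw [ChangePoint.log_natCast_eq_zero_of_le_one hp]
      norm_num
    have hl := hls hn hp (hb.one_le_s n hn) (hb.l_pos n hn) (hb.l_le n hn) (hb.init_boundary n hn)
      hδn
    have hlcn := hlc hn (hb.one_le_s n hn) (hb.l_pos n hn) (hb.l_le n hn) hc.one_le_k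
      (hc.boundary n hn) (hc.jump_lower n hn) (hc.init_close n hn) hδn' hδk
    rw [← hu₀ n, ← hr n] at hlcn
    obtain ⟨t₀, ht₀⟩ := (M n).exists_coe_eq_of_PhiMin_pos (hc.change n hn)
    exact ((hb.distributions n hn).change_bound hκ hl hlcn ht₀ (hc.change n hn) (hb.sparsity n hn)
      hL₁0 hB hcξ (hc.jump_lower n hn).le (hlam n hn).1 (hlam n hn).2 (hest n hn) (hμ n hn).le
      (hu n hn) hcv (hv n hn) hF0 hFn).le_iInf
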